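/- Let $Q$ be a smooth (Hausdorff) manifold of finite dimension $n$, let $g$ be a smooth Riemannian metric on $Q$, let $V:Q\to\mathbb{R}$ be smooth, and let $L(q,v)=\tfrac12 g_q(v,v)-V(q)$ be the natural Lagrangian with Hamiltonian $H:T^*Q\to\mathbb{R}$, $H(q,p)=p(v)-L(q,v)$ where $p=g_q(v,\cdot)$. Let $\omega=dq^i\wedge dp_i$ be the canonical symplectic form of $T^*Q$ and $X_H$ the Hamiltonian vector field, $i_{X_H}\omega=dH$. Let $h:Q\to\mathbb{R}$ be smooth with $dh\neq 0$ on $\{h=0\}$, let $\nabla h$ be its $g$-gradient, and let $$S^*=\{(q,p)\in T^*Q : h(q)=0,\ p(\nabla h)<0\}.$$ Let $\Delta:S^*\to T^*Q$ be a Weierstrass–Erdmann impact map, that is, $\Delta(q,p)=(q,p^+)$ with $$p^+=p+\varepsilon\,dh_q\ \text{ for some } \varepsilon=\varepsilon(q,p)\in\mathbb{R},\qquad H(q,p^+)=H(q,p),$$ and $S^*\cap\Delta(S^*)=\emptyset$ (which excludes the trivial solution $\varepsilon=0$). The unconstrained Hamiltonian impact system is $\mathcal{H}=(T^*Q,S^*,X_H,\Delta)$.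 For $t\ge 0$ let $\varphi_t^{\mathcal{H}}$ be the (partially defined) hybrid flow: $\varphi_t^{\mathcal{H}}(x)=y$ if the trajectory that starts at $x$, follows integral curves of $X_H$ and is reset by $\Delta$ whenever it meets $S^*$, reaches $y$ at time $t$ after finitely many impacts, where the trajectory never meets $\overline{S^*}\setminus S^*$ (no grazing) and neither time $0$ nor time $t$ is an impact time. A differential form $\alpha$ on $T^*Q$ is called hybrid-invariant if $(\varphi_t^{\mathcal{H}})^*\alpha=\alpha$ for all $t\ge 0$; explicitly, if $\varphi_t^{\mathcal{H}}$ is defined at $x$, then it is defined on a neighbourhood of $x$, is differentiable at $x$, and $\alpha_{\varphi_t^{\mathcal{H}}(x)}\big(D\varphi_t^{\mathcal{H}}(x)v_1,\dots,D\varphi_t^{\mathcal{H}}(x)v_m\big)=\alpha_x(v_1,\dots,v_m)$ for all tangent vectors $v_1,\dots,v_m$ at $x$. Let $\mathscr{A}_{\mathcal{H}}$ denote the set of all smooth hybrid-invariant differential forms on $T^*Q$. Then $\omega\in\mathscr{A}_{\mathcal{H}}$ and $\omega^n=\omega\wedge\cdots\wedge\omega\in\mathscr{A}_{\mathcal{H}}$.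 -/

import Mathlib

open Set Filter Topology Bundle Manifold
open scoped ContDiff

namespace HybridImpact

noncomputable section

/-! ### Exterior algebra of alternating forms -/

section Wedge

variable {W : Type*} [AddCommGroup W] [Module ℝ W] [TopologicalSpace W]

/-- The tensor product `α ⊗ β` of two alternating forms: `α` is fed the first `k` vectors, `β` the
last `l`. -/
def tensorForm {k l : ℕ} (α : W [⋀^Fin k]→L[ℝ] ℝ) (β : W [⋀^Fin l]→L[ℝ] ℝ) :
    ContinuousMultilinearMap ℝ (fun _ : Fin (k + l) => W) ℝ where
  toFun v := α (fun i => v (Fin.castAdd l i)) * β (fun j => v (Fin.natAdd k j))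
  map_update_add' := by
    intro inst v i x y
    have hinst : inst = instDecidableEqFin (k + l) := Subsingleton.elim _ _
    subst hinst
    induction i using Fin.addCases with
    | left i =>
      have h1 : ∀ z : W, (fun a => Function.update v (Fin.castAdd l i) z (Fin.castAdd l a))
          = Function.update (fun a => v (Fin.castAdd l a)) i z := fun z =>
        Function.update_comp_eq_of_injective v (Fin.castAdd_injective k l) i z
      have h2 : ∀ z : W, (fun a => Function.update v (Fin.castAdd l i) z (Fin.natAdd k a))
          = (fun a => v (Fin.natAdd k a)) := fun z => by
        funext a
        exact Function.update_of_ne (by simp [Fin.ext_iff]; omega) _ _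
      simp only [h1, h2, α.map_update_add, add_mul]
    | right i =>
      have h1 : ∀ z : W, (fun a => Function.update v (Fin.natAdd k i) z (Fin.natAdd k a))
          = Function.update (fun a => v (Fin.natAdd k a)) i z := fun z =>
        Function.update_comp_eq_of_injective v (Fin.natAdd_injective l k) i z
      have h2 : ∀ z : W, (fun a => Function.update v (Fin.natAdd k i) z (Fin.castAdd l a))
          = (fun a => v (Fin.castAdd l a)) := fun z => by
        funext a
        exact Function.update_of_ne (by simp [Fin.ext_iff]; omega) _ _
      simp only [h1, h2, β.map_update_add, mul_add]
  map_update_smul' := by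
    intro inst v i c x
    have hinst : inst = instDecidableEqFin (k + l) := Subsingleton.elim _ _
    subst hinst
    induction i using Fin.addCases with
    | left i =>
      have h1 : ∀ z : W, (fun a => Function.update v (Fin.castAdd l i) z (Fin.castAdd l a))
          = Function.update (fun a => v (Fin.castAdd l a)) i z := fun z =>
        Function.update_comp_eq_of_injective v (Fin.castAdd_injective k l) i z
      have h2 : ∀ z : W, (fun a => Function.update v (Fin.castAdd l i) z (Fin.natAdd k a))
          = (fun a => v (Fin.natAdd k a)) := fun z => by
        funext a
        exact Function.update_of_ne (by simp [Fin.ext_iff]; omega) _ _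
      simp only [h1, h2, α.map_update_smul, smul_eq_mul, mul_assoc]
    | right i =>
      have h1 : ∀ z : W, (fun a => Function.update v (Fin.natAdd k i) z (Fin.natAdd k a))
          = Function.update (fun a => v (Fin.natAdd k a)) i z := fun z =>
        Function.update_comp_eq_of_injective v (Fin.natAdd_injective l k) i z
      have h2 : ∀ z : W, (fun a => Function.update v (Fin.natAdd k i) z (Fin.castAdd l a))
          = (fun a => v (Fin.castAdd l a)) := fun z => by
        funext a
        exact Function.update_of_ne (by simp [Fin.ext_iff]; omega) _ _
      simp only [h1, h2, β.map_update_smul, smul_eq_mul, mul_left_comm]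
  cont := by
    refine (α.cont.comp ?_).mul (β.cont.comp ?_) <;> fun_prop

/-- The wedge product `α ∧ β = (1 / (k! l!)) ∑_σ sgn(σ) (α ⊗ β) ∘ σ`. -/
def wedge {k l : ℕ} (α : W [⋀^Fin k]→L[ℝ] ℝ) (β : W [⋀^Fin l]→L[ℝ] ℝ) :
    W [⋀^Fin (k + l)]→L[ℝ] ℝ :=
  (((k.factorial : ℝ) * (l.factorial : ℝ))⁻¹) •
    ContinuousMultilinearMap.alternatization (tensorForm α β)

/-- The wedge powers `σ^k = σ ∧ ⋯ ∧ σ` of a `2`-form, with `σ^0 = 1`. -/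
def wedgePow (σ : W [⋀^Fin 2]→L[ℝ] ℝ) : (k : ℕ) → W [⋀^Fin (2 * k)]→L[ℝ] ℝ
  | 0 => ContinuousAlternatingMap.constOfIsEmpty ℝ W (Fin 0) (1 : ℝ)
  | k + 1 => wedge (wedgePow σ k) σ

end Wedge

/-! ### Hybrid systems and hybrid-invariant forms -/

section Hybrid

variable {E' : Type*} [NormedAddCommGroup E'] [NormedSpace ℝ E']
  {H' : Type*} [TopologicalSpace H'] (I : ModelWithCorners ℝ E' H')
  (M : Type*) [TopologicalSpace M] [ChartedSpace H' M]

/-- The data `(M, S, X, Δ)` of a hybrid system: impact surface, continuous dynamics and impact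
map. -/
structure HybridSystem where
  /-- the impact surface -/
  S : Set M
  /-- the continuous dynamics -/
  X : (x : M) → TangentSpace I x
  /-- the impact map -/
  Δ : S → M

variable {I M}

/-- `𝓗.Flow t x y` says that `φ_t^𝓗(x) = y`: the hybrid trajectory that starts at `x` follows
integral curves of `X`, is reset by `Δ` each time it meets `S`, undergoes finitely many impacts
during `[0, t]`, and is at `y` at time `t`. As is usual for the smoothness of the hybrid flow, `S`
is never entered through `closure S \ S` (no grazing), and neither `0` nor `t` is an impact time. -/
inductive HybridSystem.Flow (𝓗 : HybridSystem I M) : ℝ → M → M → Prop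
  | smooth {t : ℝ} {γ : ℝ → M} (ht : 0 ≤ t)
      (hγ : IsMIntegralCurveOn γ 𝓗.X (Icc 0 t))
      (hS : ∀ s ∈ Icc 0 t, γ s ∉ closure 𝓗.S) :
      HybridSystem.Flow 𝓗 t (γ 0) (γ t)
  | impact {t₁ t₂ : ℝ} {γ : ℝ → M} {y : M} (ht₁ : 0 < t₁) (ht₂ : 0 < t₂)
      (hγ : IsMIntegralCurveOn γ 𝓗.X (Icc 0 t₁))
      (hS : ∀ s ∈ Ico 0 t₁, γ s ∉ closure 𝓗.S)
      (hit : γ t₁ ∈ 𝓗.S)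
      (next : HybridSystem.Flow 𝓗 t₂ (𝓗.Δ ⟨γ t₁, hit⟩) y) :
      HybridSystem.Flow 𝓗 (t₁ + t₂) (γ 0) y

variable {ι : Type*}

/-- `(φ_t^𝓗)^* α = α` for all times: at every point `x` from which the hybrid flow is defined up to
time `t`, the map `φ_t^𝓗` is defined on a neighbourhood of `x`, is differentiable at `x`, and pulls
`α` back to `α`. -/
def HybridSystem.IsInvariant (𝓗 : HybridSystem I M)
    (α : (x : M) → (TangentSpace I x) [⋀^ι]→L[ℝ] ℝ) : Prop :=
  ∀ (t : ℝ) (x y : M), 𝓗.Flow t x y →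
    ∃ φ : M → M, (∀ᶠ z in 𝓝 x, 𝓗.Flow t z (φ z)) ∧ MDifferentiableAt I I φ x ∧
      (α (φ x)).compContinuousLinearMap (mfderiv I I φ x) = α x

/-- Smoothness of a differential form on a manifold without boundary: in every preferred chart its
components are smooth. -/
def IsSmoothForm [I.Boundaryless] (α : (x : M) → (TangentSpace I x) [⋀^ι]→L[ℝ] ℝ) : Prop :=
  ∀ (x₀ : M) (v : ι → E'),
    ContDiffOn ℝ ∞ (fun y : E' => α ((extChartAt I x₀).symm y)
      (fun i => mfderiv 𝓘(ℝ, E') I (extChartAt I x₀).symm y (v i))) (extChartAt I x₀).target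

/-- The set `𝒜_𝓗` of hybrid-invariant differential forms. -/
def HybridSystem.invariantForms [I.Boundaryless] (𝓗 : HybridSystem I M) (ι : Type*) :
    Set ((x : M) → (TangentSpace I x) [⋀^ι]→L[ℝ] ℝ) :=
  {α | IsSmoothForm α ∧ 𝓗.IsInvariant α}

end Hybrid

/-! ### Geometry of the cotangent bundle -/

section Cotangent

variable {E : Type*} [NormedAddCommGroup E] [NormedSpace ℝ E]

/-- The constant form `dq ∧ dp` on `E × E*`:
`(dq ∧ dp)((a, ξ), (b, η)) = η(a) - ξ(b)`. -/
def stdSymplectic (E : Type*) [NormedAddCommGroup E] [NormedSpace ℝ E] :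
    (E × (E →L[ℝ] ℝ)) [⋀^Fin 2]→L[ℝ] ℝ where
  toFun v := (v 1).2 (v 0).1 - (v 0).2 (v 1).1
  map_update_add' := by
    intro inst v i x y
    have hinst : inst = instDecidableEqFin 2 := Subsingleton.elim _ _
    subst hinst
    fin_cases i <;> simp <;> ring
  map_update_smul' := by
    intro inst v i c x
    have hinst : inst = instDecidableEqFin 2 := Subsingleton.elim _ _
    subst hinst
    fin_cases i <;> simp <;> ring
  cont := by
    fun_prop
  map_eq_zero_of_eq' := by
    intro v i j hv hij
    have h01 : v 0 = v 1 := by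
      fin_cases i <;> fin_cases j <;> simp_all
    simp [h01]

variable (E) in
/-- The cotangent bundle `T^*Q`, with Mathlib's structure of a smooth vector bundle. Its preferred
chart at `x` is the canonical cotangent chart `(q^i, p_i)` induced by the chart of `Q` at `x.proj`. -/
abbrev Cotangent (Q : Type*) [TopologicalSpace Q] [ChartedSpace E Q]
    [IsManifold 𝓘(ℝ, E) ∞ Q] : Type _ :=
  TotalSpace (E →L[ℝ] ℝ) (fun q : Q => TangentSpace 𝓘(ℝ, E) q →L[ℝ] ℝ)

variable (E) in
/-- The model with corners of `T^*Q`. -/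
abbrev cotModel : ModelWithCorners ℝ (E × (E →L[ℝ] ℝ)) (ModelProd E (E →L[ℝ] ℝ)) :=
  𝓘(ℝ, E).prod 𝓘(ℝ, E →L[ℝ] ℝ)

variable {Q : Type*} [TopologicalSpace Q] [ChartedSpace E Q] [IsManifold 𝓘(ℝ, E) ∞ Q]

/-- The derivative at `x`, as a map `T_x(T^*Q) → E × E*`, of the canonical cotangent chart at `x`. -/
def chartDeriv (x : Cotangent E Q) : TangentSpace (cotModel E) x →L[ℝ] (E × (E →L[ℝ] ℝ)) :=
  mfderiv (cotModel E) 𝓘(ℝ, E × (E →L[ℝ] ℝ)) (extChartAt (cotModel E) x) x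

/-- The canonical symplectic form `ω = dq^i ∧ dp_i` of `T^*Q`: at `x` it is the pullback of the
constant form `dq ∧ dp` under the canonical cotangent chart at `x`. -/
def canonicalSymplectic (x : Cotangent E Q) :
    (TangentSpace (cotModel E) x) [⋀^Fin 2]→L[ℝ] ℝ :=
  (stdSymplectic E).compContinuousLinearMap (chartDeriv x)

/-- The exterior power `ω^k` of the canonical symplectic form. -/
def liouvillePower (k : ℕ) (x : Cotangent E Q) :
    (TangentSpace (cotModel E) x) [⋀^Fin (2 * k)]→L[ℝ] ℝ :=
  wedgePow (canonicalSymplectic x) k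

theorem exists_stdSymplectic_eq [FiniteDimensional ℝ E] (L : (E × (E →L[ℝ] ℝ)) →L[ℝ] ℝ) :
    ∃ u, ∀ v, stdSymplectic E ![u, v] = L v := by
  let F : (E × (E →L[ℝ] ℝ)) →ₗ[ℝ] Module.Dual ℝ (E × (E →L[ℝ] ℝ)) :=
    LinearMap.mk₂ ℝ (fun u v => v.2 u.1 - u.2 v.1)
      (by intros; simp; ring) (by intros; simp; ring) (by intros; simp; ring)
      (by intros; simp; ring)
  have hF : Function.Injective F := by
    refine (injective_iff_map_eq_zero F).2 fun u hu => ?_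
    have h : ∀ v : E × (E →L[ℝ] ℝ), v.2 u.1 - u.2 v.1 = 0 := fun v => LinearMap.congr_fun hu v
    have h2 : u.2 = 0 := by
      ext a
      have := h (a, 0)
      simp at this
      simpa using this
    have h1 : u.1 = 0 := by
      refine (Module.forall_dual_apply_eq_zero_iff ℝ u.1).1 fun f => ?_
      simpa using h (0, LinearMap.toContinuousLinearMap f)
    exact Prod.ext h1 h2
  have hS : Function.Surjective F :=
    (LinearMap.injective_iff_surjective_of_finrank_eq_finrank
      (Subspace.dual_finrank_eq (K := ℝ) (V := E × (E →L[ℝ] ℝ))).symm).1 hF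
  obtain ⟨u, hu⟩ := hS (L : (E × (E →L[ℝ] ℝ)) →ₗ[ℝ] ℝ)
  exact ⟨u, fun v => LinearMap.congr_fun hu v⟩

theorem exists_hamiltonianVector [FiniteDimensional ℝ E] (x : Cotangent E Q)
    (L : TangentSpace (cotModel E) x →L[ℝ] ℝ) :
    ∃ u : TangentSpace (cotModel E) x, ∀ v : TangentSpace (cotModel E) x,
      canonicalSymplectic x ![u, v] = L v := by
  have hinv : (chartDeriv x).IsInvertible := isInvertible_mfderiv_extChartAt (I := cotModel E)
    (mem_extChartAt_source (I := cotModel E) x)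
  obtain ⟨A, hA⟩ := hinv
  obtain ⟨u, hu⟩ := exists_stdSymplectic_eq
    (L.comp (A.symm : (E × (E →L[ℝ] ℝ)) →L[ℝ] TangentSpace (cotModel E) x))
  refine ⟨A.symm u, fun v => ?_⟩
  have h := hu (A v)
  rw [canonicalSymplectic, ← hA, ContinuousAlternatingMap.compContinuousLinearMap_apply]
  have hv : (⇑(A : TangentSpace (cotModel E) x →L[ℝ] (E × (E →L[ℝ] ℝ))) ∘ ![A.symm u, v]) = ![u, A v] := by
    funext i
    fin_cases i
    · exact A.apply_symm_apply u
    · rfl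
  rw [hv]
  simpa using h

/-- The Hamiltonian vector field `X_H` of `H : T^*Q → ℝ`, determined by `i_{X_H} ω = dH`. -/
def hamiltonianVectorField [FiniteDimensional ℝ E] (H : Cotangent E Q → ℝ) (x : Cotangent E Q) :
    TangentSpace (cotModel E) x :=
  (exists_hamiltonianVector x (mfderiv (cotModel E) 𝓘(ℝ, ℝ) H x)).choose

theorem canonicalSymplectic_hamiltonianVectorField [FiniteDimensional ℝ E]
    (H : Cotangent E Q → ℝ) (x : Cotangent E Q) (v : TangentSpace (cotModel E) x) :
    canonicalSymplectic x ![hamiltonianVectorField H x, v] =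
      mfderiv (cotModel E) 𝓘(ℝ, ℝ) H x v :=
  (exists_hamiltonianVector x (mfderiv (cotModel E) 𝓘(ℝ, ℝ) H x)).choose_spec v

end Cotangent

/-! ### Natural mechanical systems with impacts -/

section Mechanics

variable {E : Type*} [NormedAddCommGroup E] [NormedSpace ℝ E]
  {Q : Type*} [TopologicalSpace Q] [ChartedSpace E Q] [IsManifold 𝓘(ℝ, E) ∞ Q]

variable (E Q) in
/-- Smooth Riemannian metrics on `Q`. -/
abbrev Metric : Type _ :=
  ContMDiffRiemannianMetric 𝓘(ℝ, E) ∞ E (fun q : Q => TangentSpace 𝓘(ℝ, E) q)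

/-- The natural Lagrangian `L(q, v) = g_q(v, v) / 2 - V(q)`. -/
def lagrangian (g : Metric E Q) (V : Q → ℝ) (q : Q) (v : TangentSpace 𝓘(ℝ, E) q) : ℝ :=
  g.inner q v v / 2 - V q

/-- The inverse of the fibre derivative `v ↦ g_q(v, ·)` of a natural Lagrangian; `Q` being
finite-dimensional, the fibre derivative is invertible. -/
def sharp (g : Metric E Q) (q : Q) (p : TangentSpace 𝓘(ℝ, E) q →L[ℝ] ℝ) :
    TangentSpace 𝓘(ℝ, E) q :=
  (g.inner q).inverse p

/-- The Hamiltonian `H(q, p) = p(v) - L(q, v)`, `p = g_q(v, ·)`, of a natural Lagrangian. -/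
def hamiltonian (g : Metric E Q) (V : Q → ℝ) (x : Cotangent E Q) : ℝ :=
  x.2 (sharp g x.proj x.2) - lagrangian g V x.proj (sharp g x.proj x.2)

/-- The differential `dh_q` as a covector. -/
def differential (h : Q → ℝ) (q : Q) : TangentSpace 𝓘(ℝ, E) q →L[ℝ] ℝ :=
  mfderiv 𝓘(ℝ, E) 𝓘(ℝ, ℝ) h q

/-- The gradient `∇h = (dh)^♯`. -/
def gradient (g : Metric E Q) (h : Q → ℝ) (q : Q) : TangentSpace 𝓘(ℝ, E) q :=
  sharp g q (differential h q)

/-- The impact surface `S^* = {(q, p) ∈ T^*Q : h(q) = 0, p(∇h) < 0}`. -/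
def impactSurface (g : Metric E Q) (h : Q → ℝ) : Set (Cotangent E Q) :=
  {x | h x.proj = 0 ∧ x.2 (gradient g h x.proj) < 0}

/-- `Δ : S^* → T^*Q` is a Weierstrass–Erdmann impact map: it is the identity on the base and
satisfies the corner conditions `p⁺ = p⁻ + ε dh` and `H⁺ = H⁻` for some multiplier `ε`. As for every
hybrid system, `S^*` and `Δ(S^*)` are disjoint; this rules out the trivial solution `ε = 0`. -/
structure IsWeierstrassErdmann (g : Metric E Q) (V h : Q → ℝ)
    (Δ : impactSurface g h → Cotangent E Q) : Prop where
  momentum : ∀ x : impactSurface g h, ∃ ε : ℝ,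
    Δ x = ⟨x.1.proj, x.1.2 + ε • differential h x.1.proj⟩
  energy : ∀ x : impactSurface g h, hamiltonian g V (Δ x) = hamiltonian g V x.1
  disjoint : ∀ x : impactSurface g h, Δ x ∉ impactSurface g h

/-- The unconstrained Hamiltonian impact system `(T^*Q, S^*, X_H, Δ)`. -/
def impactSystem [FiniteDimensional ℝ E] (g : Metric E Q) (V h : Q → ℝ)
    (Δ : impactSurface g h → Cotangent E Q) :
    HybridSystem (cotModel E) (Cotangent E Q) where
  S := impactSurface g h
  X := hamiltonianVectorField (hamiltonian g V)
  Δ := Δ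

end Mechanics

end

end HybridImpact

/-! A hybrid trajectory alternates between arcs of the Hamiltonian flow and impacts, so it suffices
that both kinds of step preserve `ω`. Along an arc, the derivative `Y` of the flow solves the
variational equation `Y' = Df · Y`. In a cotangent chart `ω` is the constant form `B`, and `B (f, ·)
= DH` makes `B (Df ·, ·)` the symmetric second derivative of `H`. Hence `B (Y u, Y v)` is constant
in time (`exists_isLocalFlow`, `compContinuousLinearMap_eq_of_variation`).

The corner conditions force `Δ` to be the reflection `R` along `dh`
(`IsWeierstrassErdmann.apply_eq`). Nearby trajectories hit the surface at different times, so
differentiating the flow at a fixed time differentiates not `R` but `J z = Ψ (R (Φ z (τ z))) (-τ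
z)`: run to the surface for the signed time `τ z`, reset, run back for the same time. With `a`, `b`
the field before and after the impact, its derivative is `u ↦ R' (u + τ' u • a) - τ' u • b`. Three
facts make it symplectic (`bilin_impact_eq`). The vectors `u + τ' u • a` are tangent to `h = 0`. On
such vectors `R'` preserves `ω`, because translating `p` by `m • dh` changes `ω` by `dh ∧ dm`.
Finally `R` preserves `H`, that is `B b (R' u) = B a u`, and the terms in `τ'` cancel.

Since `p(∇h) < 0` on `S^*`, the function `h` decreases strictly at an impact; this gives a
differentiable hitting time by the implicit function theorem. After the reset `p(∇h) > 0`, so the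
trajectory leaves without meeting `closure S^*`. `hasRegularImpacts_impactSystem` collects these
facts, and `HybridSystem.Flow.preservesAlong` glues the steps by induction on the impacts. The
powers of `ω` follow, as pullback commutes with the wedge product. -/

namespace HybridImpact

noncomputable section

/-! ### Local flows in a normed space and their derivatives in the initial value -/

section LocalFlow

open Metric ODE
open scoped NNReal

variable {W : Type*} [NormedAddCommGroup W] [NormedSpace ℝ W]

/-- `Φ` is a flow of the vector field `f` with values in `U`, defined on the ball of radius `r`
around `x₀` for times in `[-ε, ε]`, which is differentiable in the initial value with derivative
solving the variational equation, and strictly differentiable at `(x₀, 0)`. -/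
structure IsLocalFlow (f : W → W) (x₀ : W) (U : Set W) (r ε : ℝ) (Φ : W → ℝ → W) : Prop where
  r_pos : 0 < r
  eps_pos : 0 < ε
  init : ∀ z ∈ ball x₀ r, Φ z 0 = z
  mem : ∀ z ∈ ball x₀ r, ∀ t ∈ Icc (-ε) ε, Φ z t ∈ U
  deriv : ∀ z ∈ ball x₀ r, ∀ t ∈ Icc (-ε) ε,
    HasDerivWithinAt (Φ z) (f (Φ z t)) (Icc (-ε) ε) t
  variation : ∀ z ∈ ball x₀ r, ∃ Y : ℝ → W →L[ℝ] W, Y 0 = ContinuousLinearMap.id ℝ W ∧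
    (∀ t ∈ Icc (-ε) ε,
      HasDerivWithinAt Y (fderiv ℝ f (Φ z t) ∘L Y t) (Icc (-ε) ε) t) ∧
    ∀ t ∈ Icc (-ε) ε, HasFDerivAt (fun z => Φ z t) (Y t) z
  strict : HasStrictFDerivAt (fun p : W × ℝ => Φ p.1 p.2)
    (ContinuousLinearMap.fst ℝ W ℝ + (ContinuousLinearMap.snd ℝ W ℝ).smulRight (f x₀)) (x₀, 0)

/-- Grönwall's inequality on a symmetric interval, for functions that vanish at `0`. -/
theorem norm_le_gronwallBound_of_norm_deriv_le_Icc {u u' : ℝ → W} {K C ε : ℝ} (hε : 0 < ε)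
    (h0 : u 0 = 0) (hu : ∀ t ∈ Icc (-ε) ε, HasDerivWithinAt u (u' t) (Icc (-ε) ε) t)
    (hb : ∀ t ∈ Icc (-ε) ε, ‖u' t‖ ≤ K * ‖u t‖ + C) :
    ∀ t ∈ Icc (-ε) ε, ‖u t‖ ≤ gronwallBound 0 K C |t| := by
  have right : ∀ {v v' : ℝ → W}, v 0 = 0 →
      (∀ t ∈ Icc (-ε) ε, HasDerivWithinAt v (v' t) (Icc (-ε) ε) t) →
      (∀ t ∈ Icc (-ε) ε, ‖v' t‖ ≤ K * ‖v t‖ + C) →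
      ∀ t ∈ Icc 0 ε, ‖v t‖ ≤ gronwallBound 0 K C t := by
    intro v v' hv0 hv hvb t ht
    have hsub : Icc 0 ε ⊆ Icc (-ε) ε := Icc_subset_Icc (by linarith) le_rfl
    have := norm_le_gronwallBound_of_norm_deriv_right_le (f := v) (f' := v') (δ := 0) (K := K)
      (ε := C) (a := 0) (b := ε)
      (fun s hs => ((hv s (hsub hs)).continuousWithinAt).mono hsub)
      (fun s hs => by
        refine (hv s ⟨by linarith [hs.1], hs.2.le⟩).mono_of_mem_nhdsWithin ?_
        exact mem_of_superset (Icc_mem_nhdsGE hs.2) (Icc_subset_Icc (by linarith [hs.1]) le_rfl))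
      (by simp [hv0]) (fun s hs => hvb s ⟨by linarith [hs.1], hs.2.le⟩) t ht
    simpa using this
  intro t ht
  rcases le_total 0 t with h | h
  · rw [abs_of_nonneg h]
    exact right h0 hu hb t ⟨h, ht.2⟩
  · rw [abs_of_nonpos h]
    -- Negative times are reduced to positive ones by reversing time.
    have := right (v := fun s => u (-s)) (v' := fun s => -u' (-s)) (by simp [h0])
      (fun s hs => by
        have h1 := hu (-s) ⟨by linarith [hs.2], by linarith [hs.1]⟩
        have h2 : HasDerivWithinAt (fun s : ℝ => -s) (-1) (Icc (-ε) ε) s :=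
          (hasDerivAt_neg s).hasDerivWithinAt
        have h3 := h1.scomp s h2 (fun x hx => ⟨by linarith [hx.2], by linarith [hx.1]⟩)
        simpa [Function.comp_def] using h3)
      (fun s hs => by simpa using hb (-s) ⟨by linarith [hs.2], by linarith [hs.1]⟩)
      (-t) ⟨by linarith, by linarith [ht.1]⟩
    simpa using this

/-- A `C²` map admits, near every point, uniform bounds on its values and first derivatives, and a
quadratic bound on its first order Taylor remainder. -/
theorem exists_closedBall_taylor_bounds {f : W → W} {x₀ : W} (hf : ContDiffAt ℝ 2 f x₀)
    {U : Set W} (hU : U ∈ 𝓝 x₀) :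
    ∃ (a : ℝ) (M K C : ℝ≥0), 0 < a ∧ closedBall x₀ a ⊆ U ∧ (∀ x ∈ closedBall x₀ a, ‖f x‖ ≤ M) ∧
      (∀ x ∈ closedBall x₀ a, ‖fderiv ℝ f x‖ ≤ K) ∧
      ContinuousOn (fderiv ℝ f) (closedBall x₀ a) ∧
      LipschitzOnWith K f (closedBall x₀ a) ∧
      ∀ x ∈ closedBall x₀ a, ∀ y ∈ closedBall x₀ a,
        ‖f x - f y - fderiv ℝ f y (x - y)‖ ≤ C * ‖x - y‖ ^ 2 := by
  have hf' : ContDiffAt ℝ 1 (fderiv ℝ f) x₀ := hf.fderiv_right (by norm_num)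
  obtain ⟨C, s, hs, hC⟩ := hf'.exists_lipschitzOnWith
  have hd : ∀ᶠ x in 𝓝 x₀, DifferentiableAt ℝ f x := by
    filter_upwards [hf.eventually (by simp)] with x hx
    exact hx.differentiableAt (by simp)
  have hM : ∀ᶠ x in 𝓝 x₀, ‖f x‖ < ‖f x₀‖ + 1 :=
    hf.continuousAt.norm.eventually_lt_const (by linarith)
  have hK : ∀ᶠ x in 𝓝 x₀, ‖fderiv ℝ f x‖ < ‖fderiv ℝ f x₀‖ + 1 :=
    hf'.continuousAt.norm.eventually_lt_const (by linarith)
  obtain ⟨a, ha, h⟩ := nhds_basis_closedBall.mem_iff.1 (inter_mem hU (inter_mem hs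
    (inter_mem hd (inter_mem hM hK))))
  have hK' : ∀ x ∈ closedBall x₀ a, ‖fderiv ℝ f x‖ ≤ ‖fderiv ℝ f x₀‖ + 1 :=
    fun x hx => (h hx).2.2.2.2.le
  refine ⟨a, ⟨‖f x₀‖ + 1, by positivity⟩, ⟨‖fderiv ℝ f x₀‖ + 1, by positivity⟩, C, ha,
    fun x hx => (h hx).1, fun x hx => (h hx).2.2.2.1.le, hK', ?_, ?_, ?_⟩
  · exact hC.continuousOn.mono fun x hx => (h hx).2.1
  · exact (convex_closedBall x₀ a).lipschitzOnWith_of_nnnorm_fderiv_le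
      (fun x hx => (h hx).2.2.1) (fun x hx => hK' x hx)
  · intro x hx y hy
    have hseg : segment ℝ y x ⊆ closedBall x₀ a := (convex_closedBall x₀ a).segment_subset hy hx
    -- Mean value inequality for `f` minus its linear part at `y`: on the segment the derivative
    -- differs from `fderiv ℝ f y` by at most `C * ‖x - y‖`, as `fderiv ℝ f` is `C`-Lipschitz.
    have := (convex_segment y x).norm_image_sub_le_of_norm_hasFDerivWithin_le'
      (f := f) (f' := fderiv ℝ f) (φ := fderiv ℝ f y) (C := C * ‖x - y‖)
      (fun z hz => ((h (hseg hz)).2.2.1 : DifferentiableAt ℝ f z).hasFDerivAt.hasFDerivWithinAt)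
      (fun z hz => by
        refine (hC.norm_sub_le (h (hseg hz)).2.1 (h hy).2.1).trans ?_
        gcongr
        obtain ⟨θ, hθ, rfl⟩ := (segment_eq_image' ℝ y x ▸ hz :
          z ∈ (fun θ : ℝ => y + θ • (x - y)) '' Icc 0 1)
        rw [add_sub_cancel_left, norm_smul, Real.norm_of_nonneg hθ.1]
        exact mul_le_of_le_one_left (norm_nonneg _) hθ.2)
      (left_mem_segment ℝ y x) (right_mem_segment ℝ y x)
    calc _ ≤ _ := this
      _ = _ := by ring

end LocalFlow

section LocalFlow

open Metric ODE
open scoped NNReal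

variable {W : Type*} [NormedAddCommGroup W] [NormedSpace ℝ W] [CompleteSpace W]

/-- The flow of the Picard–Lindelöf theorem stays in the ball on which the vector field is
controlled. -/
theorem exists_flow_mem_closedBall {f : ℝ → W → W} {tmin tmax : ℝ} {t₀ : Icc tmin tmax} {x₀ : W}
    {a r L K : ℝ≥0} (hf : IsPicardLindelof f t₀ x₀ a r L K) :
    ∃ α : W → ℝ → W, (∀ x ∈ closedBall x₀ r, α x t₀ = x ∧
      (∀ t ∈ Icc tmin tmax, HasDerivWithinAt (α x) (f t (α x t)) (Icc tmin tmax) t) ∧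
      ∀ t, α x t ∈ closedBall x₀ a) ∧
      ∃ L' : ℝ≥0, ∀ t ∈ Icc tmin tmax, LipschitzOnWith L' (α · t) (closedBall x₀ r) := by
  classical
  have (x) (hx : x ∈ closedBall x₀ r) := FunSpace.exists_isFixedPt_next hf hx
  choose α hα using this
  -- `compProj` clamps the time to the interval, so the curves lie in the ball at every real time.
  -- The value `0` outside the initial ball is a default.
  set α' := fun (x : W) ↦ if hx : x ∈ closedBall x₀ r then
    α x hx |>.compProj else 0 with hα'
  refine ⟨α', fun x hx ↦ ⟨?_, fun t ht ↦ ?_, fun t => ?_⟩, ?_⟩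
  · rw [hα']
    beta_reduce
    rw [dif_pos hx, FunSpace.compProj_val, ← hα, FunSpace.next_apply₀]
  · rw [hα']
    beta_reduce
    rw [dif_pos hx, FunSpace.compProj_apply]
    apply hasDerivWithinAt_picard_Icc t₀.2 hf.continuousOn_uncurry
      (α x hx |>.continuous_compProj.continuousOn)
      (fun _ ht' ↦ α x hx |>.compProj_mem_closedBall hf.mul_max_le)
      x ht |>.congr_of_mem _ ht
    intro t' ht'
    nth_rw 1 [← hα]
    rw [FunSpace.compProj_of_mem ht', FunSpace.next_apply]
  · rw [hα']
    beta_reduce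
    rw [dif_pos hx]
    exact (α x hx).compProj_mem_closedBall hf.mul_max_le
  · obtain ⟨L', h⟩ := FunSpace.exists_forall_closedBall_funSpace_dist_le_mul hf
    refine ⟨L', fun t ht ↦ LipschitzOnWith.of_dist_le_mul fun x hx y hy ↦ ?_⟩
    simp_rw [hα']
    rw [dif_pos hx, dif_pos hy, FunSpace.compProj_apply, FunSpace.compProj_apply,
      ← FunSpace.toContinuousMap_apply_eq_apply, ← FunSpace.toContinuousMap_apply_eq_apply]
    have : Nonempty (Icc tmin tmax) := ⟨t₀⟩
    apply ContinuousMap.dist_le_iff_of_nonempty.mp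
    exact h x y hx hy (α x hx) (α y hy) (hα x hx) (hα y hy)

/-- A linear time-dependent equation `Y' = A(t) Y` has a solution with `Y(0) = id` on short
intervals. -/
theorem exists_linear_solution {A : ℝ → W →L[ℝ] W} {K : ℝ≥0} {ε : ℝ} (hε : 0 < ε)
    (hA : ContinuousOn A (Icc (-ε) ε)) (hK : ∀ t ∈ Icc (-ε) ε, ‖A t‖ ≤ K) (hKε : 2 * K * ε ≤ 1) :
    ∃ Y : ℝ → W →L[ℝ] W, Y 0 = ContinuousLinearMap.id ℝ W ∧
      ∀ t ∈ Icc (-ε) ε, HasDerivWithinAt Y (A t ∘L Y t) (Icc (-ε) ε) t := by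
  -- On the unit ball around the identity `‖Y‖ ≤ 2`, so the speed is at most `2 * K`, and `2 * K * ε
  -- ≤ 1` keeps solutions in that ball. A single initial value is needed, hence the initial radius
  -- `0`.
  have h : IsPicardLindelof (fun t (Y : W →L[ℝ] W) => A t ∘L Y) (tmin := -ε) (tmax := ε)
      ⟨0, by constructor <;> linarith⟩ (ContinuousLinearMap.id ℝ W) 1 0 (2 * K) K := by
    constructor
    · intro t ht
      refine LipschitzOnWith.of_dist_le_mul fun Y _ Z _ => ?_
      rw [dist_eq_norm, dist_eq_norm, ← ContinuousLinearMap.comp_sub]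
      exact (ContinuousLinearMap.opNorm_comp_le _ _).trans (by gcongr; exact hK t ht)
    · intro Y _
      exact hA.clm_comp continuousOn_const
    · intro t ht Y hY
      have hY2 : ‖Y‖ ≤ 2 := by
        have h1 : ‖Y - ContinuousLinearMap.id ℝ W‖ ≤ 1 := by simpa [dist_eq_norm] using hY
        calc ‖Y‖ = ‖(Y - ContinuousLinearMap.id ℝ W) + ContinuousLinearMap.id ℝ W‖ := by simp
          _ ≤ 1 + 1 := (norm_add_le _ _).trans
            (add_le_add h1 ContinuousLinearMap.norm_id_le)
          _ = 2 := by norm_num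
      calc ‖A t ∘L Y‖ ≤ ‖A t‖ * ‖Y‖ := ContinuousLinearMap.opNorm_comp_le _ _
        _ ≤ K * 2 := by gcongr; exact hK t ht
        _ = _ := by push_cast; ring
    · simpa using hKε
  obtain ⟨Y, h0, hY⟩ := h.exists_eq_forall_mem_Icc_hasDerivWithinAt₀
  exact ⟨Y, h0, hY⟩

/-- The local flow of a `C²` vector field, with its first order dependence on initial values. -/
theorem exists_isLocalFlow {f : W → W} {x₀ : W} (hf : ContDiffAt ℝ 2 f x₀) {U : Set W}
    (hU : U ∈ 𝓝 x₀) : ∃ (r ε : ℝ) (Φ : W → ℝ → W), IsLocalFlow f x₀ U r ε Φ := by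
  obtain ⟨a, M, K, C, ha, haU, hM, hK, hcont, hlip, htay⟩ := exists_closedBall_taylor_bounds hf hU
  -- The first bound keeps trajectories from the half ball inside the ball of radius `a`; the second
  -- is what `exists_linear_solution` asks for. Adding `1` to the denominators covers `M = 0` and `K
  -- = 0`.
  obtain ⟨ε, hε, hεM, hεK⟩ : ∃ ε > 0, M * ε ≤ a / 2 ∧ 2 * K * ε ≤ 1 := by
    refine ⟨min (a / 2 / (M + 1)) (1 / (2 * K + 1)), by positivity, ?_, ?_⟩
    · calc M * min (a / 2 / (M + 1)) (1 / (2 * K + 1)) ≤ M * (a / 2 / (M + 1)) := by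
            gcongr; exact min_le_left _ _
        _ = M / (M + 1) * (a / 2) := by ring
        _ ≤ 1 * (a / 2) := by
            gcongr
            exact (div_le_one (by positivity)).2 (by linarith)
        _ = a / 2 := one_mul _
    · calc 2 * K * min (a / 2 / (M + 1)) (1 / (2 * K + 1)) ≤ 2 * K * (1 / (2 * K + 1)) := by
            gcongr; exact min_le_right _ _
        _ = 2 * K / (2 * K + 1) := by ring
        _ ≤ 1 := (div_le_one (by positivity)).2 (by linarith)
  have hPL : IsPicardLindelof (fun _ : ℝ => f) (tmin := -ε) (tmax := ε)
      ⟨0, by constructor <;> linarith⟩ x₀ ⟨a, ha.le⟩ ⟨a / 2, by positivity⟩ M K := by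
    refine IsPicardLindelof.of_time_independent hM hlip ?_
    simp only [sub_zero, zero_sub, neg_neg, max_self]
    change M * ε ≤ a - a / 2
    linarith
  obtain ⟨Φ, hΦ, L', hL'⟩ := exists_flow_mem_closedBall hPL
  change ∀ x ∈ closedBall x₀ (a / 2), Φ x 0 = x ∧ _ at hΦ
  have hmem : ∀ z ∈ closedBall x₀ (a / 2), ∀ t, Φ z t ∈ closedBall x₀ a :=
    fun z hz t => (hΦ z hz).2.2 t
  have hderiv : ∀ z ∈ closedBall x₀ (a / 2), ∀ t ∈ Icc (-ε) ε,
      HasDerivWithinAt (Φ z) (f (Φ z t)) (Icc (-ε) ε) t := fun z hz => (hΦ z hz).2.1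
  have hsub : ball x₀ (a / 2) ⊆ closedBall x₀ (a / 2) := ball_subset_closedBall
  have h0ε : (0 : ℝ) ∈ Icc (-ε) ε := ⟨by linarith, hε.le⟩
  have hx₀ : x₀ ∈ closedBall x₀ (a / 2) := mem_closedBall_self (by positivity)
  refine ⟨a / 2, ε, Φ, by positivity, hε, fun z hz => (hΦ z (hsub hz)).1,
    fun z hz t _ => haU (hmem z (hsub hz) t), fun z hz => hderiv z (hsub hz), ?_, ?_⟩
  · intro z₀ hz₀
    obtain ⟨Y, hY0, hY⟩ := exists_linear_solution (A := fun t => fderiv ℝ f (Φ z₀ t)) (K := K) hε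
      (hcont.comp (fun t ht => (hderiv z₀ (hsub hz₀) t ht).continuousWithinAt)
        fun t _ => hmem z₀ (hsub hz₀) t)
      (fun t _ => hK _ (hmem z₀ (hsub hz₀) t)) hεK
    refine ⟨Y, hY0, hY, fun t ht => ?_⟩
    -- The remainder solves the variational equation up to the Taylor error of `f`, which is
    -- quadratic in `z - z₀` because the flow is `L'`-Lipschitz in the initial value; Grönwall then
    -- gives a quadratic bound. The rate `K + 1` is nonzero, so the closed formula for
    -- `gronwallBound` applies.
    have key : ∀ z ∈ ball x₀ (a / 2), ‖Φ z t - Φ z₀ t - Y t (z - z₀)‖ ≤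
        gronwallBound 0 (K + 1) (C * L' ^ 2 * ‖z - z₀‖ ^ 2) |t| := by
      intro z hz
      refine norm_le_gronwallBound_of_norm_deriv_le_Icc (u := fun t => Φ z t - Φ z₀ t - Y t (z - z₀))
        (u' := fun t => f (Φ z t) - f (Φ z₀ t) - fderiv ℝ f (Φ z₀ t) (Y t (z - z₀))) hε ?_ ?_ ?_ t ht
      · simp [(hΦ z (hsub hz)).1, (hΦ z₀ (hsub hz₀)).1, hY0]
      · intro s hs
        exact ((hderiv z (hsub hz) s hs).sub (hderiv z₀ (hsub hz₀) s hs)).sub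
          (by simpa using (hY s hs).clm_apply (hasDerivWithinAt_const s _ (z - z₀)))
      · intro s hs
        have e : f (Φ z s) - f (Φ z₀ s) - fderiv ℝ f (Φ z₀ s) (Y s (z - z₀)) =
            fderiv ℝ f (Φ z₀ s) (Φ z s - Φ z₀ s - Y s (z - z₀)) +
            (f (Φ z s) - f (Φ z₀ s) - fderiv ℝ f (Φ z₀ s) (Φ z s - Φ z₀ s)) := by
          simp only [map_sub]; abel
        rw [e]
        refine (norm_add_le _ _).trans (add_le_add ?_ ?_)
        · refine (ContinuousLinearMap.le_opNorm _ _).trans ?_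
          gcongr
          exact (hK _ (hmem z₀ (hsub hz₀) s)).trans (by linarith)
        · refine (htay _ (hmem z (hsub hz) s) _ (hmem z₀ (hsub hz₀) s)).trans ?_
          rw [mul_assoc, ← mul_pow]
          gcongr
          exact (hL' s hs).norm_sub_le (hsub hz) (hsub hz₀)
    have hO : (fun z => Φ z t - Φ z₀ t - Y t (z - z₀)) =O[𝓝 z₀] fun z => ‖z - z₀‖ ^ 2 := by
      refine Asymptotics.IsBigO.of_bound (C * L' ^ 2 / (K + 1) * (Real.exp ((K + 1) * |t|) - 1)) ?_
      filter_upwards [isOpen_ball.mem_nhds hz₀] with z hz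
      refine (key z hz).trans (le_of_eq ?_)
      rw [gronwallBound_of_K_ne_0 (by positivity)]
      simp
      ring
    have h1 : HasFDerivAt (fun z => Φ z t - Φ z₀ t - Y t (z - z₀)) (0 : W →L[ℝ] W) z₀ :=
      hO.hasFDerivAt (by norm_num)
    have h2 : HasFDerivAt (fun z => Y t (z - z₀)) (Y t) z₀ := by
      exact (Y t).hasFDerivAt.comp z₀ ((hasFDerivAt_id z₀).sub_const z₀)
    have h3 := (h1.add h2).add_const (Φ z₀ t)
    simpa using h3
  · have hnear : ∀ z ∈ ball x₀ (a / 2), ∀ s ∈ Icc (-ε) ε,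
        ‖f (Φ z s) - f x₀‖ ≤ K * (‖z - x₀‖ + M * |s|) := by
      intro z hz s hs
      have h1 : ‖Φ z s - Φ z 0‖ ≤ M * ‖s - 0‖ :=
        (convex_Icc (-ε) ε).norm_image_sub_le_of_norm_hasDerivWithin_le
          (hderiv z (hsub hz)) (fun t _ => hM _ (hmem z (hsub hz) t)) h0ε hs
      rw [(hΦ z (hsub hz)).1, sub_zero, Real.norm_eq_abs] at h1
      refine (hlip.norm_sub_le (hmem z (hsub hz) s) (mem_closedBall_self ha.le)).trans ?_
      gcongr
      calc ‖Φ z s - x₀‖ = ‖(z - x₀) + (Φ z s - z)‖ := by congr 1; abel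
        _ ≤ _ := (norm_add_le _ _).trans (by gcongr)
    -- An increment splits into a change of time at fixed initial value (`e1`, by `hnear`) and a
    -- change of initial value at fixed time (`e2`, by the Lipschitz bounds over a time of at most
    -- `δ`).
    rw [hasStrictFDerivAt_iff_isLittleO, Asymptotics.isLittleO_iff]
    intro c hc
    obtain ⟨δ, hδ, hδa, hδε, hδ1, hδ2⟩ : ∃ δ > 0, δ ≤ a / 2 ∧ δ ≤ ε ∧
        K * (δ + M * δ) ≤ c / 2 ∧ K * L' * δ ≤ c / 2 := by
      have h1 : ∀ᶠ δ : ℝ in 𝓝[>] 0, K * (δ + M * δ) < c / 2 := by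
        refine (Continuous.tendsto' (by fun_prop) 0 0 (by simp)).eventually_lt_const
          (half_pos hc) |>.filter_mono nhdsWithin_le_nhds
      have h2 : ∀ᶠ δ : ℝ in 𝓝[>] 0, K * L' * δ < c / 2 := by
        refine (Continuous.tendsto' (by fun_prop) 0 0 (by simp)).eventually_lt_const
          (half_pos hc) |>.filter_mono nhdsWithin_le_nhds
      have h3 : ∀ᶠ δ : ℝ in 𝓝[>] 0, δ < a / 2 :=
        mem_of_superset (Ioo_mem_nhdsGT (half_pos ha)) fun δ h => h.2
      have h4 : ∀ᶠ δ : ℝ in 𝓝[>] 0, δ < ε := mem_of_superset (Ioo_mem_nhdsGT hε) fun δ h => h.2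
      obtain ⟨δ, h⟩ := (h1.and (h2.and (h3.and (h4.and self_mem_nhdsWithin)))).exists
      exact ⟨δ, h.2.2.2.2, h.2.2.1.le, h.2.2.2.1.le, h.1.le, h.2.1.le⟩
    have hnb : ∀ᶠ p : (W × ℝ) × (W × ℝ) in 𝓝 ((x₀, 0), (x₀, 0)),
        p.1.1 ∈ ball x₀ δ ∧ p.1.2 ∈ Ioo (-δ) δ ∧ p.2.1 ∈ ball x₀ δ ∧ p.2.2 ∈ Ioo (-δ) δ := by
      have b := ball_mem_nhds x₀ hδ
      have i : Ioo (-δ) δ ∈ 𝓝 (0 : ℝ) := Ioo_mem_nhds (by linarith) hδ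
      filter_upwards [prod_mem_nhds (prod_mem_nhds b i) (prod_mem_nhds b i)] with p hp
      exact ⟨hp.1.1, hp.1.2, hp.2.1, hp.2.2⟩
    filter_upwards [hnb]
    rintro ⟨⟨z, s⟩, ⟨z', s'⟩⟩ ⟨hz, hs, hz', hs'⟩
    dsimp only at hz hs hz' hs' ⊢
    have hδI : Ioo (-δ) δ ⊆ Icc (-ε) ε := fun t ht => ⟨by linarith [ht.1], by linarith [ht.2]⟩
    have hδB : ball x₀ δ ⊆ ball x₀ (a / 2) := ball_subset_ball hδa
    have e1 : ‖(Φ z s - s • f x₀) - (Φ z s' - s' • f x₀)‖ ≤ c / 2 * ‖s - s'‖ := by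
      refine (convex_Ioo (-δ) δ).norm_image_sub_le_of_norm_hasDerivWithin_le
        (f := fun s => Φ z s - s • f x₀) (f' := fun s => f (Φ z s) - f x₀) ?_ ?_ hs' hs
      · intro t ht
        refine ((hderiv z (hsub (hδB hz)) t (hδI ht)).mono hδI).sub ?_
        simpa using (hasDerivWithinAt_id t _).smul_const (f x₀)
      · intro t ht
        refine (hnear z (hδB hz) t (hδI ht)).trans (le_trans ?_ hδ1)
        gcongr
        · exact (mem_ball_iff_norm.1 hz).le
        · exact abs_le.2 ⟨ht.1.le, ht.2.le⟩
    have e2 : ‖(Φ z s' - Φ z' s') - (z - z')‖ ≤ c / 2 * ‖z - z'‖ := by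
      have := (convex_Icc (-ε) ε).norm_image_sub_le_of_norm_hasDerivWithin_le
        (f := fun s => Φ z s - Φ z' s) (f' := fun s => f (Φ z s) - f (Φ z' s))
        (C := K * (L' * ‖z - z'‖))
        (fun t ht => (hderiv z (hsub (hδB hz)) t ht).sub (hderiv z' (hsub (hδB hz')) t ht))
        (fun t ht => (hlip.norm_sub_le (hmem z (hsub (hδB hz)) t) (hmem z' (hsub (hδB hz')) t)).trans
          (by gcongr; exact (hL' t ht).norm_sub_le (hsub (hδB hz)) (hsub (hδB hz')))) h0ε (hδI hs')
      rw [(hΦ z (hsub (hδB hz))).1, (hΦ z' (hsub (hδB hz'))).1, sub_zero] at this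
      refine this.trans ?_
      have h3 : ‖s'‖ ≤ δ := abs_le.2 ⟨hs'.1.le, hs'.2.le⟩
      calc K * (L' * ‖z - z'‖) * ‖s'‖ ≤ K * (L' * ‖z - z'‖) * δ := by gcongr
        _ = K * L' * δ * ‖z - z'‖ := by ring
        _ ≤ _ := by gcongr
    have e3 : Φ z s - Φ z' s' - (ContinuousLinearMap.fst ℝ W ℝ +
        (ContinuousLinearMap.snd ℝ W ℝ).smulRight (f x₀)) ((z, s) - (z', s')) =
        ((Φ z s - s • f x₀) - (Φ z s' - s' • f x₀)) + ((Φ z s' - Φ z' s') - (z - z')) := by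
      simp [sub_smul]
      abel
    rw [e3]
    have h1 : ‖s - s'‖ ≤ ‖(z, s) - (z', s')‖ := norm_snd_le ((z, s) - (z', s'))
    have h2 : ‖z - z'‖ ≤ ‖(z, s) - (z', s')‖ := norm_fst_le ((z, s) - (z', s'))
    calc _ ≤ c / 2 * ‖s - s'‖ + c / 2 * ‖z - z'‖ := (norm_add_le _ _).trans (add_le_add e1 e2)
      _ ≤ c / 2 * ‖(z, s) - (z', s')‖ + c / 2 * ‖(z, s) - (z', s')‖ := by gcongr
      _ = _ := by ring

end LocalFlow

/-! ### Vector fields on manifolds read in charts -/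

section ManifoldFlow

open Metric
open scoped NNReal

variable {W : Type*} [NormedAddCommGroup W] [NormedSpace ℝ W]
  {H' : Type*} [TopologicalSpace H'] {I : ModelWithCorners ℝ W H'}
  {M : Type*} [TopologicalSpace M] [ChartedSpace H' M]

/-- The expression of a vector field in the preferred chart at `x₀`. -/
def chartField (X : (x : M) → TangentSpace I x) (x₀ : M) (y : W) : W :=
  mfderiv I 𝓘(ℝ, W) (extChartAt I x₀) ((extChartAt I x₀).symm y) (X ((extChartAt I x₀).symm y))

/-- The derivative at `x` of `φ` exists and pulls `α` back to `α`. -/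
def PreservesAt {ι : Type*} (α : (x : M) → (TangentSpace I x) [⋀^ι]→L[ℝ] ℝ) (φ : M → M) (x : M) :
    Prop :=
  ∃ A : TangentSpace I x →L[ℝ] TangentSpace I (φ x), HasMFDerivAt I I φ x A ∧
    (α (φ x)).compContinuousLinearMap A = α x

section Preserves

variable {ι : Type*} {α : (x : M) → (TangentSpace I x) [⋀^ι]→L[ℝ] ℝ} {φ ψ : M → M} {x : M}

theorem PreservesAt.continuousAt (h : PreservesAt α φ x) : ContinuousAt φ x :=
  h.choose_spec.1.continuousAt

theorem PreservesAt.id : PreservesAt α (fun z => z) x :=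
  ⟨ContinuousLinearMap.id ℝ _, hasMFDerivAt_id x, by ext; simp⟩

theorem PreservesAt.comp (hψ : PreservesAt α ψ (φ x)) (hφ : PreservesAt α φ x) :
    PreservesAt α (fun z => ψ (φ z)) x := by
  obtain ⟨A, hA, hA'⟩ := hφ
  obtain ⟨B, hB, hB'⟩ := hψ
  refine ⟨B.comp A, hB.comp x hA, ?_⟩
  rw [← hA', ← hB']
  rfl

theorem PreservesAt.congr (hφ : PreservesAt α φ x) (h : ψ =ᶠ[𝓝 x] φ) : PreservesAt α ψ x := by
  obtain ⟨A, hA, hA'⟩ := hφ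
  have e : ψ x = φ x := h.self_of_nhds
  have hA2 := hA.congr_of_eventuallyEq h
  -- The type of `A` mentions `φ x`, so it is generalized before `ψ x` is rewritten.
  revert A
  unfold PreservesAt
  rw [e]
  intro A hA hA' hA2
  exact ⟨A, hA2, hA'⟩

end Preserves

section Charts

variable [IsManifold I 1 M]

/-- With its converse below, this moves the differential equation between `M` and the model space.
Derivatives within a set are used because integral curves live on closed intervals. -/
theorem hasDerivWithinAt_extChartAt_comp {X : (x : M) → TangentSpace I x} {x₀ : M} {γ : ℝ → M}
    {s : Set ℝ} {t : ℝ}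
    (hγ : HasMFDerivWithinAt 𝓘(ℝ, ℝ) I γ s t ((1 : ℝ →L[ℝ] ℝ).smulRight (X (γ t))))
    (ht : γ t ∈ (extChartAt I x₀).source) :
    HasDerivWithinAt (fun u => extChartAt I x₀ (γ u)) (chartField X x₀ (extChartAt I x₀ (γ t)))
      s t := by
  have h1 : HasMFDerivAt I 𝓘(ℝ, W) (extChartAt I x₀) (γ t)
      (mfderiv I 𝓘(ℝ, W) (extChartAt I x₀) (γ t)) :=
    ((mdifferentiableAt_extChartAt (by simpa using ht))).hasMFDerivAt
  have h2 := h1.comp_hasMFDerivWithinAt t hγ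
  have h3 : HasFDerivWithinAt (fun u => extChartAt I x₀ (γ u))
      ((1 : ℝ →L[ℝ] ℝ).smulRight (chartField X x₀ (extChartAt I x₀ (γ t)))) s t := by
    refine h2.hasFDerivWithinAt.congr_fderiv (ContinuousLinearMap.ext_ring ?_)
    rw [chartField, (extChartAt I x₀).left_inv ht]
    change mfderiv I 𝓘(ℝ, W) (extChartAt I x₀) (γ t) ((1 : ℝ) • X (γ t)) =
      (1 : ℝ) • mfderiv I 𝓘(ℝ, W) (extChartAt I x₀) (γ t) (X (γ t))
    rw [one_smul, one_smul]
  simpa using h3.hasDerivWithinAt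

theorem hasMFDerivWithinAt_extChartAt_symm_comp [I.Boundaryless] {X : (x : M) → TangentSpace I x}
    {x₀ : M} {c : ℝ → W} {s : Set ℝ} {t : ℝ}
    (hc : HasDerivWithinAt c (chartField X x₀ (c t)) s t)
    (ht : c t ∈ (extChartAt I x₀).target) :
    HasMFDerivWithinAt 𝓘(ℝ, ℝ) I (fun u => (extChartAt I x₀).symm (c u)) s t
      ((1 : ℝ →L[ℝ] ℝ).smulRight (X ((extChartAt I x₀).symm (c t)))) := by
  have h1 : HasMFDerivAt 𝓘(ℝ, W) I (extChartAt I x₀).symm (c t)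
      (mfderiv 𝓘(ℝ, W) I (extChartAt I x₀).symm (c t)) := by
    have := mdifferentiableWithinAt_extChartAt_symm (I := I) ht
    rw [I.range_eq_univ, mdifferentiableWithinAt_univ] at this
    exact this.hasMFDerivAt
  have h2 := h1.comp_hasMFDerivWithinAt t hc.hasFDerivWithinAt.hasMFDerivWithinAt
  have h3 := mfderivWithin_extChartAt_symm_comp_mfderiv_extChartAt (I := I) ht
  rw [I.range_eq_univ, mfderivWithin_univ] at h3
  have h4 : mfderiv 𝓘(ℝ, W) I (extChartAt I x₀).symm (c t) (chartField X x₀ (c t) : W) =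
      X ((extChartAt I x₀).symm (c t)) :=
    congrArg (fun A => A (X ((extChartAt I x₀).symm (c t)))) h3
  refine h2.congr_mfderiv ?_
  have key : ∀ r : ℝ, mfderiv 𝓘(ℝ, W) I (extChartAt I x₀).symm (c t)
      (r • chartField X x₀ (c t) : W) = r • X ((extChartAt I x₀).symm (c t)) := fun r => by
    rw [← h4]
    exact (mfderiv 𝓘(ℝ, W) I (extChartAt I x₀).symm (c t)).map_smul r (chartField X x₀ (c t) : W)
  exact ContinuousLinearMap.ext fun r => key r

end Charts

end ManifoldFlow

/-! ### Integral curves: concatenation and uniqueness -/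

section ManifoldFlow

open Metric
open scoped NNReal

variable {W : Type*} [NormedAddCommGroup W] [NormedSpace ℝ W]
  {H' : Type*} [TopologicalSpace H'] {I : ModelWithCorners ℝ W H'}
  {M : Type*} [TopologicalSpace M] [ChartedSpace H' M]

/-- The vector field `X` is of class `C²` in the preferred charts. -/
def IsC2Field (X : (x : M) → TangentSpace I x) : Prop :=
  ∀ (x₀ : M), ∀ y ∈ (extChartAt I x₀).target, ContDiffAt ℝ 2 (chartField X x₀) y

variable {X : (x : M) → TangentSpace I x}

theorem isMIntegralCurveOn_Icc_shift {γ : ℝ → M} {a b : ℝ}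
    (hγ : IsMIntegralCurveOn γ X (Icc a b)) (d : ℝ) :
    IsMIntegralCurveOn (fun s => γ (s + d)) X (Icc (a - d) (b - d)) := by
  refine (IsMIntegralCurveOn.comp_add hγ d).mono fun t ht => ?_
  exact ⟨by linarith [ht.1], by linarith [ht.2]⟩

/-- Concatenation of integral curves. -/
theorem exists_isMIntegralCurveOn_concat {γ γ' : ℝ → M} {a b : ℝ} (ha : 0 ≤ a)
    (hγ : IsMIntegralCurveOn γ X (Icc 0 a)) (hγ' : IsMIntegralCurveOn γ' X (Icc 0 b))
    (h : γ a = γ' 0) : ∃ c : ℝ → M, IsMIntegralCurveOn c X (Icc 0 (a + b)) ∧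
      EqOn c γ (Icc 0 a) ∧ ∀ s ∈ Ici (0 : ℝ), c (a + s) = γ' s := by
  classical
  set c : ℝ → M := fun s => if s ≤ a then γ s else γ' (s - a) with hcdef
  have hc1 : EqOn c γ (Icc 0 a) := fun s hs => by simp [hcdef, hs.2]
  have hc2 : ∀ s ∈ Ici a, c s = γ' (s - a) := fun s hs => by
    rcases eq_or_lt_of_le (mem_Ici.1 hs) with rfl | hlt
    · simp [hcdef, h]
    · simp [hcdef, not_le.2 hlt]
  have hshift : IsMIntegralCurveOn (fun s => γ' (s - a)) X (Icc a (a + b)) := by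
    simpa [sub_eq_add_neg, add_comm b] using isMIntegralCurveOn_Icc_shift hγ' (-a)
  have d1 : ∀ t ∈ Icc 0 a,
      HasMFDerivWithinAt 𝓘(ℝ, ℝ) I c (Icc 0 a) t ((1 : ℝ →L[ℝ] ℝ).smulRight (X (c t))) := by
    intro t ht
    have := (hγ t ht).congr_mono hc1 (hc1 ht) subset_rfl
    rwa [← hc1 ht] at this
  have d2 : ∀ t ∈ Icc a (a + b),
      HasMFDerivWithinAt 𝓘(ℝ, ℝ) I c (Icc a (a + b)) t ((1 : ℝ →L[ℝ] ℝ).smulRight (X (c t))) := by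
    intro t ht
    have hcc : ∀ s ∈ Icc a (a + b), c s = γ' (s - a) := fun s hs => hc2 s hs.1
    have := (hshift t ht).congr_mono hcc (hcc t ht) subset_rfl
    beta_reduce at this
    rwa [← hcc t ht] at this
  refine ⟨c, fun t ht => ?_, hc1, fun s hs => by rw [hc2 _ (by simpa using hs)]; simp⟩
  rcases lt_trichotomy t a with hlt | rfl | hgt
  · refine (d1 t ⟨ht.1, hlt.le⟩).mono_of_mem_nhdsWithin ?_
    filter_upwards [self_mem_nhdsWithin, mem_nhdsWithin_of_mem_nhds (Iio_mem_nhds hlt)] with s h1 h2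
    exact ⟨h1.1, le_of_lt h2⟩
  -- At the junction both one-sided derivatives equal the field, so they combine.
  · have := (d1 t ⟨ht.1, le_rfl⟩).union (d2 t ⟨le_rfl, ht.2⟩)
    rwa [Icc_union_Icc_eq_Icc ht.1 ht.2] at this
  · refine (d2 t ⟨hgt.le, ht.2⟩).mono_of_mem_nhdsWithin ?_
    filter_upwards [self_mem_nhdsWithin, mem_nhdsWithin_of_mem_nhds (Ioi_mem_nhds hgt)] with s h1 h2
    exact ⟨le_of_lt h2, h1.2⟩

variable [IsManifold I 1 M]

/-- Integral curves of a `C²` vector field that agree at one time agree nearby. -/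
theorem eventuallyEq_of_isMIntegralCurveOn_Icc (hX : IsC2Field X) {γ γ' : ℝ → M} {a b s₀ : ℝ}
    (hγ : IsMIntegralCurveOn γ X (Icc a b)) (hγ' : IsMIntegralCurveOn γ' X (Icc a b))
    (hs₀ : s₀ ∈ Icc a b) (h : γ s₀ = γ' s₀) : γ =ᶠ[𝓝[Icc a b] s₀] γ' := by
  set x₀ := γ s₀ with hx₀
  set e := extChartAt I x₀ with he
  have hx₀e : x₀ ∈ e.source := mem_extChartAt_source x₀
  -- The chart field is Lipschitz on `u`, so uniqueness of solutions applies as long as both curves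
  -- stay in `u` in the chart.
  obtain ⟨K, u, hu, hK⟩ := ((hX x₀ (e x₀) (mem_extChartAt_target x₀)).of_le
    (by norm_num : (1 : WithTop ℕ∞) ≤ 2)).exists_lipschitzOnWith
  have hev : ∀ {c : ℝ → M}, IsMIntegralCurveOn c X (Icc a b) → c s₀ = x₀ →
      ∀ᶠ s in 𝓝[Icc a b] s₀, c s ∈ e.source ∧ e (c s) ∈ u := by
    intro c hc hcs
    have hcc : ContinuousWithinAt c (Icc a b) s₀ := (hc s₀ hs₀).continuousWithinAt
    have h1 : Tendsto c (𝓝[Icc a b] s₀) (𝓝 x₀) := hcs ▸ hcc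
    have h2 : ∀ᶠ x in 𝓝 x₀, x ∈ e.source ∧ e x ∈ u :=
      Filter.Eventually.and (extChartAt_source_mem_nhds (I := I) x₀)
        ((continuousAt_extChartAt x₀) hu)
    exact h1.eventually h2
  have hall := (hev hγ rfl).and (hev hγ' h.symm)
  obtain ⟨δ, hδ, hball⟩ := Metric.mem_nhdsWithin_iff.1 hall
  have hder : ∀ {c : ℝ → M}, IsMIntegralCurveOn c X (Icc a b) → ∀ s ∈ Icc a b, c s ∈ e.source →
      HasDerivWithinAt (fun s => e (c s)) (chartField X x₀ (e (c s))) (Icc a b) s :=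
    fun hc s hs hcs => hasDerivWithinAt_extChartAt_comp (hc s hs) hcs
  refine Metric.mem_nhdsWithin_iff.2 ⟨δ, hδ, fun t ht => ?_⟩
  have htb : ∀ s ∈ uIcc s₀ t, s ∈ ball s₀ δ ∩ Icc a b := fun s hs =>
    ⟨(convex_ball s₀ δ).ordConnected.uIcc_subset (mem_ball_self hδ) ht.1 hs,
      ordConnected_Icc.uIcc_subset hs₀ ht.2 hs⟩
  have heq : e (γ t) = e (γ' t) := by
    rcases le_total s₀ t with hst | hts
    · rw [uIcc_of_le hst] at htb
      have hnb : ∀ s ∈ Ico s₀ t, Icc a b ∈ 𝓝[≥] s := fun s hs =>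
        mem_of_superset (Icc_mem_nhdsGE (hs.2.trans_le ht.2.2))
          (Icc_subset_Icc (hs₀.1.trans hs.1) le_rfl)
      exact ODE_solution_unique_of_mem_Icc_right (v := fun _ => chartField X x₀) (s := fun _ => u)
        (K := K) (f := fun s => e (γ s)) (g := fun s => e (γ' s)) (fun _ _ => hK)
        (fun s hs => ((hder hγ s (htb s hs).2 (hball (htb s hs)).1.1).continuousWithinAt).mono
          fun s hs => (htb s hs).2)
        (fun s hs => (hder hγ s (htb s (Ico_subset_Icc_self hs)).2
          (hball (htb s (Ico_subset_Icc_self hs))).1.1).mono_of_mem_nhdsWithin (hnb s hs))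
        (fun s hs => (hball (htb s (Ico_subset_Icc_self hs))).1.2)
        (fun s hs => ((hder hγ' s (htb s hs).2 (hball (htb s hs)).2.1).continuousWithinAt).mono
          fun s hs => (htb s hs).2)
        (fun s hs => (hder hγ' s (htb s (Ico_subset_Icc_self hs)).2
          (hball (htb s (Ico_subset_Icc_self hs))).2.1).mono_of_mem_nhdsWithin (hnb s hs))
        (fun s hs => (hball (htb s (Ico_subset_Icc_self hs))).2.2)
        (by simp only [← h, hx₀]) ⟨hst, le_rfl⟩
    · rw [uIcc_of_ge hts] at htb
      have hnb : ∀ s ∈ Ioc t s₀, Icc a b ∈ 𝓝[≤] s := fun s hs =>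
        mem_of_superset (Icc_mem_nhdsLE (ht.2.1.trans_lt hs.1))
          (Icc_subset_Icc le_rfl (hs.2.trans hs₀.2))
      exact ODE_solution_unique_of_mem_Icc_left (v := fun _ => chartField X x₀) (s := fun _ => u)
        (K := K) (f := fun s => e (γ s)) (g := fun s => e (γ' s)) (fun _ _ => hK)
        (fun s hs => ((hder hγ s (htb s hs).2 (hball (htb s hs)).1.1).continuousWithinAt).mono
          fun s hs => (htb s hs).2)
        (fun s hs => (hder hγ s (htb s (Ioc_subset_Icc_self hs)).2
          (hball (htb s (Ioc_subset_Icc_self hs))).1.1).mono_of_mem_nhdsWithin (hnb s hs))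
        (fun s hs => (hball (htb s (Ioc_subset_Icc_self hs))).1.2)
        (fun s hs => ((hder hγ' s (htb s hs).2 (hball (htb s hs)).2.1).continuousWithinAt).mono
          fun s hs => (htb s hs).2)
        (fun s hs => (hder hγ' s (htb s (Ioc_subset_Icc_self hs)).2
          (hball (htb s (Ioc_subset_Icc_self hs))).2.1).mono_of_mem_nhdsWithin (hnb s hs))
        (fun s hs => (hball (htb s (Ioc_subset_Icc_self hs))).2.2)
        (by simp only [← h, hx₀]) ⟨le_rfl, hts⟩
  exact e.injOn (hball ht).1.1 (hball ht).2.1 heq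

/-- Integral curves of a `C²` vector field on a Hausdorff manifold that agree at one time agree. -/
theorem eqOn_of_isMIntegralCurveOn_Icc [T2Space M] (hX : IsC2Field X) {γ γ' : ℝ → M} {a b s₀ : ℝ}
    (hγ : IsMIntegralCurveOn γ X (Icc a b)) (hγ' : IsMIntegralCurveOn γ' X (Icc a b))
    (hs₀ : s₀ ∈ Icc a b) (h : γ s₀ = γ' s₀) : EqOn γ γ' (Icc a b) := by
  have hc : ContinuousOn γ (Icc a b) := fun s hs => (hγ s hs).continuousWithinAt
  have hc' : ContinuousOn γ' (Icc a b) := fun s hs => (hγ' s hs).continuousWithinAt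
  -- The set of agreement is closed because `M` is Hausdorff, and open by local uniqueness.
  have hclopen : IsClopen {s : Icc a b | γ s = γ' s} := by
    refine ⟨isClosed_eq hc.domRestrict hc'.domRestrict, isOpen_iff_mem_nhds.2 fun s hs => ?_⟩
    have := eventuallyEq_of_isMIntegralCurveOn_Icc hX hγ hγ' s.2 hs
    rw [mem_nhds_subtype_iff_nhdsWithin]
    filter_upwards [this, self_mem_nhdsWithin] with t ht ht'
    exact ⟨⟨t, ht'⟩, ht, rfl⟩
  have : PreconnectedSpace (Icc a b) := isPreconnected_iff_preconnectedSpace.1 isPreconnected_Icc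
  have huniv := hclopen.eq_univ ⟨⟨s₀, hs₀⟩, h⟩
  intro s hs
  have : (⟨s, hs⟩ : Icc a b) ∈ {s : Icc a b | γ s = γ' s} := huniv ▸ mem_univ _
  exact this

end ManifoldFlow

/-! ### Locally constant forms and symplectic vector fields -/

section ManifoldFlow

open Metric
open scoped NNReal

variable {W : Type*} [NormedAddCommGroup W] [NormedSpace ℝ W]
  {H' : Type*} [TopologicalSpace H'] {I : ModelWithCorners ℝ W H'}
  {M : Type*} [TopologicalSpace M] [ChartedSpace H' M] [IsManifold I 1 M]

/-- The form `α` is the pullback of the constant form `β` under every preferred chart. -/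
def IsLocallyConst {ι : Type*} (α : (x : M) → (TangentSpace I x) [⋀^ι]→L[ℝ] ℝ)
    (β : W [⋀^ι]→L[ℝ] ℝ) : Prop :=
  ∀ x₀ x : M, x ∈ (extChartAt I x₀).source →
    α x = β.compContinuousLinearMap (mfderiv I 𝓘(ℝ, W) (extChartAt I x₀) x)

section

variable {ι : Type*} {α : (x : M) → (TangentSpace I x) [⋀^ι]→L[ℝ] ℝ} {β : W [⋀^ι]→L[ℝ] ℝ}

theorem mfderiv_extChartAt_apply_mfderiv_symm [I.Boundaryless] {x₀ : M} {y : W}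
    (hy : y ∈ (extChartAt I x₀).target) (v : W) :
    mfderiv I 𝓘(ℝ, W) (extChartAt I x₀) ((extChartAt I x₀).symm y)
      (mfderiv 𝓘(ℝ, W) I (extChartAt I x₀).symm y v) = v := by
  have h := mfderiv_extChartAt_comp_mfderivWithin_extChartAt_symm (I := I) hy
  rw [I.range_eq_univ, mfderivWithin_univ] at h
  exact congrArg (fun A => A v) h

/-- The components in each preferred chart are the constants `β v`. -/
theorem IsLocallyConst.isSmoothForm [I.Boundaryless] (h : IsLocallyConst α β) :
    IsSmoothForm α := by
  intro x₀ v
  refine (contDiffOn_const (c := β v)).congr fun y hy => ?_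
  rw [h x₀ _ ((extChartAt I x₀).map_target hy)]
  exact congrArg β (funext fun i => mfderiv_extChartAt_apply_mfderiv_symm hy (v i))

/-- A map that preserves the constant form in a chart preserves the locally constant form. -/
theorem IsLocallyConst.preservesAt [I.Boundaryless] (h : IsLocallyConst α β) {x₀ x : M} {φ : M → M}
    {F : W → W} {A : W →L[ℝ] W} (hx : x ∈ (extChartAt I x₀).source)
    (hF : HasFDerivAt F A (extChartAt I x₀ x))
    (hFx : F (extChartAt I x₀ x) ∈ (extChartAt I x₀).target)
    (hA : β.compContinuousLinearMap A = β)
    (hφ : φ =ᶠ[𝓝 x] fun z => (extChartAt I x₀).symm (F (extChartAt I x₀ z))) :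
    PreservesAt α φ x := by
  refine PreservesAt.congr ?_ hφ
  set e := extChartAt I x₀ with he
  have h1 : HasMFDerivAt I 𝓘(ℝ, W) e x (mfderiv I 𝓘(ℝ, W) e x) :=
    (mdifferentiableAt_extChartAt (by simpa [he] using hx)).hasMFDerivAt
  have h2 : HasMFDerivAt 𝓘(ℝ, W) 𝓘(ℝ, W) F (e x) A := hF.hasMFDerivAt
  have h3 : HasMFDerivAt 𝓘(ℝ, W) I e.symm (F (e x)) (mfderiv 𝓘(ℝ, W) I e.symm (F (e x))) := by
    have := mdifferentiableWithinAt_extChartAt_symm (I := I) hFx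
    rw [I.range_eq_univ, mdifferentiableWithinAt_univ] at this
    exact this.hasMFDerivAt
  refine ⟨_, h3.comp x (h2.comp x h1), ?_⟩
  rw [h x₀ _ (e.map_target hFx), h x₀ x hx]
  refine ContinuousAlternatingMap.ext fun v => ?_
  have h4 := congrArg (fun B : W [⋀^ι]→L[ℝ] ℝ => B fun i => mfderiv I 𝓘(ℝ, W) e x (v i)) hA
  refine Eq.trans ?_ h4
  exact congrArg β (funext fun i => mfderiv_extChartAt_apply_mfderiv_symm hFx _)

end

/-- Solutions of the variational equation of an infinitesimally symplectic field preserve the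
form. -/
theorem compContinuousLinearMap_eq_of_variation {β : W [⋀^Fin 2]→L[ℝ] ℝ} {B : W →L[ℝ] W →L[ℝ] ℝ}
    (hB : ∀ u, β u = B (u 0) (u 1)) {A Y : ℝ → W →L[ℝ] W} {ε : ℝ}
    (hY0 : Y 0 = ContinuousLinearMap.id ℝ W)
    (hY : ∀ t ∈ Icc (-ε) ε, HasDerivWithinAt Y (A t ∘L Y t) (Icc (-ε) ε) t)
    (hA : ∀ t ∈ Icc (-ε) ε, ∀ v w, B (A t v) w + B v (A t w) = 0) :
    ∀ t ∈ Icc (-ε) ε, β.compContinuousLinearMap (Y t) = β := by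
  intro t ht
  refine ContinuousAlternatingMap.ext fun u => ?_
  rw [ContinuousAlternatingMap.compContinuousLinearMap_apply, hB, hB]
  have hε : 0 ≤ ε := by linarith [ht.1, ht.2]
  -- For `ε = 0` the interval is a point, where derivatives within it are not unique.
  rcases hε.eq_or_lt with h0 | h0
  · obtain rfl : t = 0 := by simpa [← h0] using ht
    simp [hY0]
  have hd : ∀ s ∈ Icc (-ε) ε, HasDerivWithinAt (fun s => B (Y s (u 0)) (Y s (u 1))) 0
      (Icc (-ε) ε) s := by
    intro s hs
    have d : ∀ v, HasDerivWithinAt (fun s => Y s v) (A s (Y s v)) (Icc (-ε) ε) s := fun v => by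
      simpa using (hY s hs).clm_apply (hasDerivWithinAt_const s _ v)
    have d1 : HasDerivWithinAt (fun s => B (Y s (u 0))) (B (A s (Y s (u 0)))) (Icc (-ε) ε) s :=
      B.hasFDerivAt.comp_hasDerivWithinAt s (d (u 0))
    have := d1.clm_apply (d (u 1))
    rwa [hA s hs] at this
  have := (convex_Icc (-ε) ε).is_const_of_fderivWithin_eq_zero (𝕜 := ℝ)
    (fun s hs => (hd s hs).differentiableWithinAt)
    (fun s hs => by
      rw [(hd s hs).hasFDerivWithinAt.fderivWithin ((uniqueDiffOn_Icc (by linarith)) s hs)]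
      simp)
    ht (show (0 : ℝ) ∈ Icc (-ε) ε from ⟨by linarith, hε⟩)
  simpa [hY0] using this

/-- A `C²` vector field `X` that is infinitesimally symplectic for the form `α`, which is given in
every preferred chart by the constant form `β`, that is by the bilinear form `B`. -/
structure IsSymplecticField (X : (x : M) → TangentSpace I x)
    (α : (x : M) → (TangentSpace I x) [⋀^Fin 2]→L[ℝ] ℝ) (β : W [⋀^Fin 2]→L[ℝ] ℝ)
    (B : W →L[ℝ] W →L[ℝ] ℝ) : Prop where
  c2 : IsC2Field X
  locallyConst : IsLocallyConst α β
  bilin : ∀ u, β u = B (u 0) (u 1)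
  infinitesimal : ∀ x₀ : M, ∀ y ∈ (extChartAt I x₀).target, ∀ v w,
    B (fderiv ℝ (chartField X x₀) y v) w + B v (fderiv ℝ (chartField X x₀) y w) = 0

/-- This is the chart flow of `exists_isLocalFlow` carried to `M`. The neighbourhood `U` is
prescribed so that whole trajectories can be kept away from the closure of the impact surface. -/
theorem IsSymplecticField.exists_flow [I.Boundaryless] [CompleteSpace W]
    {X : (x : M) → TangentSpace I x} {α : (x : M) → (TangentSpace I x) [⋀^Fin 2]→L[ℝ] ℝ}
    {β : W [⋀^Fin 2]→L[ℝ] ℝ} {B : W →L[ℝ] W →L[ℝ] ℝ} (h : IsSymplecticField X α β B)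
    (x₀ : M) {U : Set M} (hU : U ∈ 𝓝 x₀) :
    ∃ ε > 0, ∃ N ∈ 𝓝 x₀, ∃ Φ : M → ℝ → M, ∀ z ∈ N, Φ z 0 = z ∧
      IsMIntegralCurveOn (Φ z) X (Icc (-ε) ε) ∧
      ∀ t ∈ Icc (-ε) ε, Φ z t ∈ U ∧ PreservesAt α (fun z => Φ z t) z := by
  set e := extChartAt I x₀ with he
  have hx₀ : e x₀ ∈ e.target := mem_extChartAt_target x₀
  have hU' : e.target ∩ e.symm ⁻¹' U ∈ 𝓝 (e x₀) := by
    refine inter_mem (extChartAt_target_mem_nhds x₀) ?_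
    exact (continuousAt_extChartAt_symm x₀).preimage_mem_nhds (by rwa [extChartAt_to_inv])
  obtain ⟨r, ε, Φ, hΦ⟩ := exists_isLocalFlow (h.c2 x₀ _ hx₀) hU'
  refine ⟨ε, hΦ.eps_pos, e.source ∩ e ⁻¹' ball (e x₀) r,
    inter_mem (extChartAt_source_mem_nhds x₀)
      ((continuousAt_extChartAt x₀).preimage_mem_nhds (ball_mem_nhds _ hΦ.r_pos)),
    fun z t => e.symm (Φ (e z) t), fun z hz => ⟨?_, ?_, fun t ht => ⟨?_, ?_⟩⟩⟩
  · beta_reduce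
    rw [hΦ.init _ hz.2, e.left_inv hz.1]
  · exact fun t ht => hasMFDerivWithinAt_extChartAt_symm_comp (hΦ.deriv _ hz.2 t ht)
      (hΦ.mem _ hz.2 t ht).1
  · exact (hΦ.mem _ hz.2 t ht).2
  · obtain ⟨Y, hY0, hY, hd⟩ := hΦ.variation _ hz.2
    exact h.locallyConst.preservesAt hz.1 (hd t ht) (hΦ.mem _ hz.2 t ht).1
      (compContinuousLinearMap_eq_of_variation h.bilin hY0 hY
        (fun s hs => h.infinitesimal x₀ _ (hΦ.mem _ hz.2 s hs).1) t ht)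
      (Eventually.of_forall fun _ => rfl)

end ManifoldFlow

/-! ### Gluing arcs and impacts of the hybrid flow -/

section HybridFlow

open Metric

variable {W : Type*} [NormedAddCommGroup W] [NormedSpace ℝ W]
  {H' : Type*} [TopologicalSpace H'] {I : ModelWithCorners ℝ W H'}
  {M : Type*} [TopologicalSpace M] [ChartedSpace H' M] {𝓗 : HybridSystem I M}

/-- The constructor has `γ 0` and `γ t` as indices; here the endpoints are arbitrary points with
equations. -/
theorem HybridSystem.Flow.of_smooth {t : ℝ} {γ : ℝ → M} {x y : M} (ht : 0 ≤ t)
    (hγ : IsMIntegralCurveOn γ 𝓗.X (Icc 0 t)) (hS : ∀ s ∈ Icc 0 t, γ s ∉ closure 𝓗.S)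
    (hx : γ 0 = x) (hy : γ t = y) : 𝓗.Flow t x y := by
  subst hx hy
  exact .smooth ht hγ hS

theorem HybridSystem.Flow.of_impact {t₁ t₂ t : ℝ} {γ : ℝ → M} {x p y : M} (ht₁ : 0 < t₁)
    (ht₂ : 0 < t₂) (ht : t = t₁ + t₂) (hγ : IsMIntegralCurveOn γ 𝓗.X (Icc 0 t₁))
    (hS : ∀ s ∈ Ico 0 t₁, γ s ∉ closure 𝓗.S) (hx : γ 0 = x) (hp : γ t₁ = p) (hit : p ∈ 𝓗.S)
    (next : 𝓗.Flow t₂ (𝓗.Δ ⟨p, hit⟩) y) : 𝓗.Flow t x y := by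
  subst hx hp ht
  exact .impact ht₁ ht₂ hγ hS hit next

/-- A hybrid trajectory may be prolonged into the past along an integral curve. -/
theorem HybridSystem.Flow.prepend {t r : ℝ} {c : ℝ → M} {x y : M} (hf : 𝓗.Flow t x y) (hr : 0 ≤ r)
    (hc : IsMIntegralCurveOn c 𝓗.X (Icc 0 r)) (hS : ∀ s ∈ Icc 0 r, c s ∉ closure 𝓗.S)
    (hx : c r = x) : 𝓗.Flow (r + t) (c 0) y := by
  cases hf with
  | @smooth t γ ht hγ hSγ =>
    obtain ⟨d, hd, hd1, hd2⟩ := exists_isMIntegralCurveOn_concat hr hc hγ hx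
    refine .of_smooth (by linarith) hd (fun s hs => ?_) (hd1 ⟨le_rfl, hr⟩) (hd2 t ht)
    rcases le_total s r with h | h
    · rw [hd1 ⟨hs.1, h⟩]
      exact hS s ⟨hs.1, h⟩
    · have := hd2 (s - r) (by simpa using h)
      rw [add_sub_cancel] at this
      rw [this]
      exact hSγ _ ⟨by linarith, by linarith [hs.2]⟩
  | @impact t₁ t₂ γ y ht₁ ht₂ hγ hSγ hit next =>
    obtain ⟨d, hd, hd1, hd2⟩ := exists_isMIntegralCurveOn_concat hr hc hγ hx
    refine .of_impact (t₁ := r + t₁) (by linarith) ht₂ (by ring) hd (fun s hs => ?_)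
      (hd1 ⟨le_rfl, hr⟩) (hd2 t₁ ht₁.le) hit next
    rcases le_total s r with h | h
    · rw [hd1 ⟨hs.1, h⟩]
      exact hS s ⟨hs.1, h⟩
    · have := hd2 (s - r) (by simpa using h)
      rw [add_sub_cancel] at this
      rw [this]
      exact hSγ _ ⟨by linarith, by linarith [hs.2]⟩

variable [IsManifold I 1 M]

/-- The initial smooth piece of a hybrid trajectory may be removed. -/
theorem HybridSystem.Flow.chop [T2Space M] (hX : IsC2Field 𝓗.X) {t r : ℝ} {c : ℝ → M} {x y : M}
    (hf : 𝓗.Flow t x y) (hr : 0 ≤ r) (hrt : r ≤ t) (hc : IsMIntegralCurveOn c 𝓗.X (Icc 0 r))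
    (hS : ∀ s ∈ Icc 0 r, c s ∉ closure 𝓗.S) (hx : c 0 = x) : 𝓗.Flow (t - r) (c r) y := by
  have sub : ∀ {a b : ℝ}, a ≤ b → Icc 0 a ⊆ Icc 0 b := fun h => Icc_subset_Icc le_rfl h
  have shift : ∀ {γ : ℝ → M} {a : ℝ}, IsMIntegralCurveOn γ 𝓗.X (Icc 0 a) →
      IsMIntegralCurveOn (fun s => γ (s + r)) 𝓗.X (Icc 0 (a - r)) := fun h =>
    (isMIntegralCurveOn_Icc_shift h r).mono (Icc_subset_Icc (by linarith) le_rfl)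
  cases hf with
  | @smooth t γ ht hγ hSγ =>
    have h : EqOn c γ (Icc 0 r) :=
      eqOn_of_isMIntegralCurveOn_Icc hX hc (hγ.mono (sub hrt)) ⟨le_rfl, hr⟩ hx
    refine .of_smooth (by linarith) (shift hγ)
      (fun s hs => hSγ _ ⟨by linarith [hs.1], by linarith [hs.2]⟩) ?_ (by simp)
    simp only [zero_add]
    exact (h ⟨hr, le_rfl⟩).symm
  | @impact t₁ t₂ γ y ht₁ ht₂ hγ hSγ hit next =>
    -- Otherwise `c`, which agrees with `γ`, would be on `S` at time `t₁`, against `hS`.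
    have hlt : r < t₁ := by
      by_contra! hle
      have h : EqOn c γ (Icc 0 t₁) :=
        eqOn_of_isMIntegralCurveOn_Icc hX (hc.mono (sub hle)) hγ ⟨le_rfl, ht₁.le⟩ hx
      apply hS t₁ ⟨ht₁.le, hle⟩
      rw [h ⟨ht₁.le, le_rfl⟩]
      exact subset_closure hit
    have h : EqOn c γ (Icc 0 r) :=
      eqOn_of_isMIntegralCurveOn_Icc hX hc (hγ.mono (sub hlt.le)) ⟨le_rfl, hr⟩ hx
    refine .of_impact (t₁ := t₁ - r) (p := γ t₁) (by linarith) ht₂ (by ring) (shift hγ)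
      (fun s hs => hSγ _ ⟨by linarith [hs.1], by linarith [hs.2]⟩) ?_ (by simp) hit next
    simp only [zero_add]
    exact (h ⟨hr, le_rfl⟩).symm

variable {α : (x : M) → (TangentSpace I x) [⋀^Fin 2]→L[ℝ] ℝ} {β : W [⋀^Fin 2]→L[ℝ] ℝ}
  {B : W →L[ℝ] W →L[ℝ] ℝ}

/-- The hybrid flow takes `x` to `y` in time `t`, is defined around `x`, and its derivative at `x`
preserves `α`. -/
def HybridSystem.PreservesAlong (𝓗 : HybridSystem I M)
    (α : (x : M) → (TangentSpace I x) [⋀^Fin 2]→L[ℝ] ℝ) (t : ℝ) (x y : M) : Prop :=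
  ∃ φ : M → M, φ x = y ∧ PreservesAt α φ x ∧ ∀ᶠ z in 𝓝 x, 𝓗.Flow t z (φ z)

/-- The impacts of `𝓗` are transversal and preserve `α`: after the trajectories near an impact
point `y` have been extended smoothly beyond the impact, and those that emanate from the
impact map have been extended smoothly into the past, the resulting map `J` at the impact time of
`y` preserves `α`. -/
def HybridSystem.HasRegularImpacts (𝓗 : HybridSystem I M)
    (α : (x : M) → (TangentSpace I x) [⋀^Fin 2]→L[ℝ] ℝ) : Prop :=
  ∀ (y : M) (hy : y ∈ 𝓗.S), ∃ J : M → M, J y = 𝓗.Δ ⟨y, hy⟩ ∧ PreservesAt α J y ∧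
    -- The lifetime `δ` of the extended curves is uniform in `z` and chosen before `η`, while the
    -- hitting time `τ` can be made as small as a given next arc requires.
    ∃ δ > 0, ∀ η > 0, ∀ᶠ z in 𝓝 y, ∃ (τ : ℝ) (c d : ℝ → M) (hit : c τ ∈ 𝓗.S), |τ| < η ∧
      IsMIntegralCurveOn c 𝓗.X (Icc (-δ) δ) ∧ c 0 = z ∧ (∀ s ∈ Ico (-δ) τ, c s ∉ closure 𝓗.S) ∧
      IsMIntegralCurveOn d 𝓗.X (Icc (-δ) δ) ∧ d τ = 𝓗.Δ ⟨c τ, hit⟩ ∧ d 0 = J z ∧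
      ∀ s ∈ Icc (-δ) δ, d s ∉ closure 𝓗.S

variable [I.Boundaryless] [CompleteSpace W] [T2Space M]

/-- Near `s₀` a single flow box contains the arc from `c a` to `c b`, so the new map is the old one
after the time-`(b - a)` flow, which preserves `α`. The box avoids `closure 𝓗.S`, hence so do all
nearby trajectories. -/
theorem HybridSystem.PreservesAlong.exists_local_prepend (h : IsSymplecticField 𝓗.X α β B) {r : ℝ}
    {c : ℝ → M} (hc : IsMIntegralCurveOn c 𝓗.X (Icc 0 r))
    (hS : ∀ s ∈ Icc 0 r, c s ∉ closure 𝓗.S) {s₀ : ℝ} (hs₀ : s₀ ∈ Icc 0 r) :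
    ∃ δ > 0, ∀ a ∈ ball s₀ δ, ∀ b ∈ ball s₀ δ, a ∈ Icc 0 r → b ∈ Icc 0 r → a ≤ b → ∀ (τ : ℝ)
      (y : M), 𝓗.PreservesAlong α τ (c b) y → 𝓗.PreservesAlong α (b - a + τ) (c a) y := by
  obtain ⟨ε, hε, N, hN, Φ, hΦ⟩ := h.exists_flow (c s₀)
    (isClosed_closure.isOpen_compl.mem_nhds (hS s₀ hs₀))
  obtain ⟨N', hN'N, hN'o, hN'⟩ := mem_nhds_iff.1 hN
  have hcc : ContinuousWithinAt c (Icc 0 r) s₀ := (hc s₀ hs₀).continuousWithinAt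
  obtain ⟨δ, hδ, hδN⟩ := Metric.mem_nhdsWithin_iff.1 (hcc (hN'o.mem_nhds hN'))
  -- Half of `ε`, since `a` and `b` may lie on opposite sides of `s₀`.
  refine ⟨min δ (ε / 2), lt_min hδ (half_pos hε), fun a ha b hb har hbr hab τ y hR => ?_⟩
  obtain ⟨φ, hφy, hφ, hflow⟩ := hR
  have haN : c a ∈ N' := hδN ⟨ball_subset_ball (min_le_left _ _) ha, har⟩
  have hab' : b - a ∈ Icc (-ε) ε := by
    have h1 := ball_subset_ball (min_le_right δ (ε / 2)) ha
    have h2 := ball_subset_ball (min_le_right δ (ε / 2)) hb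
    rw [Real.ball_eq_Ioo] at h1 h2
    constructor <;> linarith [h1.1, h1.2, h2.1, h2.2]
  have hsub : Icc 0 (b - a) ⊆ Icc (-ε) ε := Icc_subset_Icc (by linarith) hab'.2
  have hend : Φ (c a) (b - a) = c b := by
    have h1 : IsMIntegralCurveOn (fun s => c (s + a)) 𝓗.X (Icc 0 (b - a)) :=
      (isMIntegralCurveOn_Icc_shift hc a).mono (Icc_subset_Icc (by linarith [har.1])
        (by linarith [hbr.2]))
    have h2 := eqOn_of_isMIntegralCurveOn_Icc h.c2 ((hΦ (c a) (hN'N haN)).2.1.mono hsub) h1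
      (s₀ := 0) ⟨le_rfl, by linarith⟩ (by simp [(hΦ (c a) (hN'N haN)).1])
    have h3 := h2 (x := b - a) ⟨by linarith, le_rfl⟩
    simpa using h3
  have hpres : PreservesAt α (fun z => Φ z (b - a)) (c a) :=
    ((hΦ _ (hN'N haN)).2.2 _ hab').2
  refine ⟨fun z => φ (Φ z (b - a)), by simp only [hend, hφy],
    PreservesAt.comp (φ := fun z => Φ z (b - a)) (by simpa only [hend] using hφ) hpres, ?_⟩
  have hcont : Tendsto (fun z => Φ z (b - a)) (𝓝 (c a)) (𝓝 (c b)) := by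
    simpa only [ContinuousAt, hend] using hpres.continuousAt
  filter_upwards [hN'o.mem_nhds haN, hcont.eventually hflow] with z hz hfz
  have := hfz.prepend (c := Φ z) (by linarith) ((hΦ z (hN'N hz)).2.1.mono hsub)
    (fun s hs => ((hΦ z (hN'N hz)).2.2 s (hsub hs)).1) rfl
  rwa [(hΦ z (hN'N hz)).1] at this

/-- The arc is compact, so a Lebesgue number `ρ` cuts it into steps of length at most `ρ / 2`, each
inside one flow box. The induction runs backwards from the end of the arc. -/
theorem HybridSystem.PreservesAlong.prepend (h : IsSymplecticField 𝓗.X α β B) {r : ℝ} (hr : 0 ≤ r)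
    {c : ℝ → M} (hc : IsMIntegralCurveOn c 𝓗.X (Icc 0 r))
    (hS : ∀ s ∈ Icc 0 r, c s ∉ closure 𝓗.S) {τ : ℝ} {y : M}
    (hR : 𝓗.PreservesAlong α τ (c r) y) : 𝓗.PreservesAlong α (r + τ) (c 0) y := by
  choose! δ hδ hstep using fun s₀ (hs₀ : s₀ ∈ Icc 0 r) =>
    HybridSystem.PreservesAlong.exists_local_prepend h hc hS hs₀
  obtain ⟨ρ, hρ, hleb⟩ := lebesgue_number_lemma_of_metric (isCompact_Icc (a := (0 : ℝ)) (b := r))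
    (c := fun s : Icc 0 r => ball (s : ℝ) (δ s)) (fun _ => isOpen_ball)
    (fun s hs => mem_iUnion.2 ⟨⟨s, hs⟩, mem_ball_self (hδ s hs)⟩)
  have key : ∀ (n : ℕ), ∀ s ∈ Icc 0 r, r - s ≤ n * (ρ / 2) →
      𝓗.PreservesAlong α (r - s + τ) (c s) y := by
    intro n
    induction n with
    | zero =>
      intro s hs hle
      obtain rfl : s = r := le_antisymm hs.2 (by simpa using hle)
      simpa using hR
    | succ n ih =>
      intro s hs hle
      have hb : min r (s + ρ / 2) ∈ Icc 0 r :=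
        ⟨le_min hr (by linarith [hs.1]), min_le_left _ _⟩
      have hsb : s ≤ min r (s + ρ / 2) := le_min hs.2 (by linarith)
      have h1 := ih _ hb (by
        push_cast at hle
        rcases min_choice r (s + ρ / 2) with e | e <;> rw [e]
        · simp only [sub_self]; positivity
        · linarith)
      obtain ⟨i, hi⟩ := hleb s hs
      have h2 := hstep i i.2 s (hi (mem_ball_self hρ)) _ (hi (by
        rw [Real.ball_eq_Ioo]
        exact ⟨by linarith, by linarith [min_le_right r (s + ρ / 2)]⟩)) hs hb hsb _ y h1
      convert h2 using 1
      ring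
  obtain ⟨n, hn⟩ := exists_nat_ge (r / (ρ / 2))
  have := key n 0 ⟨le_rfl, hr⟩ (by rw [sub_zero]; exact (div_le_iff₀ (by positivity)).1 hn)
  simpa using this

/-- The hybrid flow of an infinitesimally symplectic field with regular impacts preserves the
form. -/
theorem HybridSystem.Flow.preservesAlong (h : IsSymplecticField 𝓗.X α β B)
    (hJ : 𝓗.HasRegularImpacts α) {t : ℝ} {x y : M} (hf : 𝓗.Flow t x y) :
    𝓗.PreservesAlong α t x y := by
  induction hf with
  | @smooth t γ ht hγ hS =>
    -- At time `0` the hybrid flow is the identity, and it is defined nearby because `γ t` lies in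
    -- the open complement of `closure 𝓗.S`.
    have h0 : 𝓗.PreservesAlong α 0 (γ t) (γ t) := by
      refine ⟨fun z => z, rfl, PreservesAt.id, ?_⟩
      obtain ⟨ε, hε, N, hN, Φ, hΦ⟩ := h.exists_flow (γ t)
        (isClosed_closure.isOpen_compl.mem_nhds (hS t ⟨ht, le_rfl⟩))
      filter_upwards [hN] with z hz
      have hsub : Icc 0 0 ⊆ Icc (-ε) ε := Icc_subset_Icc (by linarith) hε.le
      exact .of_smooth (γ := Φ z) le_rfl ((hΦ z hz).2.1.mono hsub)
        (fun s hs => ((hΦ z hz).2.2 s (hsub hs)).1) (hΦ z hz).1 (hΦ z hz).1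
    simpa using HybridSystem.PreservesAlong.prepend h ht hγ hS h0
  | @impact t₁ t₂ γ w ht₁ ht₂ hγ hS hit next ih =>
    obtain ⟨ψ, hψw, hψ, hψflow⟩ := ih
    obtain ⟨J, hJy, hJpres, δ₀, hδ₀, hJ⟩ := hJ _ hit
    obtain ⟨ε, hε, N, hN, Φ, hΦ⟩ := h.exists_flow (γ t₁) univ_mem
    obtain ⟨N', hN'N, hN'o, hN'⟩ := mem_nhds_iff.1 hN
    have hcc : ContinuousWithinAt γ (Icc 0 t₁) t₁ := (hγ t₁ ⟨ht₁.le, le_rfl⟩).continuousWithinAt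
    obtain ⟨ρ, hρ, hρN⟩ := Metric.mem_nhdsWithin_iff.1 (hcc (hN'o.mem_nhds hN'))
    -- The trajectory is cut at time `t₁ - δ`, late enough for one flow box to reach the impact
    -- point and for the extended curves of `hJ` to exist.
    obtain ⟨δ, hδ, hδδ₀, hδε, hδt, hδρ⟩ : ∃ δ > 0, δ ≤ δ₀ ∧ δ ≤ ε ∧ δ ≤ t₁ ∧ δ < ρ := by
      refine ⟨min (min δ₀ ε) (min t₁ (ρ / 2)), by positivity, ?_, ?_, ?_, ?_⟩
      · exact (min_le_left _ _).trans (min_le_left _ _)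
      · exact (min_le_left _ _).trans (min_le_right _ _)
      · exact (min_le_right _ _).trans (min_le_left _ _)
      · exact ((min_le_right _ _).trans (min_le_right _ _)).trans_lt (by linarith)
    set x₁ := γ (t₁ - δ) with hx₁
    have hx₁N : x₁ ∈ N' := hρN ⟨by rw [Real.ball_eq_Ioo]; constructor <;> linarith,
      by constructor <;> linarith⟩
    have hδI : δ ∈ Icc (-ε) ε := ⟨by linarith, hδε⟩
    have hend : Φ x₁ δ = γ t₁ := by
      have h1 : IsMIntegralCurveOn (fun s => γ (s + (t₁ - δ))) 𝓗.X (Icc 0 δ) :=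
        (isMIntegralCurveOn_Icc_shift hγ (t₁ - δ)).mono
          (Icc_subset_Icc (by linarith) (by linarith))
      have h2 := eqOn_of_isMIntegralCurveOn_Icc h.c2
        ((hΦ x₁ (hN'N hx₁N)).2.1.mono (Icc_subset_Icc (by linarith) hδε)) h1
        (s₀ := 0) ⟨le_rfl, hδ.le⟩ (by rw [(hΦ x₁ (hN'N hx₁N)).1]; simp [hx₁])
      have h3 := h2 (x := δ) ⟨hδ.le, le_rfl⟩
      simpa using h3
    have hpres : PreservesAt α (fun z => Φ z δ) x₁ := ((hΦ _ (hN'N hx₁N)).2.2 _ hδI).2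
    have hcont : Tendsto (fun z => Φ z δ) (𝓝 x₁) (𝓝 (γ t₁)) := by
      simpa only [ContinuousAt, hend] using hpres.continuousAt
    have hJcont : Tendsto J (𝓝 (γ t₁)) (𝓝 (𝓗.Δ ⟨γ t₁, hit⟩)) := by
      simpa only [ContinuousAt, hJy] using hJpres.continuousAt
    -- Flow for time `δ` as if there were no impact, apply `J`, then follow the rest: `J` absorbs
    -- the dependence of the hitting time on `z`.
    have hR : 𝓗.PreservesAlong α (δ + t₂) x₁ w := by
      refine ⟨fun z => ψ (J (Φ z δ)), by simp only [hend, hJy, hψw],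
        PreservesAt.comp (ψ := fun z => ψ (J z)) (φ := fun z => Φ z δ) ?_ hpres, ?_⟩
      · simp only [hend]
        exact PreservesAt.comp (by simpa only [hJy] using hψ) hJpres
      have hη : 0 < min δ t₂ := lt_min hδ ht₂
      filter_upwards [hN'o.mem_nhds hx₁N, hcont.eventually (hJ _ hη),
        hcont.eventually (hJcont.eventually hψflow)] with z hz hz' hflow
      obtain ⟨τ, c, d, hitc, hτ, hc, hc0, hcS, hd, hdτ, hd0, hdS⟩ := hz'
      have hτδ : |τ| < δ := hτ.trans_le (min_le_left _ _)
      have hτt : |τ| < t₂ := hτ.trans_le (min_le_right _ _)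
      rw [abs_lt] at hτδ hτt
      have hcz : c (-δ) = z := by
        have h1 : IsMIntegralCurveOn (fun s => Φ z (s + δ)) 𝓗.X (Icc (-δ) 0) :=
          (isMIntegralCurveOn_Icc_shift (hΦ z (hN'N hz)).2.1 δ).mono
            (Icc_subset_Icc (by linarith) (by linarith))
        have h2 := eqOn_of_isMIntegralCurveOn_Icc h.c2
          (hc.mono (Icc_subset_Icc (by linarith) (by linarith))) h1
          (s₀ := 0) ⟨by linarith, le_rfl⟩ (by simp [hc0])
        have h3 := h2 (x := -δ) ⟨le_rfl, by linarith⟩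
        simpa [(hΦ z (hN'N hz)).1] using h3
      have hdI : ∀ {a b : ℝ}, -δ ≤ a → b ≤ δ → Icc a b ⊆ Icc (-δ₀) δ₀ := fun h1 h2 =>
        Icc_subset_Icc (by linarith) (by linarith)
      -- The flow known from `hψflow` starts at `J z'`, with `z' = Φ z δ`, but the real one starts
      -- at `d τ`. For a late hit the arc of `d` from `0` to `τ` is removed; for an early hit the
      -- arc from `τ` to `0` is added in front.
      have hnext : 𝓗.Flow (t₂ - τ) (𝓗.Δ ⟨c τ, hitc⟩) (ψ (J (Φ z δ))) := by
        rcases le_total 0 τ with h0 | h0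
        · have := hflow.chop h.c2 (c := d) h0 hτt.2.le (hd.mono (hdI (by linarith) hτδ.2.le))
            (fun s hs => hdS s (hdI (by linarith) hτδ.2.le hs)) hd0
          rwa [hdτ] at this
        · have := hflow.prepend (c := fun s => d (s + τ)) (r := -τ) (by linarith)
            ((isMIntegralCurveOn_Icc_shift hd τ).mono
              (Icc_subset_Icc (by linarith) (by linarith)))
            (fun s hs => hdS _ ⟨by linarith [hs.1], by linarith [hs.2]⟩) (by simp [hd0])
          simp only [zero_add, hdτ] at this
          rwa [neg_add_eq_sub] at this
      refine .of_impact (t₁ := δ + τ) (γ := fun s => c (s - δ)) (p := c τ) (by linarith)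
        (by linarith) (by ring) ?_ ?_ (by simpa using hcz) (by simp) hitc hnext
      · have := isMIntegralCurveOn_Icc_shift hc (-δ)
        exact this.mono (Icc_subset_Icc (by linarith) (by linarith))
      · exact fun s hs => hcS _ ⟨by linarith [hs.1], by linarith [hs.2]⟩
    have := HybridSystem.PreservesAlong.prepend h (r := t₁ - δ) (c := γ) (by linarith)
      (hγ.mono (Icc_subset_Icc le_rfl (by linarith)))
      (fun s hs => hS s ⟨hs.1, by linarith [hs.2]⟩) hR
    convert this using 1
    ring

end HybridFlow

/-! ### Naturality of the wedge product -/

section Wedge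

variable {W W' : Type*} [AddCommGroup W] [Module ℝ W] [TopologicalSpace W]
  [AddCommGroup W'] [Module ℝ W'] [TopologicalSpace W']

theorem wedge_compContinuousLinearMap {k l : ℕ} (α : W [⋀^Fin k]→L[ℝ] ℝ) (β : W [⋀^Fin l]→L[ℝ] ℝ)
    (A : W' →L[ℝ] W) :
    (wedge α β).compContinuousLinearMap A =
      wedge (α.compContinuousLinearMap A) (β.compContinuousLinearMap A) := by
  ext v
  simp only [wedge, ContinuousAlternatingMap.compContinuousLinearMap_apply,
    ContinuousAlternatingMap.smul_apply, ContinuousMultilinearMap.alternatization_apply_apply]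
  rfl

theorem wedgePow_compContinuousLinearMap (σ : W [⋀^Fin 2]→L[ℝ] ℝ) (A : W' →L[ℝ] W) (k : ℕ) :
    (wedgePow σ k).compContinuousLinearMap A = wedgePow (σ.compContinuousLinearMap A) k := by
  induction k with
  | zero => rfl
  | succ k ih => 
    change (wedge (wedgePow σ k) σ).compContinuousLinearMap A = wedge _ _
    rw [wedge_compContinuousLinearMap, ih]

end Wedge

/-! ### The standard form and cotangent lifts -/

section Lift

variable {E : Type*} [NormedAddCommGroup E] [NormedSpace ℝ E]

variable (E) in
/-- The bilinear form of `stdSymplectic`. -/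
def stdBilin : (E × (E →L[ℝ] ℝ)) →L[ℝ] (E × (E →L[ℝ] ℝ)) →L[ℝ] ℝ :=
  let P : (E × (E →L[ℝ] ℝ)) →L[ℝ] (E × (E →L[ℝ] ℝ)) →L[ℝ] ℝ :=
    ((ContinuousLinearMap.compL ℝ (E × (E →L[ℝ] ℝ)) E ℝ).flip
      (ContinuousLinearMap.fst ℝ E (E →L[ℝ] ℝ))).comp (ContinuousLinearMap.snd ℝ E (E →L[ℝ] ℝ))
  P.flip - P

@[simp]
theorem stdBilin_apply (u v : E × (E →L[ℝ] ℝ)) : stdBilin E u v = v.2 u.1 - u.2 v.1 := rfl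

theorem stdSymplectic_eq_stdBilin (u : Fin 2 → E × (E →L[ℝ] ℝ)) :
    stdSymplectic E u = stdBilin E (u 0) (u 1) := rfl

theorem stdSymplectic_compContinuousLinearMap_eq {A : (E × (E →L[ℝ] ℝ)) →L[ℝ] (E × (E →L[ℝ] ℝ))}
    (h : ∀ u v, stdBilin E (A u) (A v) = stdBilin E u v) :
    (stdSymplectic E).compContinuousLinearMap A = stdSymplectic E :=
  ContinuousAlternatingMap.ext fun u => h (u 0) (u 1)

/-- The cotangent lift `(q, p) ↦ (ψ q, p ∘ Dθ (ψ q))` of a map `ψ` with left inverse `θ`. -/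
def cotangentLift (ψ θ : E → E) (y : E × (E →L[ℝ] ℝ)) : E × (E →L[ℝ] ℝ) :=
  (ψ y.1, y.2 ∘L fderiv ℝ θ (ψ y.1))

/-- Cotangent lifts are symplectic. -/
theorem exists_hasFDerivAt_cotangentLift {ψ θ : E → E} {y : E × (E →L[ℝ] ℝ)}
    (hψ : DifferentiableAt ℝ ψ y.1) (hθ : ContDiffAt ℝ 2 θ (ψ y.1))
    (hinv : ∀ᶠ a in 𝓝 y.1, θ (ψ a) = a) :
    ∃ A : (E × (E →L[ℝ] ℝ)) →L[ℝ] (E × (E →L[ℝ] ℝ)), HasFDerivAt (cotangentLift ψ θ) A y ∧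
      ∀ u v, stdBilin E (A u) (A v) = stdBilin E u v := by
  have h1 : HasFDerivAt (fun y : E × (E →L[ℝ] ℝ) => ψ y.1)
      (fderiv ℝ ψ y.1 ∘L ContinuousLinearMap.fst ℝ E (E →L[ℝ] ℝ)) y :=
    hψ.hasFDerivAt.comp y hasFDerivAt_fst
  have hθ' : DifferentiableAt ℝ (fderiv ℝ θ) (ψ y.1) :=
    (hθ.fderiv_right (m := 1) (by norm_num)).differentiableAt (by norm_num)
  have h2 := (hθ'.hasFDerivAt.comp y h1)
  have h3 := (hasFDerivAt_snd (𝕜 := ℝ) (p := y)).clm_comp h2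
  have hid : ∀ v, fderiv ℝ θ (ψ y.1) (fderiv ℝ ψ y.1 v) = v := by
    have h4 : HasFDerivAt (fun a => θ (ψ a)) (fderiv ℝ θ (ψ y.1) ∘L fderiv ℝ ψ y.1) y.1 :=
      (hθ.differentiableAt (by norm_num)).hasFDerivAt.comp y.1 hψ.hasFDerivAt
    have h5 := h4.unique ((hasFDerivAt_id y.1).congr_of_eventuallyEq hinv)
    exact fun v => congrArg (fun B => B v) h5
  -- The terms in which `y.2` is applied to the second derivative of `θ` cancel by this symmetry;
  -- `hid` reduces what remains to the original form.
  have hsymm : ∀ a b, fderiv ℝ (fderiv ℝ θ) (ψ y.1) a b = fderiv ℝ (fderiv ℝ θ) (ψ y.1) b a :=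
    fun a b => (hθ.isSymmSndFDerivAt (by simp)) a b
  refine ⟨_, h1.prodMk h3, fun u v => ?_⟩
  simp [hid, hsymm (fderiv ℝ ψ y.1 u.1)]

end Lift

/-! ### Cotangent charts and the canonical symplectic form -/

section CotangentChart

variable {E : Type*} [NormedAddCommGroup E] [NormedSpace ℝ E]
  {Q : Type*} [TopologicalSpace Q] [ChartedSpace E Q] [IsManifold 𝓘(ℝ, E) ∞ Q]

/-- The coordinate frame at `q` of the chart around `q₀`. -/
def frame (q₀ q : Q) : E →L[ℝ] TangentSpace 𝓘(ℝ, E) q :=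
  (trivializationAt E (TangentSpace 𝓘(ℝ, E)) q₀).symmL ℝ q

theorem mem_cotangent_source {x₀ x : Cotangent E Q} :
    x ∈ (extChartAt (cotModel E) x₀).source ↔ x.proj ∈ (extChartAt 𝓘(ℝ, E) x₀.proj).source := by
  simp [FiberBundle.chartedSpace_chartAt]
  exact fun h => h

theorem mem_cotangent_target {x₀ : Cotangent E Q} {y : E × (E →L[ℝ] ℝ)} :
    y ∈ (extChartAt (cotModel E) x₀).target ↔
      y.1 ∈ (extChartAt 𝓘(ℝ, E) x₀.proj).target := by
  rw [FiberBundle.extChartAt]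
  simp
  exact fun h => (chartAt E x₀.proj).map_target h

theorem extChartAt_cotangent_apply (x₀ x : Cotangent E Q) :
    extChartAt (cotModel E) x₀ x =
      (extChartAt 𝓘(ℝ, E) x₀.proj x.proj, x.2 ∘L frame x₀.proj x.proj) := by
  rw [FiberBundle.extChartAt]
  simp [hom_trivializationAt_apply, ContinuousLinearMap.inCoordinates, frame]

theorem frame_eq_mfderiv {q₀ q : Q} (hq : q ∈ (extChartAt 𝓘(ℝ, E) q₀).source) :
    (frame q₀ q : E →L[ℝ] TangentSpace 𝓘(ℝ, E) q) =
      mfderiv 𝓘(ℝ, E) 𝓘(ℝ, E) (extChartAt 𝓘(ℝ, E) q₀).symm (extChartAt 𝓘(ℝ, E) q₀ q) := by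
  have := TangentBundle.symmL_trivializationAt (I := 𝓘(ℝ, E)) (x₀ := q₀) (x := q) (by simpa using hq)
  rwa [ModelWithCorners.range_eq_univ, mfderivWithin_univ] at this

/-- Coordinate frames are derivatives of inverse charts, so the chain rule relates them by the
Jacobian of the coordinate change. Dually, this is the transformation rule of the momenta. -/
theorem frame_comp_fderiv {q₀ q₁ q : Q} (hq₀ : q ∈ (extChartAt 𝓘(ℝ, E) q₀).source)
    (hq₁ : q ∈ (extChartAt 𝓘(ℝ, E) q₁).source) :
    (frame q₁ q : E →L[ℝ] TangentSpace 𝓘(ℝ, E) q) ∘L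
      fderiv ℝ (fun a => extChartAt 𝓘(ℝ, E) q₁ ((extChartAt 𝓘(ℝ, E) q₀).symm a))
        (extChartAt 𝓘(ℝ, E) q₀ q) = frame q₀ q := by
  set c₀ := extChartAt 𝓘(ℝ, E) q₀ with hc₀
  set c₁ := extChartAt 𝓘(ℝ, E) q₁ with hc₁
  have hm0 : MDifferentiableAt 𝓘(ℝ, E) 𝓘(ℝ, E) c₀.symm (c₀ q) := by
    have := mdifferentiableWithinAt_extChartAt_symm (I := 𝓘(ℝ, E)) (c₀.map_source hq₀)
    rwa [ModelWithCorners.range_eq_univ, mdifferentiableWithinAt_univ] at this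
  have hq : c₀.symm (c₀ q) = q := c₀.left_inv hq₀
  have hm1 : MDifferentiableAt 𝓘(ℝ, E) 𝓘(ℝ, E) c₁ (c₀.symm (c₀ q)) := by
    rw [hq]
    exact mdifferentiableAt_extChartAt (by simpa [hc₁] using hq₁)
  have h1 : fderiv ℝ (fun a => c₁ (c₀.symm a)) (c₀ q) =
      mfderiv 𝓘(ℝ, E) 𝓘(ℝ, E) c₁ (c₀.symm (c₀ q)) ∘L
        mfderiv 𝓘(ℝ, E) 𝓘(ℝ, E) c₀.symm (c₀ q) := by
    rw [← mfderiv_comp (c₀ q) hm1 hm0, mfderiv_eq_fderiv]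
    rfl
  have h2 := mfderivWithin_extChartAt_symm_comp_mfderiv_extChartAt' (I := 𝓘(ℝ, E)) hq₁
  rw [ModelWithCorners.range_eq_univ, mfderivWithin_univ] at h2
  rw [frame_eq_mfderiv hq₁, frame_eq_mfderiv hq₀, h1, hq]
  exact ContinuousLinearMap.ext fun v =>
    congrArg (fun A => A (mfderiv 𝓘(ℝ, E) 𝓘(ℝ, E) c₀.symm (c₀ q) v)) h2

theorem contDiffAt_coordChange {q₀ q₁ q : Q} (hq₀ : q ∈ (extChartAt 𝓘(ℝ, E) q₀).source)
    (hq₁ : q ∈ (extChartAt 𝓘(ℝ, E) q₁).source) :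
    ContDiffAt ℝ ∞ (fun a => extChartAt 𝓘(ℝ, E) q₁ ((extChartAt 𝓘(ℝ, E) q₀).symm a))
      (extChartAt 𝓘(ℝ, E) q₀ q) := by
  have := contDiffWithinAt_ext_coord_change (I := 𝓘(ℝ, E)) (n := ∞) q₁ q₀
    (y := extChartAt 𝓘(ℝ, E) q₀ q) (by
      refine ⟨(extChartAt 𝓘(ℝ, E) q₀).map_source hq₀, ?_⟩
      simp only [mem_preimage]
      change (extChartAt 𝓘(ℝ, E) q₀).symm (extChartAt 𝓘(ℝ, E) q₀ q) ∈ _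
      rwa [(extChartAt 𝓘(ℝ, E) q₀).left_inv hq₀])
  rwa [ModelWithCorners.range_eq_univ, contDiffWithinAt_univ] at this

/-- Near `x`, the cotangent chart at `x₀` is a cotangent lift of the cotangent chart at `x`. -/
theorem eventually_extChartAt_cotangent_eq {x₀ x : Cotangent E Q}
    (hx : x ∈ (extChartAt (cotModel E) x₀).source) :
    ∀ᶠ z in 𝓝 x, extChartAt (cotModel E) x₀ z =
      cotangentLift (fun a => extChartAt 𝓘(ℝ, E) x₀.proj ((extChartAt 𝓘(ℝ, E) x.proj).symm a))
        (fun a => extChartAt 𝓘(ℝ, E) x.proj ((extChartAt 𝓘(ℝ, E) x₀.proj).symm a))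
        (extChartAt (cotModel E) x z) := by
  filter_upwards [(isOpen_extChartAt_source (I := cotModel E) x₀).mem_nhds hx,
    extChartAt_source_mem_nhds (I := cotModel E) x] with z hz₀ hz
  rw [mem_cotangent_source] at hz₀ hz
  have hl := (extChartAt 𝓘(ℝ, E) x.proj).left_inv hz
  rw [extChartAt_cotangent_apply, extChartAt_cotangent_apply]
  simp only [cotangentLift, hl]
  rw [← frame_comp_fderiv hz₀ hz]
  rfl

/-- `canonicalSymplectic x` uses the chart at `x` itself. Changes of cotangent charts are cotangent
lifts, which are symplectic, so every chart around `x` gives the same form. -/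
theorem isLocallyConst_canonicalSymplectic :
    IsLocallyConst (canonicalSymplectic (E := E) (Q := Q)) (stdSymplectic E) := by
  intro x₀ x hx
  have hq₀ := mem_cotangent_source.1 hx
  have hq : x.proj ∈ (extChartAt 𝓘(ℝ, E) x.proj).source := mem_extChartAt_source x.proj
  have hx1 : (extChartAt (cotModel E) x x).1 = extChartAt 𝓘(ℝ, E) x.proj x.proj := by
    rw [extChartAt_cotangent_apply]
  have hl := (extChartAt 𝓘(ℝ, E) x.proj).left_inv hq
  obtain ⟨A, hA, hA'⟩ := exists_hasFDerivAt_cotangentLift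
    (ψ := fun a => extChartAt 𝓘(ℝ, E) x₀.proj ((extChartAt 𝓘(ℝ, E) x.proj).symm a))
    (θ := fun a => extChartAt 𝓘(ℝ, E) x.proj ((extChartAt 𝓘(ℝ, E) x₀.proj).symm a))
    (y := extChartAt (cotModel E) x x)
    (by rw [hx1]; exact (contDiffAt_coordChange hq hq₀).differentiableAt (by simp))
    (by rw [hx1, hl]; exact contDiffAt_infty.1 (contDiffAt_coordChange hq₀ hq) 2)
    (by
      rw [hx1]
      have h1 : ∀ᶠ a in 𝓝 (extChartAt 𝓘(ℝ, E) x.proj x.proj),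
          a ∈ (extChartAt 𝓘(ℝ, E) x.proj).target := extChartAt_target_mem_nhds x.proj
      have h2 : ∀ᶠ a in 𝓝 (extChartAt 𝓘(ℝ, E) x.proj x.proj),
          (extChartAt 𝓘(ℝ, E) x.proj).symm a ∈ (extChartAt 𝓘(ℝ, E) x₀.proj).source := by
        refine (continuousAt_extChartAt_symm x.proj).eventually_mem ?_
        rw [hl]
        exact (isOpen_extChartAt_source x₀.proj).mem_nhds hq₀
      filter_upwards [h1, h2] with a ha1 ha2
      rw [(extChartAt 𝓘(ℝ, E) x₀.proj).left_inv ha2, (extChartAt 𝓘(ℝ, E) x.proj).right_inv ha1])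
  have h1 : HasMFDerivAt (cotModel E) 𝓘(ℝ, E × (E →L[ℝ] ℝ)) (extChartAt (cotModel E) x) x
      (chartDeriv x) :=
    (mdifferentiableAt_extChartAt (mem_chart_source _ x)).hasMFDerivAt
  have h2 := (hA.hasMFDerivAt.comp x h1).congr_of_eventuallyEq
    (eventually_extChartAt_cotangent_eq hx)
  rw [h2.mfderiv, canonicalSymplectic]
  refine ContinuousAlternatingMap.ext fun u => ?_
  exact (hA' (chartDeriv x (u 0)) (chartDeriv x (u 1))).symm

theorem isLocallyConst_liouvillePower (k : ℕ) :
    IsLocallyConst (liouvillePower (E := E) (Q := Q) k) (wedgePow (stdSymplectic E) k) := by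
  intro x₀ x hx
  rw [liouvillePower, isLocallyConst_canonicalSymplectic x₀ x hx]
  exact (wedgePow_compContinuousLinearMap (stdSymplectic E) _ k).symm

/-- Pullback by a linear map commutes with wedge powers, so the derivative that preserves `ω`
preserves `ω^k`. -/
theorem PreservesAt.liouvillePower {φ : Cotangent E Q → Cotangent E Q} {x : Cotangent E Q}
    (h : PreservesAt canonicalSymplectic φ x) (k : ℕ) :
    PreservesAt (HybridImpact.liouvillePower k) φ x := by
  obtain ⟨A, hA, hA'⟩ := h
  refine ⟨A, hA, ?_⟩
  rw [HybridImpact.liouvillePower, wedgePow_compContinuousLinearMap, hA']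
  rfl

/-- Points of one fibre are separated inside a common cotangent chart, other points in the base.
Uniqueness of integral curves depends on this. -/
instance [T2Space Q] : T2Space (Cotangent E Q) := by
  refine ⟨fun x y hxy => ?_⟩
  by_cases h : x.proj = y.proj
  · have hx : x ∈ (extChartAt (cotModel E) x).source := mem_extChartAt_source x
    have hy : y ∈ (extChartAt (cotModel E) x).source := by
      rw [mem_cotangent_source, ← h]
      exact mem_extChartAt_source x.proj
    have hne : extChartAt (cotModel E) x x ≠ extChartAt (cotModel E) x y :=
      fun he => hxy ((extChartAt (cotModel E) x).injOn hx hy he)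
    obtain ⟨u, v, hu, hv, hxu, hyv, huv⟩ := t2_separation hne
    have hc := continuousOn_extChartAt (I := cotModel E) x
    have ho := isOpen_extChartAt_source (I := cotModel E) x
    exact ⟨_, _, hc.isOpen_inter_preimage ho hu, hc.isOpen_inter_preimage ho hv, ⟨hx, hxu⟩,
      ⟨hy, hyv⟩, disjoint_left.2 fun z hz hz' => disjoint_left.1 huv hz.2 hz'.2⟩
  · obtain ⟨u, v, hu, hv, hxu, hyv, huv⟩ := t2_separation h
    have hc : Continuous (TotalSpace.proj : Cotangent E Q → Q) :=
      FiberBundle.continuous_proj (E →L[ℝ] ℝ) _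
    exact ⟨_, _, hu.preimage hc, hv.preimage hc, hxu, hyv, huv.preimage _⟩

end CotangentChart

/-! ### Hamiltonian vector fields are symplectic -/

section HamiltonianField

/-- A field `f` with `B (f, ·) = DF`, `B` a nondegenerate alternating form, is smooth and
infinitesimally symplectic. -/
theorem contDiffAt_and_infinitesimal_of_eq_fderiv {W : Type*} [NormedAddCommGroup W]
    [NormedSpace ℝ W] [FiniteDimensional ℝ W] {B : W →L[ℝ] W →L[ℝ] ℝ}
    (hB : Function.Bijective B) (hanti : ∀ u v, B u v = -B v u) {f : W → W} {F : W → ℝ} {y : W}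
    (hF : ContDiffAt ℝ ∞ F y) (h : ∀ᶠ z in 𝓝 y, B (f z) = fderiv ℝ F z) :
    ContDiffAt ℝ 2 f y ∧ ∀ v w, B (fderiv ℝ f y v) w + B v (fderiv ℝ f y w) = 0 := by
  set J : W ≃L[ℝ] (W →L[ℝ] ℝ) :=
    (LinearEquiv.ofBijective B.toLinearMap hB).toContinuousLinearEquiv with hJ
  have hJB : ∀ u, J u = B u := fun _ => rfl
  have hf : ContDiffAt ℝ 2 f y := by
    have h1 : ContDiffAt ℝ 2 (fun y => J.symm (fderiv ℝ F y)) y :=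
      J.symm.contDiff.contDiffAt.comp y
        ((contDiffAt_infty.1 hF 3).fderiv_right (m := 2) (by norm_num))
    refine h1.congr_of_eventuallyEq ?_
    filter_upwards [h] with z hz
    rw [← hz, ← hJB, ContinuousLinearEquiv.symm_apply_apply]
  refine ⟨hf, fun v w => ?_⟩
  have hd : HasFDerivAt f (fderiv ℝ f y) y := (hf.differentiableAt (by simp)).hasFDerivAt
  -- Differentiating `B (f ·) = DF` turns the infinitesimal condition into the symmetry of the
  -- second derivative of `F`.
  have h1 : B ∘L fderiv ℝ f y = fderiv ℝ (fderiv ℝ F) y := by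
    rw [← EventuallyEq.fderiv_eq (f₁ := fun z => B (f z)) h]
    exact (B.hasFDerivAt.comp y hd).fderiv.symm
  have h2 : ∀ v w, B (fderiv ℝ f y v) w = fderiv ℝ (fderiv ℝ F) y v w := fun v w => by
    rw [← h1]; rfl
  have h3 : fderiv ℝ (fderiv ℝ F) y v w = fderiv ℝ (fderiv ℝ F) y w v :=
    ((contDiffAt_infty.1 hF 2).isSymmSndFDerivAt (by simp)) v w
  rw [hanti v, h2, h2, h3, add_neg_cancel]

section

variable {E : Type*} [NormedAddCommGroup E] [NormedSpace ℝ E]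
  {Q : Type*} [TopologicalSpace Q] [ChartedSpace E Q] [IsManifold 𝓘(ℝ, E) ∞ Q]

theorem contDiffAt_comp_extChartAt_symm {H : Cotangent E Q → ℝ}
    (hH : ContMDiff (cotModel E) 𝓘(ℝ, ℝ) ∞ H)
    {x₀ : Cotangent E Q} {y : E × (E →L[ℝ] ℝ)} (hy : y ∈ (extChartAt (cotModel E) x₀).target) :
    ContDiffAt ℝ ∞ (fun y => H ((extChartAt (cotModel E) x₀).symm y)) y := by
  have h1 := (contMDiffOn_extChartAt_symm (I := cotModel E) (n := ∞) x₀).contMDiffAt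
    ((isOpen_extChartAt_target x₀).mem_nhds hy)
  exact (hH.contMDiffAt.comp y h1).contDiffAt

end

variable {E : Type*} [NormedAddCommGroup E] [NormedSpace ℝ E] [FiniteDimensional ℝ E]

theorem bijective_stdBilin : Function.Bijective (stdBilin E) := by
  constructor
  · refine (injective_iff_map_eq_zero (stdBilin E)).2 fun u hu => ?_
    have h : ∀ v, stdBilin E u v = 0 := fun v => by rw [hu]; rfl
    have h2 : u.2 = 0 := by
      ext a
      simpa using h (a, 0)
    have h1 : u.1 = 0 := by
      refine (Module.forall_dual_apply_eq_zero_iff ℝ u.1).1 fun f => ?_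
      simpa using h (0, LinearMap.toContinuousLinearMap f)
    exact Prod.ext h1 h2
  · intro L
    obtain ⟨u, hu⟩ := exists_stdSymplectic_eq L
    exact ⟨u, ContinuousLinearMap.ext hu⟩

variable {Q : Type*} [TopologicalSpace Q] [ChartedSpace E Q] [IsManifold 𝓘(ℝ, E) ∞ Q]
  {H : Cotangent E Q → ℝ}

/-- Hamilton's equations in coordinates. They hold in any chart around the point, not just its own,
by `isLocallyConst_canonicalSymplectic`. -/
theorem stdBilin_chartField (hH : ContMDiff (cotModel E) 𝓘(ℝ, ℝ) ∞ H)
    {x₀ : Cotangent E Q} {y : E × (E →L[ℝ] ℝ)} (hy : y ∈ (extChartAt (cotModel E) x₀).target) :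
    stdBilin E (chartField (hamiltonianVectorField H) x₀ y) =
      fderiv ℝ (fun y => H ((extChartAt (cotModel E) x₀).symm y)) y := by
  refine ContinuousLinearMap.ext fun w => ?_
  set e := extChartAt (cotModel E) x₀ with he
  set w' := mfderiv 𝓘(ℝ, E × (E →L[ℝ] ℝ)) (cotModel E) e.symm y w with hw'
  have h1 := canonicalSymplectic_hamiltonianVectorField H (e.symm y) w'
  rw [isLocallyConst_canonicalSymplectic x₀ _ (e.map_target hy)] at h1
  have h2 : mfderiv (cotModel E) 𝓘(ℝ, E × (E →L[ℝ] ℝ)) e (e.symm y) w' = w :=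
    mfderiv_extChartAt_apply_mfderiv_symm hy w
  have h3 : stdBilin E (chartField (hamiltonianVectorField H) x₀ y)
      (mfderiv (cotModel E) 𝓘(ℝ, E × (E →L[ℝ] ℝ)) e (e.symm y) w') =
      mfderiv (cotModel E) 𝓘(ℝ, ℝ) H (e.symm y) w' := h1
  rw [h2] at h3
  rw [h3, hw']
  have hs : MDifferentiableAt 𝓘(ℝ, E × (E →L[ℝ] ℝ)) (cotModel E) e.symm y := by
    have := mdifferentiableWithinAt_extChartAt_symm (I := cotModel E) hy
    rwa [ModelWithCorners.range_eq_univ, mdifferentiableWithinAt_univ] at this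
  have hHd : MDifferentiableAt (cotModel E) 𝓘(ℝ, ℝ) H (e.symm y) :=
    hH.mdifferentiable (by simp) _
  have h4 := mfderiv_comp y hHd hs
  rw [mfderiv_eq_fderiv] at h4
  exact (congrArg (fun A => A w) h4).symm

/-- Hamiltonian vector fields are symplectic. -/
theorem isSymplecticField_hamiltonianVectorField (hH : ContMDiff (cotModel E) 𝓘(ℝ, ℝ) ∞ H) :
    IsSymplecticField (hamiltonianVectorField H) (canonicalSymplectic (E := E) (Q := Q))
      (stdSymplectic E) (stdBilin E) := by
  have key : ∀ (x₀ : Cotangent E Q), ∀ y ∈ (extChartAt (cotModel E) x₀).target, _ :=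
    fun x₀ y hy => contDiffAt_and_infinitesimal_of_eq_fderiv (B := stdBilin E) (y := y)
      (f := chartField (hamiltonianVectorField H) x₀) bijective_stdBilin (fun u v => by simp)
      (contDiffAt_comp_extChartAt_symm hH hy) (by
        filter_upwards [(isOpen_extChartAt_target x₀).mem_nhds hy] with z hz
        exact stdBilin_chartField hH hz)
  exact ⟨fun x₀ y hy => (key x₀ y hy).1, isLocallyConst_canonicalSymplectic,
    stdSymplectic_eq_stdBilin, fun x₀ y hy => (key x₀ y hy).2⟩

end HamiltonianField

/-! ### The metric and its inverse in coordinates -/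

section MetricCoordinates

theorem isInvertible_of_pos {E : Type*} [NormedAddCommGroup E] [NormedSpace ℝ E]
    [FiniteDimensional ℝ E] {G : E →L[ℝ] E →L[ℝ] ℝ} (hG : ∀ v, v ≠ 0 → 0 < G v v) :
    G.IsInvertible := by
  have hinj : Function.Injective G.toLinearMap := by
    refine (injective_iff_map_eq_zero _).2 fun v hv => ?_
    by_contra hne
    have := hG v hne
    have h0 : G v = 0 := hv
    simp [h0] at this
  have hsurj : Function.Surjective G.toLinearMap := by
    refine (LinearMap.injective_iff_surjective_of_finrank_eq_finrank ?_).1 hinj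
    rw [← (LinearMap.toContinuousLinearMap (𝕜 := ℝ) (E := E) (F' := ℝ)).finrank_eq]
    exact (Subspace.dual_finrank_eq (K := ℝ) (V := E)).symm
  exact ⟨(LinearEquiv.ofBijective G.toLinearMap ⟨hinj, hsurj⟩).toContinuousLinearEquiv, rfl⟩

variable {E : Type*} [NormedAddCommGroup E] [NormedSpace ℝ E]
  {Q : Type*} [TopologicalSpace Q] [ChartedSpace E Q] [IsManifold 𝓘(ℝ, E) ∞ Q]

theorem bijective_frame {q₀ q : Q} (hq : q ∈ (extChartAt 𝓘(ℝ, E) q₀).source) :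
    Function.Bijective (frame (E := E) q₀ q) := by
  have hb : q ∈ (trivializationAt E (TangentSpace 𝓘(ℝ, E)) q₀).baseSet := by simpa using hq
  constructor
  · intro u v huv
    have := congrArg
      ((trivializationAt E (TangentSpace 𝓘(ℝ, E)) q₀).continuousLinearMapAt ℝ q) huv
    simpa [frame, Trivialization.continuousLinearMapAt_symmL _ hb] using this
  · exact fun w => ⟨(trivializationAt E (TangentSpace 𝓘(ℝ, E)) q₀).continuousLinearMapAt ℝ q w,
      Trivialization.symmL_continuousLinearMapAt _ hb w⟩

/-- The matrix of the metric in the chart around `q₀`. -/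
def coordMetric (g : Metric E Q) (q₀ : Q) (a : E) : E →L[ℝ] E →L[ℝ] ℝ :=
  ContinuousLinearMap.inCoordinates E (fun q : Q => TangentSpace 𝓘(ℝ, E) q) (E →L[ℝ] ℝ)
    (fun q : Q => TangentSpace 𝓘(ℝ, E) q →L[ℝ] ℝ) q₀ ((extChartAt 𝓘(ℝ, E) q₀).symm a) q₀
    ((extChartAt 𝓘(ℝ, E) q₀).symm a) (g.inner ((extChartAt 𝓘(ℝ, E) q₀).symm a))

theorem coordMetric_apply (g : Metric E Q) {q₀ : Q} {a : E}
    (ha : a ∈ (extChartAt 𝓘(ℝ, E) q₀).target) (u v : E) :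
    coordMetric g q₀ a u v = g.inner ((extChartAt 𝓘(ℝ, E) q₀).symm a)
      (frame q₀ _ u) (frame q₀ _ v) := by
  have hb : (extChartAt 𝓘(ℝ, E) q₀).symm a ∈ (trivializationAt (E →L[ℝ] ℝ)
      (fun q : Q => TangentSpace 𝓘(ℝ, E) q →L[ℝ] ℝ) q₀).baseSet := by
    have := (extChartAt 𝓘(ℝ, E) q₀).map_target ha
    simpa using this
  rw [coordMetric, ContinuousLinearMap.inCoordinates]
  simp only [ContinuousLinearMap.comp_apply]
  rw [Trivialization.continuousLinearMapAt_apply, Trivialization.coe_linearMapAt_of_mem _ hb]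
  simp [hom_trivializationAt_apply, ContinuousLinearMap.inCoordinates, frame]
  rfl

set_option synthInstance.maxHeartbeats 400000 in
set_option maxHeartbeats 1000000 in
theorem contDiffAt_coordMetric (g : Metric E Q) {q₀ : Q} {a : E}
    (ha : a ∈ (extChartAt 𝓘(ℝ, E) q₀).target) : ContDiffAt ℝ ∞ (coordMetric g q₀) a := by
  have hs := (extChartAt 𝓘(ℝ, E) q₀).map_target ha
  have h1 := g.contMDiff ((extChartAt 𝓘(ℝ, E) q₀).symm a)
  have h2 := ((trivializationAt (E →L[ℝ] E →L[ℝ] ℝ)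
    (fun q : Q => TangentSpace 𝓘(ℝ, E) q →L[ℝ] TangentSpace 𝓘(ℝ, E) q →L[ℝ] ℝ) q₀).contMDiffAt_iff
      (IB := 𝓘(ℝ, E)) (n := ∞) (by simpa [Trivialization.mem_source] using hs)).1 h1
  have h3 := (contMDiffOn_extChartAt_symm (I := 𝓘(ℝ, E)) (n := ∞) q₀).contMDiffAt
    ((isOpen_extChartAt_target q₀).mem_nhds ha)
  have h4 := (h2.2.comp a h3).contDiffAt
  refine h4.congr_of_eventuallyEq (Eventually.of_forall fun b => ?_)
  simp [hom_trivializationAt_apply, coordMetric]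

theorem coordMetric_symm (g : Metric E Q) {q₀ : Q} {a : E}
    (ha : a ∈ (extChartAt 𝓘(ℝ, E) q₀).target) (u v : E) :
    coordMetric g q₀ a u v = coordMetric g q₀ a v u := by
  rw [coordMetric_apply g ha, coordMetric_apply g ha, g.symm]

theorem coordMetric_pos (g : Metric E Q) {q₀ : Q} {a : E}
    (ha : a ∈ (extChartAt 𝓘(ℝ, E) q₀).target) {u : E} (hu : u ≠ 0) :
    0 < coordMetric g q₀ a u u := by
  rw [coordMetric_apply g ha]
  refine g.pos _ _ fun h => hu ?_
  exact (bijective_frame ((extChartAt 𝓘(ℝ, E) q₀).map_target ha)).1 (h.trans (map_zero _).symm)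

variable [FiniteDimensional ℝ E]

/-- The raising of indices in the chart around `q₀`. -/
def coordSharp (g : Metric E Q) (q₀ : Q) (a : E) : (E →L[ℝ] ℝ) →L[ℝ] E :=
  (coordMetric g q₀ a).inverse

theorem isInvertible_coordMetric (g : Metric E Q) {q₀ : Q} {a : E}
    (ha : a ∈ (extChartAt 𝓘(ℝ, E) q₀).target) : (coordMetric g q₀ a).IsInvertible :=
  isInvertible_of_pos fun _ => coordMetric_pos g ha

/-- Inversion of operators is smooth at invertible ones, and positive definiteness makes the metric
invertible. -/
theorem contDiffAt_coordSharp (g : Metric E Q) {q₀ : Q} {a : E}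
    (ha : a ∈ (extChartAt 𝓘(ℝ, E) q₀).target) : ContDiffAt ℝ ∞ (coordSharp g q₀) a := by
  have := FiniteDimensional.complete ℝ E
  obtain ⟨A, hA⟩ := isInvertible_coordMetric g ha
  have h := contDiffAt_map_inverse (𝕜 := ℝ) (n := ∞) A
  rw [hA] at h
  exact h.comp a (contDiffAt_coordMetric g ha)

theorem coordMetric_coordSharp (g : Metric E Q) {q₀ : Q} {a : E}
    (ha : a ∈ (extChartAt 𝓘(ℝ, E) q₀).target) (ξ : E →L[ℝ] ℝ) :
    coordMetric g q₀ a (coordSharp g q₀ a ξ) = ξ := by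
  obtain ⟨A, hA⟩ := isInvertible_coordMetric g ha
  rw [coordSharp, ← hA, ContinuousLinearMap.inverse_equiv]
  exact A.apply_symm_apply ξ

theorem coordSharp_symm (g : Metric E Q) {q₀ : Q} {a : E}
    (ha : a ∈ (extChartAt 𝓘(ℝ, E) q₀).target) (ξ η : E →L[ℝ] ℝ) :
    ξ (coordSharp g q₀ a η) = η (coordSharp g q₀ a ξ) := by
  conv_lhs => rw [← coordMetric_coordSharp g ha ξ]
  conv_rhs => rw [← coordMetric_coordSharp g ha η]
  exact coordMetric_symm g ha _ _

theorem coordSharp_pos (g : Metric E Q) {q₀ : Q} {a : E}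
    (ha : a ∈ (extChartAt 𝓘(ℝ, E) q₀).target) {ξ : E →L[ℝ] ℝ} (hξ : ξ ≠ 0) :
    0 < ξ (coordSharp g q₀ a ξ) := by
  have h := coordMetric_coordSharp g ha ξ
  have hne : coordSharp g q₀ a ξ ≠ 0 := fun h0 => hξ (by rw [← h, h0, map_zero])
  have := coordMetric_pos g ha hne
  rwa [h] at this

/-- The coordinate expression of `sharp`. -/
theorem sharp_eq_frame (g : Metric E Q) {q₀ q : Q} (hq : q ∈ (extChartAt 𝓘(ℝ, E) q₀).source)
    (p : TangentSpace 𝓘(ℝ, E) q →L[ℝ] ℝ) :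
    sharp g q p = frame q₀ q (coordSharp g q₀ (extChartAt 𝓘(ℝ, E) q₀ q) (p ∘L frame q₀ q)) := by
  have ha := (extChartAt 𝓘(ℝ, E) q₀).map_source hq
  have hl := (extChartAt 𝓘(ℝ, E) q₀).left_inv hq
  set u := coordSharp g q₀ (extChartAt 𝓘(ℝ, E) q₀ q) (p ∘L frame q₀ q) with hu
  have h1 : g.inner q (frame q₀ q u) = p := by
    refine ContinuousLinearMap.ext fun w => ?_
    obtain ⟨v, rfl⟩ := (bijective_frame hq).2 w
    have h2 := coordMetric_apply g ha u v
    rw [hu, coordMetric_coordSharp g ha, ← hu, hl] at h2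
    exact h2.symm
  have hinv : (g.inner q).IsInvertible := isInvertible_of_pos (E := E) (g.pos q)
  obtain ⟨A, hA⟩ := hinv
  rw [sharp, ← h1, ← hA, ContinuousLinearMap.inverse_equiv]
  exact A.symm_apply_apply _

end MetricCoordinates

/-! ### Raising indices, and the reflection law -/

section Sharp

variable {E : Type*} [NormedAddCommGroup E] [NormedSpace ℝ E] [FiniteDimensional ℝ E]
  {Q : Type*} [TopologicalSpace Q] [ChartedSpace E Q] [IsManifold 𝓘(ℝ, E) ∞ Q]

theorem inner_sharp (g : Metric E Q) (q : Q) (p : TangentSpace 𝓘(ℝ, E) q →L[ℝ] ℝ) :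
    g.inner q (sharp g q p) = p := by
  have hinv : (g.inner q).IsInvertible := isInvertible_of_pos (E := E) (g.pos q)
  obtain ⟨A, hA⟩ := hinv
  rw [sharp, ← hA, ContinuousLinearMap.inverse_equiv]
  exact A.apply_symm_apply _

theorem apply_sharp_comm (g : Metric E Q) (q : Q) (p p' : TangentSpace 𝓘(ℝ, E) q →L[ℝ] ℝ) :
    p (sharp g q p') = p' (sharp g q p) := by
  conv_lhs => rw [← inner_sharp g q p]
  conv_rhs => rw [← inner_sharp g q p']
  exact g.symm q _ _

theorem apply_sharp_pos (g : Metric E Q) {q : Q} {p : TangentSpace 𝓘(ℝ, E) q →L[ℝ] ℝ}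
    (hp : p ≠ 0) : 0 < p (sharp g q p) := by
  have h := inner_sharp g q p
  have hne : sharp g q p ≠ 0 := fun h0 => hp (by rw [← h, h0, map_zero])
  have := g.pos q _ hne
  rwa [h] at this

theorem hamiltonian_eq (g : Metric E Q) (V : Q → ℝ) (x : Cotangent E Q) :
    hamiltonian g V x = x.2 (sharp g x.proj x.2) / 2 + V x.proj := by
  rw [hamiltonian, lagrangian, inner_sharp]
  ring

/-- The corner conditions determine the impact map: it is the reflection along `dh`. -/
theorem IsWeierstrassErdmann.apply_eq {g : Metric E Q} {V h : Q → ℝ}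
    {Δ : impactSurface g h → Cotangent E Q} (hΔ : IsWeierstrassErdmann g V h Δ)
    (x : impactSurface g h) :
    Δ x = ⟨x.1.proj, x.1.2 - (2 * x.1.2 (gradient g h x.1.proj) /
      differential h x.1.proj (gradient g h x.1.proj)) • differential h x.1.proj⟩ := by
  obtain ⟨ε, hε⟩ := hΔ.momentum x
  -- A vanishing `dh` would give `p(∇h) = 0`, but `p(∇h) < 0` on the impact surface.
  have hne : (differential h x.1.proj : TangentSpace 𝓘(ℝ, E) x.1.proj →L[ℝ] ℝ) ≠ 0 := by
    intro h0
    have := x.2.2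
    rw [gradient, h0] at this
    simp [sharp] at this
  have hpos : 0 < differential h x.1.proj (gradient g h x.1.proj) := apply_sharp_pos g hne
  have hen := hΔ.energy x
  rw [hε, hamiltonian_eq, hamiltonian_eq] at hen
  have hadd : sharp g x.1.proj (x.1.2 + ε • differential h x.1.proj) =
      sharp g x.1.proj x.1.2 + ε • gradient g h x.1.proj := by
    simp [sharp, gradient]
  have hcomm : differential h x.1.proj (sharp g x.1.proj x.1.2) =
      x.1.2 (gradient g h x.1.proj) := apply_sharp_comm g _ _ _
  have hε0 : ε ≠ 0 := by
    rintro rfl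
    refine hΔ.disjoint x ?_
    have h0 : Δ x = x.1 := hε.trans (congrArg (TotalSpace.mk x.1.proj)
      (ContinuousLinearMap.ext fun v => by simp))
    rw [h0]
    exact x.2
  simp only [hadd, add_apply, smul_apply, map_add, map_smul, smul_eq_mul, hcomm] at hen
  -- The energy balance is quadratic in `ε` without constant term. The root `ε = 0` would fix a
  -- point of `S^*`, against `disjoint`; the other root is the reflection.
  have h2 : ε * (2 * x.1.2 (gradient g h x.1.proj) +
      ε * differential h x.1.proj (gradient g h x.1.proj)) = 0 := by linarith
  have h3 := (mul_eq_zero.1 h2).resolve_left hε0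
  have h4 : ε = -(2 * x.1.2 (gradient g h x.1.proj) /
      differential h x.1.proj (gradient g h x.1.proj)) := by
    field_simp
    linarith
  rw [hε, h4]
  refine congrArg (TotalSpace.mk x.1.proj) (ContinuousLinearMap.ext fun v => ?_)
  simp [sub_eq_add_neg]

end Sharp

/-! ### The mechanical data in coordinates -/

section Coordinates

variable {E : Type*} [NormedAddCommGroup E] [NormedSpace ℝ E]
  {Q : Type*} [TopologicalSpace Q] [ChartedSpace E Q] [IsManifold 𝓘(ℝ, E) ∞ Q]

/-- The differential of `h` in the chart around `q₀`. -/
def coordDifferential (h : Q → ℝ) (q₀ : Q) (a : E) : E →L[ℝ] ℝ :=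
  fderiv ℝ (fun a => h ((extChartAt 𝓘(ℝ, E) q₀).symm a)) a

theorem contDiffAt_comp_symm {h : Q → ℝ} (hh : ContMDiff 𝓘(ℝ, E) 𝓘(ℝ, ℝ) ∞ h) {q₀ : Q} {a : E}
    (ha : a ∈ (extChartAt 𝓘(ℝ, E) q₀).target) :
    ContDiffAt ℝ ∞ (fun a => h ((extChartAt 𝓘(ℝ, E) q₀).symm a)) a := by
  have h1 := (contMDiffOn_extChartAt_symm (I := 𝓘(ℝ, E)) (n := ∞) q₀).contMDiffAt
    ((isOpen_extChartAt_target q₀).mem_nhds ha)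
  exact (hh.contMDiffAt.comp a h1).contDiffAt

theorem contDiffAt_coordDifferential {h : Q → ℝ} (hh : ContMDiff 𝓘(ℝ, E) 𝓘(ℝ, ℝ) ∞ h) {q₀ : Q}
    {a : E} (ha : a ∈ (extChartAt 𝓘(ℝ, E) q₀).target) :
    ContDiffAt ℝ ∞ (coordDifferential h q₀) a :=
  (contDiffAt_comp_symm hh ha).fderiv_right (by simp)

theorem differential_comp_frame {h : Q → ℝ} (hh : ContMDiff 𝓘(ℝ, E) 𝓘(ℝ, ℝ) ∞ h) {q₀ q : Q}
    (hq : q ∈ (extChartAt 𝓘(ℝ, E) q₀).source) :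
    (differential h q : TangentSpace 𝓘(ℝ, E) q →L[ℝ] ℝ) ∘L frame q₀ q =
      coordDifferential h q₀ (extChartAt 𝓘(ℝ, E) q₀ q) := by
  set c := extChartAt 𝓘(ℝ, E) q₀ with hc
  have ha := c.map_source hq
  have hs : MDifferentiableAt 𝓘(ℝ, E) 𝓘(ℝ, E) c.symm (c q) := by
    have := mdifferentiableWithinAt_extChartAt_symm (I := 𝓘(ℝ, E)) ha
    rwa [ModelWithCorners.range_eq_univ, mdifferentiableWithinAt_univ] at this
  have h1 := mfderiv_comp (c q) (hh.mdifferentiable (by simp) (c.symm (c q))) hs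
  rw [mfderiv_eq_fderiv, c.left_inv hq] at h1
  rw [frame_eq_mfderiv hq]
  exact h1.symm

variable [FiniteDimensional ℝ E]

/-- `p(∇h)` in the chart around `q₀`. -/
def coordRate (g : Metric E Q) (h : Q → ℝ) (q₀ : Q) (y : E × (E →L[ℝ] ℝ)) : ℝ :=
  y.2 (coordSharp g q₀ y.1 (coordDifferential h q₀ y.1))

/-- The reflection along `dh` in the chart around `q₀`. -/
def coordReset (g : Metric E Q) (h : Q → ℝ) (q₀ : Q) (y : E × (E →L[ℝ] ℝ)) : E × (E →L[ℝ] ℝ) :=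
  (y.1, y.2 - (2 * coordRate g h q₀ y / coordDifferential h q₀ y.1
    (coordSharp g q₀ y.1 (coordDifferential h q₀ y.1))) • coordDifferential h q₀ y.1)

/-- The Hamiltonian in the chart around `q₀`. -/
def coordHamiltonian (g : Metric E Q) (V : Q → ℝ) (q₀ : Q) (y : E × (E →L[ℝ] ℝ)) : ℝ :=
  y.2 (coordSharp g q₀ y.1 y.2) / 2 + V ((extChartAt 𝓘(ℝ, E) q₀).symm y.1)

theorem apply_sharp_eq (g : Metric E Q) {q₀ q : Q} (hq : q ∈ (extChartAt 𝓘(ℝ, E) q₀).source)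
    (p p' : TangentSpace 𝓘(ℝ, E) q →L[ℝ] ℝ) :
    p (sharp g q p') = (p ∘L frame q₀ q)
      (coordSharp g q₀ (extChartAt 𝓘(ℝ, E) q₀ q) (p' ∘L frame q₀ q)) := by
  rw [sharp_eq_frame g hq]
  rfl

theorem hamiltonian_eq_coordHamiltonian (g : Metric E Q) (V : Q → ℝ) {x₀ x : Cotangent E Q}
    (hx : x ∈ (extChartAt (cotModel E) x₀).source) :
    hamiltonian g V x = coordHamiltonian g V x₀.proj (extChartAt (cotModel E) x₀ x) := by
  have hq := mem_cotangent_source.1 hx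
  rw [hamiltonian_eq, apply_sharp_eq g hq, extChartAt_cotangent_apply, coordHamiltonian,
    PartialEquiv.left_inv _ hq]

theorem apply_gradient_eq_coordRate (g : Metric E Q) {h : Q → ℝ}
    (hh : ContMDiff 𝓘(ℝ, E) 𝓘(ℝ, ℝ) ∞ h) {x₀ x : Cotangent E Q}
    (hx : x ∈ (extChartAt (cotModel E) x₀).source) :
    x.2 (gradient g h x.proj) = coordRate g h x₀.proj (extChartAt (cotModel E) x₀ x) := by
  have hq := mem_cotangent_source.1 hx
  rw [gradient, apply_sharp_eq g hq, differential_comp_frame hh hq, extChartAt_cotangent_apply,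
    coordRate]

theorem contDiffAt_coordSharp_apply (g : Metric E Q) {q₀ : Q} {y : E × (E →L[ℝ] ℝ)}
    (hy : y.1 ∈ (extChartAt 𝓘(ℝ, E) q₀).target) {ξ η : E × (E →L[ℝ] ℝ) → E →L[ℝ] ℝ}
    (hξ : ContDiffAt ℝ ∞ ξ y) (hη : ContDiffAt ℝ ∞ η y) :
    ContDiffAt ℝ ∞ (fun y => ξ y (coordSharp g q₀ y.1 (η y))) y :=
  hξ.clm_apply (((contDiffAt_coordSharp g hy).comp y contDiffAt_fst).clm_apply hη)

theorem contDiffAt_coordHamiltonian (g : Metric E Q) {V : Q → ℝ}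
    (hV : ContMDiff 𝓘(ℝ, E) 𝓘(ℝ, ℝ) ∞ V) {q₀ : Q} {y : E × (E →L[ℝ] ℝ)}
    (hy : y.1 ∈ (extChartAt 𝓘(ℝ, E) q₀).target) :
    ContDiffAt ℝ ∞ (coordHamiltonian g V q₀) y :=
  ((contDiffAt_coordSharp_apply g hy contDiffAt_snd contDiffAt_snd).div_const 2).add
    ((contDiffAt_comp_symm hV hy).comp y contDiffAt_fst)

theorem contDiffAt_coordRate (g : Metric E Q) {h : Q → ℝ}
    (hh : ContMDiff 𝓘(ℝ, E) 𝓘(ℝ, ℝ) ∞ h) {q₀ : Q} {y : E × (E →L[ℝ] ℝ)}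
    (hy : y.1 ∈ (extChartAt 𝓘(ℝ, E) q₀).target) :
    ContDiffAt ℝ ∞ (coordRate g h q₀) y :=
  contDiffAt_coordSharp_apply g hy contDiffAt_snd
    ((contDiffAt_coordDifferential hh hy).comp y contDiffAt_fst)

theorem contMDiff_hamiltonian (g : Metric E Q) {V : Q → ℝ}
    (hV : ContMDiff 𝓘(ℝ, E) 𝓘(ℝ, ℝ) ∞ V) :
    ContMDiff (cotModel E) 𝓘(ℝ, ℝ) ∞ (hamiltonian g V) := by
  intro x
  have hy := (extChartAt (cotModel E) x).map_source (mem_extChartAt_source (I := cotModel E) x)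
  have h1 := (contDiffAt_coordHamiltonian g hV (mem_cotangent_target.1 hy)).contMDiffAt
  refine (h1.comp x (contMDiffAt_extChartAt (I := cotModel E) (n := ∞))).congr_of_eventuallyEq ?_
  filter_upwards [extChartAt_source_mem_nhds (I := cotModel E) x] with z hz
  exact hamiltonian_eq_coordHamiltonian g V hz

theorem continuous_apply_gradient (g : Metric E Q) {h : Q → ℝ}
    (hh : ContMDiff 𝓘(ℝ, E) 𝓘(ℝ, ℝ) ∞ h) :
    Continuous (fun x : Cotangent E Q => x.2 (gradient g h x.proj)) := by
  refine continuous_iff_continuousAt.2 fun x => ?_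
  have hy := (extChartAt (cotModel E) x).map_source (mem_extChartAt_source (I := cotModel E) x)
  have h1 := (contDiffAt_coordRate g hh (mem_cotangent_target.1 hy)).continuousAt
  refine (h1.comp (continuousAt_extChartAt (I := cotModel E) x)).congr ?_
  filter_upwards [extChartAt_source_mem_nhds (I := cotModel E) x] with z hz
  exact (apply_gradient_eq_coordRate g hh hz).symm

/-- Only this inclusion is needed: a point with `h ≠ 0` or `p(∇h) > 0` is then off the closure. -/
theorem closure_impactSurface_subset (g : Metric E Q) {h : Q → ℝ}
    (hh : ContMDiff 𝓘(ℝ, E) 𝓘(ℝ, ℝ) ∞ h) :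
    closure (impactSurface g h) ⊆ {x | h x.proj = 0 ∧ x.2 (gradient g h x.proj) ≤ 0} := by
  refine closure_minimal (fun x hx => ⟨hx.1, hx.2.le⟩) ?_
  refine (isClosed_eq (hh.continuous.comp (FiberBundle.continuous_proj _ _))
    continuous_const).inter (isClosed_le (continuous_apply_gradient g hh) continuous_const)

end Coordinates

/-! ### The reset map in coordinates -/

section Reflection

variable {E : Type*} [NormedAddCommGroup E] [NormedSpace ℝ E]

/-- Translating the momentum by `m • dh` preserves `dq ∧ dp` on the tangent space of the levels of
`h`. -/
theorem stdBilin_fderiv_translation {k : E → ℝ} {m : E × (E →L[ℝ] ℝ) → ℝ} {y : E × (E →L[ℝ] ℝ)}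
    (hk : ContDiffAt ℝ ∞ k y.1) (hm : DifferentiableAt ℝ m y)
    {A : (E × (E →L[ℝ] ℝ)) →L[ℝ] (E × (E →L[ℝ] ℝ))}
    (hA : HasFDerivAt (fun y => (y.1, y.2 + m y • fderiv ℝ k y.1)) A y)
    {u v : E × (E →L[ℝ] ℝ)} (hu : fderiv ℝ k y.1 u.1 = 0) (hv : fderiv ℝ k y.1 v.1 = 0) :
    stdBilin E (A u) (A v) = stdBilin E u v := by
  have h1 : HasFDerivAt (fderiv ℝ k) (fderiv ℝ (fderiv ℝ k) y.1) y.1 :=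
    (((contDiffAt_infty.1 hk 2).fderiv_right (m := 1) (by norm_num)).differentiableAt
      (by simp)).hasFDerivAt
  have h2 := h1.comp y hasFDerivAt_fst
  have h3 := (hasFDerivAt_fst (𝕜 := ℝ) (p := y)).prodMk
    ((hasFDerivAt_snd (𝕜 := ℝ) (p := y)).add (hm.hasFDerivAt.smul h2))
  have hAe := hA.unique h3
  -- The derivative of `m` enters only multiplied by `dk`, which kills `u.1` and `v.1`; the term
  -- with `m` itself is the antisymmetrized second derivative of `k`.
  have hsymm : fderiv ℝ (fderiv ℝ k) y.1 u.1 v.1 = fderiv ℝ (fderiv ℝ k) y.1 v.1 u.1 :=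
    ((contDiffAt_infty.1 hk 2).isSymmSndFDerivAt (by simp)) _ _
  rw [hAe]
  simp [hu, hv, hsymm]

variable {Q : Type*} [TopologicalSpace Q] [ChartedSpace E Q] [IsManifold 𝓘(ℝ, E) ∞ Q]

theorem coordReset_eq (g : Metric E Q) (h : Q → ℝ) (q₀ : Q) :
    coordReset g h q₀ = fun y => (y.1, y.2 + (-(2 * coordRate g h q₀ y /
      coordDifferential h q₀ y.1 (coordSharp g q₀ y.1 (coordDifferential h q₀ y.1)))) •
        coordDifferential h q₀ y.1) := by
  funext y
  refine Prod.ext rfl (ContinuousLinearMap.ext fun v => ?_)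
  simp [coordReset, sub_eq_add_neg]

variable [FiniteDimensional ℝ E]

theorem contDiffAt_coordMultiplier (g : Metric E Q) {h : Q → ℝ}
    (hh : ContMDiff 𝓘(ℝ, E) 𝓘(ℝ, ℝ) ∞ h) {q₀ : Q} {y : E × (E →L[ℝ] ℝ)}
    (hy : y.1 ∈ (extChartAt 𝓘(ℝ, E) q₀).target) (hd : coordDifferential h q₀ y.1 ≠ 0) :
    ContDiffAt ℝ ∞ (fun y => -(2 * coordRate g h q₀ y / coordDifferential h q₀ y.1
      (coordSharp g q₀ y.1 (coordDifferential h q₀ y.1)))) y := by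
  have h1 := (contDiffAt_coordDifferential hh hy).comp y contDiffAt_fst
  exact ((contDiffAt_const.mul (contDiffAt_coordRate g hh hy)).div
    (contDiffAt_coordSharp_apply g hy h1 h1) (coordSharp_pos g hy hd).ne').neg

theorem contDiffAt_coordReset (g : Metric E Q) {h : Q → ℝ}
    (hh : ContMDiff 𝓘(ℝ, E) 𝓘(ℝ, ℝ) ∞ h) {q₀ : Q} {y : E × (E →L[ℝ] ℝ)}
    (hy : y.1 ∈ (extChartAt 𝓘(ℝ, E) q₀).target) (hd : coordDifferential h q₀ y.1 ≠ 0) :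
    ContDiffAt ℝ ∞ (coordReset g h q₀) y := by
  rw [coordReset_eq]
  exact contDiffAt_fst.prodMk (contDiffAt_snd.add ((contDiffAt_coordMultiplier g hh hy hd).smul
    ((contDiffAt_coordDifferential hh hy).comp y contDiffAt_fst)))

theorem stdBilin_fderiv_coordReset (g : Metric E Q) {h : Q → ℝ}
    (hh : ContMDiff 𝓘(ℝ, E) 𝓘(ℝ, ℝ) ∞ h) {q₀ : Q} {y : E × (E →L[ℝ] ℝ)}
    (hy : y.1 ∈ (extChartAt 𝓘(ℝ, E) q₀).target) (hd : coordDifferential h q₀ y.1 ≠ 0)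
    {u v : E × (E →L[ℝ] ℝ)} (hu : coordDifferential h q₀ y.1 u.1 = 0)
    (hv : coordDifferential h q₀ y.1 v.1 = 0) :
    stdBilin E (fderiv ℝ (coordReset g h q₀) y u) (fderiv ℝ (coordReset g h q₀) y v) =
      stdBilin E u v := by
  have hA := ((contDiffAt_coordReset g hh hy hd).differentiableAt (by simp)).hasFDerivAt
  rw [coordReset_eq] at hA ⊢
  exact stdBilin_fderiv_translation (contDiffAt_comp_symm hh hy)
    ((contDiffAt_coordMultiplier g hh hy hd).differentiableAt (by simp)) hA hu hv

/-- The subtracted multiple of `dh` pairs with the gradient to twice the rate. The change of sign is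
what makes outgoing trajectories avoid `closure S^*`. -/
theorem coordRate_coordReset (g : Metric E Q) (h : Q → ℝ) {q₀ : Q} {y : E × (E →L[ℝ] ℝ)}
    (hy : y.1 ∈ (extChartAt 𝓘(ℝ, E) q₀).target) (hd : coordDifferential h q₀ y.1 ≠ 0) :
    coordRate g h q₀ (coordReset g h q₀ y) = -coordRate g h q₀ y := by
  have hpos := coordSharp_pos g hy hd
  have h1 : coordRate g h q₀ (coordReset g h q₀ y) = coordRate g h q₀ y -
      2 * coordRate g h q₀ y / coordDifferential h q₀ y.1
        (coordSharp g q₀ y.1 (coordDifferential h q₀ y.1)) * coordDifferential h q₀ y.1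
        (coordSharp g q₀ y.1 (coordDifferential h q₀ y.1)) := rfl
  rw [h1, div_mul_cancel₀ _ hpos.ne']
  ring

/-- This holds wherever `dh ≠ 0`, also off `h = 0`, so it may be differentiated in all directions.
-/
theorem coordHamiltonian_coordReset (g : Metric E Q) (V h : Q → ℝ) {q₀ : Q}
    {y : E × (E →L[ℝ] ℝ)} (hy : y.1 ∈ (extChartAt 𝓘(ℝ, E) q₀).target)
    (hd : coordDifferential h q₀ y.1 ≠ 0) :
    coordHamiltonian g V q₀ (coordReset g h q₀ y) = coordHamiltonian g V q₀ y := by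
  have hpos := coordSharp_pos g hy hd
  have hs : coordDifferential h q₀ y.1 (coordSharp g q₀ y.1 y.2) = coordRate g h q₀ y :=
    coordSharp_symm g hy _ _
  simp only [coordHamiltonian, coordReset, map_sub, map_smul, sub_apply, smul_apply, smul_eq_mul,
    hs]
  have hr : y.2 (coordSharp g q₀ y.1 (coordDifferential h q₀ y.1)) = coordRate g h q₀ y := rfl
  rw [hr]
  field_simp
  ring

/-- The reset preserves the derivative of the energy. -/
theorem fderiv_coordHamiltonian_coordReset (g : Metric E Q) {V h : Q → ℝ}
    (hV : ContMDiff 𝓘(ℝ, E) 𝓘(ℝ, ℝ) ∞ V) (hh : ContMDiff 𝓘(ℝ, E) 𝓘(ℝ, ℝ) ∞ h) {q₀ : Q}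
    {y : E × (E →L[ℝ] ℝ)} (hy : y.1 ∈ (extChartAt 𝓘(ℝ, E) q₀).target)
    (hd : coordDifferential h q₀ y.1 ≠ 0) (u : E × (E →L[ℝ] ℝ)) :
    fderiv ℝ (coordHamiltonian g V q₀) (coordReset g h q₀ y) (fderiv ℝ (coordReset g h q₀) y u) =
      fderiv ℝ (coordHamiltonian g V q₀) y u := by
  have hR := ((contDiffAt_coordReset g hh hy hd).differentiableAt (by simp)).hasFDerivAt
  have hF : HasFDerivAt (coordHamiltonian g V q₀) _ (coordReset g h q₀ y) :=
    ((contDiffAt_coordHamiltonian g hV (y := coordReset g h q₀ y) hy).differentiableAt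
      (by simp)).hasFDerivAt
  have hc := hF.comp y hR
  have hev : coordHamiltonian g V q₀ ∘ coordReset g h q₀ =ᶠ[𝓝 y] coordHamiltonian g V q₀ := by
    have h1 : ∀ᶠ z : E × (E →L[ℝ] ℝ) in 𝓝 y, z.1 ∈ (extChartAt 𝓘(ℝ, E) q₀).target :=
      continuousAt_fst.eventually ((isOpen_extChartAt_target q₀).mem_nhds hy)
    have h2 : ∀ᶠ z : E × (E →L[ℝ] ℝ) in 𝓝 y, coordDifferential h q₀ z.1 ≠ 0 :=
      (((contDiffAt_coordDifferential hh hy).continuousAt).comp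
        (f := Prod.fst) continuousAt_fst).eventually_ne hd
    filter_upwards [h1, h2] with z hz1 hz2 using coordHamiltonian_coordReset g V h hz1 hz2
  have := (hc.congr_of_eventuallyEq hev.symm).fderiv
  rw [this]
  rfl

theorem coordHamiltonian_eventuallyEq (g : Metric E Q) (V : Q → ℝ) {x₀ : Cotangent E Q}
    {y : E × (E →L[ℝ] ℝ)} (hy : y ∈ (extChartAt (cotModel E) x₀).target) :
    (fun y => hamiltonian g V ((extChartAt (cotModel E) x₀).symm y)) =ᶠ[𝓝 y]
      coordHamiltonian g V x₀.proj := by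
  filter_upwards [(isOpen_extChartAt_target x₀).mem_nhds hy] with z hz
  rw [hamiltonian_eq_coordHamiltonian g V ((extChartAt (cotModel E) x₀).map_target hz),
    PartialEquiv.right_inv _ hz]

theorem stdBilin_chartField_hamiltonian (g : Metric E Q) {V : Q → ℝ}
    (hV : ContMDiff 𝓘(ℝ, E) 𝓘(ℝ, ℝ) ∞ V) {x₀ : Cotangent E Q} {y : E × (E →L[ℝ] ℝ)}
    (hy : y ∈ (extChartAt (cotModel E) x₀).target) :
    stdBilin E (chartField (hamiltonianVectorField (hamiltonian g V)) x₀ y) =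
      fderiv ℝ (coordHamiltonian g V x₀.proj) y := by
  rw [stdBilin_chartField (contMDiff_hamiltonian g hV) hy,
    (coordHamiltonian_eventuallyEq g V hy).fderiv_eq]

/-- The velocity in the chart: `q̇ = p^♯`. -/
theorem chartField_fst (g : Metric E Q) {V : Q → ℝ}
    (hV : ContMDiff 𝓘(ℝ, E) 𝓘(ℝ, ℝ) ∞ V) {x₀ : Cotangent E Q} {y : E × (E →L[ℝ] ℝ)}
    (hy : y ∈ (extChartAt (cotModel E) x₀).target) :
    (chartField (hamiltonianVectorField (hamiltonian g V)) x₀ y).1 =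
      coordSharp g x₀.proj y.1 y.2 := by
  have hy1 := mem_cotangent_target.1 hy
  rw [← sub_eq_zero]
  refine (Module.forall_dual_apply_eq_zero_iff ℝ _).1 fun η => ?_
  obtain ⟨η, rfl⟩ := (LinearMap.toContinuousLinearMap (𝕜 := ℝ) (E := E) (F' := ℝ)).symm.surjective η
  -- Pairing with the vertical vector `(0, η)` extracts `η` of the velocity; the other side is the
  -- derivative of the Hamiltonian along the fibre, a quadratic polynomial in `t`.
  have h1 := DFunLike.congr_fun (stdBilin_chartField_hamiltonian g hV hy) (0, η)
  have h2 := ((contDiffAt_coordHamiltonian g hV hy1).differentiableAt (by simp)).hasFDerivAt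
  have h3 : HasDerivAt (fun t : ℝ => y + t • ((0, η) : E × (E →L[ℝ] ℝ))) (0, η) 0 := by
    simpa using ((hasDerivAt_id (0 : ℝ)).smul_const ((0, η) : E × (E →L[ℝ] ℝ))).const_add y
  have h4 : HasFDerivAt (coordHamiltonian g V x₀.proj)
      (fderiv ℝ (coordHamiltonian g V x₀.proj) y)
      ((fun t : ℝ => y + t • ((0, η) : E × (E →L[ℝ] ℝ))) 0) := by simpa using h2
  have h5 := h4.comp_hasDerivAt 0 h3
  set G := coordSharp g x₀.proj y.1 with hG
  have hcomm : y.2 (G η) = η (G y.2) := coordSharp_symm g hy1 _ _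
  have h6 : coordHamiltonian g V x₀.proj ∘ (fun t : ℝ => y + t • ((0, η) : E × (E →L[ℝ] ℝ))) =
      fun t => (y.2 (G y.2) + 2 * t * η (G y.2) + t ^ 2 * η (G η)) / 2 +
        V ((extChartAt 𝓘(ℝ, E) x₀.proj).symm y.1) := by
    funext t
    simp [coordHamiltonian, ← hG, hcomm]
    ring
  rw [h6] at h5
  have h7 : HasDerivAt (fun t : ℝ => (y.2 (G y.2) + 2 * t * η (G y.2) + t ^ 2 * η (G η)) / 2 +
        V ((extChartAt 𝓘(ℝ, E) x₀.proj).symm y.1)) (η (G y.2)) 0 := by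
    have a1 := ((hasDerivAt_id (0 : ℝ)).const_mul 2).mul_const (η (G y.2))
    have a2 := ((hasDerivAt_id (0 : ℝ)).pow 2).mul_const (η (G η))
    have := ((((a1.const_add (y.2 (G y.2))).add a2).div_const 2).add_const
      (V ((extChartAt 𝓘(ℝ, E) x₀.proj).symm y.1)))
    refine this.congr_deriv ?_
    simp
  rw [← h1] at h5
  have h8 := h5.unique h7
  simp at h8
  simp [h8]

end Reflection

/-! ### Hitting times and the linear algebra of an impact -/

section LocalImpact

open Metric

variable {W : Type*} [NormedAddCommGroup W] [NormedSpace ℝ W]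
  {f : W → W} {x₀ : W} {U : Set W} {r ε : ℝ} {Φ : W → ℝ → W}

theorem IsLocalFlow.apply_center (hΦ : IsLocalFlow f x₀ U r ε Φ) : Φ x₀ 0 = x₀ :=
  hΦ.init x₀ (mem_ball_self hΦ.r_pos)

/-- The time at which the trajectories of a flow hit a transverse hypersurface. -/
theorem IsLocalFlow.exists_hitting_time [CompleteSpace W] (hΦ : IsLocalFlow f x₀ U r ε Φ)
    {k : W → ℝ} {k' : W →L[ℝ] ℝ} (hk : HasStrictFDerivAt k k' x₀) (hk0 : k x₀ = 0)
    (hf : k' (f x₀) ≠ 0) :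
    ∃ (τ : W → ℝ) (τ' : W →L[ℝ] ℝ), HasFDerivAt τ τ' x₀ ∧ τ x₀ = 0 ∧
      (∀ v, k' (v + τ' v • f x₀) = 0) ∧ ∀ᶠ z in 𝓝 x₀, k (Φ z (τ z)) = 0 := by
  have hc := hΦ.apply_center
  have hk1 : HasStrictFDerivAt k k' ((fun p : W × ℝ => Φ p.1 p.2) (x₀, 0)) := by
    simpa only [hc] using hk
  have h1 := hk1.comp (x₀, (0 : ℝ)) hΦ.strict
  set A := ContinuousLinearMap.fst ℝ W ℝ + (ContinuousLinearMap.snd ℝ W ℝ).smulRight (f x₀)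
    with hA
  -- The partial derivative in time is `k' (f x₀)`, nonzero by transversality, so the implicit
  -- function theorem applies.
  have hinv : ((k' ∘L A) ∘L ContinuousLinearMap.inr ℝ W ℝ).IsInvertible := by
    refine ⟨ContinuousLinearEquiv.unitsEquivAut ℝ (Units.mk0 _ hf), ?_⟩
    ext
    simp [hA]
  set τ := h1.implicitFunctionOfProdDomain hinv with hτ
  have h2 := (h1.hasStrictFDerivAt_implicitFunctionOfProdDomain hinv).hasFDerivAt
  have h3 := h1.eventually_apply_implicitFunctionOfProdDomain hinv
  have h4 := h1.tendsto_implicitFunctionOfProdDomain hinv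
  rw [← hτ] at h2 h3 h4
  have h0 : τ x₀ = 0 := tendsto_nhds_unique h2.continuousAt.tendsto h4
  have h5 : ∀ᶠ z in 𝓝 x₀, k (Φ z (τ z)) = 0 := by
    simpa [hc, hk0] using h3
  refine ⟨τ, _, h2, h0, fun v => ?_, h5⟩
  have h6 : HasFDerivAt (fun p : W × ℝ => k (Φ p.1 p.2)) (k' ∘L A) (x₀, τ x₀) := by
    rw [h0]
    exact h1.hasFDerivAt
  -- Differentiating `k (Φ z (τ z)) = 0` shows that the corrected vectors are tangent to the
  -- surface.
  have h7 := h6.comp x₀ ((hasFDerivAt_id x₀).prodMk h2)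
  have h8 := h7.unique ((hasFDerivAt_const (0 : ℝ) x₀).congr_of_eventuallyEq h5)
  simpa [hA] using congrArg (fun L => L v) h8

/-- The derivative of the impact map at a fixed time, the trajectories being extended beyond the
impact and into the past. -/
theorem IsLocalFlow.hasFDerivAt_impact (hΦ : IsLocalFlow f x₀ U r ε Φ) {R : W → W}
    {R' : W →L[ℝ] W} (hR : HasFDerivAt R R' x₀) {U' : Set W} {r' ε' : ℝ} {Ψ : W → ℝ → W}
    (hΨ : IsLocalFlow f (R x₀) U' r' ε' Ψ) {τ : W → ℝ} {τ' : W →L[ℝ] ℝ}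
    (hτ : HasFDerivAt τ τ' x₀) (hτ0 : τ x₀ = 0) :
    HasFDerivAt (fun z => Ψ (R (Φ z (τ z))) (-τ z))
      (R' ∘L (ContinuousLinearMap.id ℝ W + τ'.smulRight (f x₀)) - τ'.smulRight (f (R x₀))) x₀ := by
  have hc := hΦ.apply_center
  have h1 : HasFDerivAt (fun p : W × ℝ => Φ p.1 p.2) (ContinuousLinearMap.fst ℝ W ℝ +
      (ContinuousLinearMap.snd ℝ W ℝ).smulRight (f x₀)) (x₀, τ x₀) := by
    rw [hτ0]
    exact hΦ.strict.hasFDerivAt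
  have h2 := h1.comp x₀ ((hasFDerivAt_id x₀).prodMk hτ)
  have h3 : HasFDerivAt R R' (Φ x₀ (τ x₀)) := by rwa [hτ0, hc]
  have h4 := h3.comp x₀ h2
  have h5 : HasFDerivAt (fun p : W × ℝ => Ψ p.1 p.2) (ContinuousLinearMap.fst ℝ W ℝ +
      (ContinuousLinearMap.snd ℝ W ℝ).smulRight (f (R x₀))) (R (Φ x₀ (τ x₀)), -τ x₀) := by
    rw [hτ0, hc, neg_zero]
    exact hΨ.strict.hasFDerivAt
  have h6 := h5.comp x₀ (h4.prodMk hτ.neg)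
  refine h6.congr_fderiv (ContinuousLinearMap.ext fun v => ?_)
  simp [sub_eq_add_neg]

/-- An impact that preserves the form along the impact surface and the derivative of the energy
is symplectic. -/
theorem bilin_impact_eq {B : W →L[ℝ] W →L[ℝ] ℝ} (hanti : ∀ u v, B u v = -B v u) {R' : W →L[ℝ] W}
    {k' τ' : W →L[ℝ] ℝ} {a b : W} (hR : ∀ u v, k' u = 0 → k' v = 0 → B (R' u) (R' v) = B u v)
    (hE : ∀ u, B b (R' u) = B a u) (hτ : ∀ v, k' (v + τ' v • a) = 0) (u v : W) :
    B ((R' ∘L (ContinuousLinearMap.id ℝ W + τ'.smulRight a) - τ'.smulRight b) u)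
      ((R' ∘L (ContinuousLinearMap.id ℝ W + τ'.smulRight a) - τ'.smulRight b) v) = B u v := by
  have haa : B a a = 0 := by linarith [hanti a a]
  have hbb : B b b = 0 := by linarith [hanti b b]
  have e : ∀ w, (R' ∘L (ContinuousLinearMap.id ℝ W + τ'.smulRight a) - τ'.smulRight b) w =
      R' (w + τ' w • a) - τ' w • b := fun w => by simp
  -- `h1` applies since the corrected vectors are tangent; `h2` and `h3` replace pairings with `b`
  -- by pairings with `a`, which cancel those created by the corrections.
  have h1 := hR _ _ (hτ u) (hτ v)
  have h2 := hE (u + τ' u • a)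
  have h3 := hE (v + τ' v • a)
  rw [e, e]
  simp only [map_sub, map_smul, sub_apply, smul_apply, smul_eq_mul, hbb, h1, h3,
    hanti (R' (u + τ' u • a)) b, h2]
  simp only [map_add, map_smul, add_apply, smul_apply, smul_eq_mul, haa, hanti u a]
  ring

/-- A function that decreases along the field decreases strictly along the flow. -/
theorem IsLocalFlow.strictAntiOn (hΦ : IsLocalFlow f x₀ U r ε Φ) {k : W → ℝ}
    (hk : ∀ y ∈ U, DifferentiableAt ℝ k y ∧ fderiv ℝ k y (f y) < 0) {z : W} (hz : z ∈ ball x₀ r) :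
    StrictAntiOn (fun s => k (Φ z s)) (Icc (-ε) ε) := by
  have hd : ∀ t ∈ Icc (-ε) ε, HasDerivWithinAt (fun s => k (Φ z s))
      (fderiv ℝ k (Φ z t) (f (Φ z t))) (Icc (-ε) ε) t := fun t ht =>
    (hk _ (hΦ.mem z hz t ht)).1.hasFDerivAt.comp_hasDerivWithinAt t (hΦ.deriv z hz t ht)
  refine strictAntiOn_of_deriv_neg (convex_Icc _ _)
    (fun t ht => (hd t ht).continuousWithinAt) fun t ht => ?_
  have ht' := interior_subset ht
  rw [((hd t ht').hasDerivAt (mem_interior_iff_mem_nhds.1 ht)).deriv]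
  exact (hk _ (hΦ.mem z hz t ht')).2

end LocalImpact

/-! ### Regularity of the impacts of a natural system -/

section ImpactSystem

open Metric

variable {E : Type*} [NormedAddCommGroup E] [NormedSpace ℝ E]
  {Q : Type*} [TopologicalSpace Q] [ChartedSpace E Q] [IsManifold 𝓘(ℝ, E) ∞ Q]
  {g : Metric E Q} {V h : Q → ℝ}

theorem proj_extChartAt_symm {x₀ : Cotangent E Q} {y : E × (E →L[ℝ] ℝ)}
    (hy : y ∈ (extChartAt (cotModel E) x₀).target) :
    ((extChartAt (cotModel E) x₀).symm y).proj = (extChartAt 𝓘(ℝ, E) x₀.proj).symm y.1 := by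
  have hs := (extChartAt (cotModel E) x₀).map_target hy
  have h1 := (extChartAt (cotModel E) x₀).right_inv hy
  rw [extChartAt_cotangent_apply] at h1
  rw [← congrArg Prod.fst h1]
  exact ((extChartAt 𝓘(ℝ, E) x₀.proj).left_inv (mem_cotangent_source.1 hs)).symm

theorem coordDifferential_ne_zero_of_coordRate {q₀ : Q} {y : E × (E →L[ℝ] ℝ)}
    (hy : coordRate g h q₀ y ≠ 0) : coordDifferential h q₀ y.1 ≠ 0 := by
  intro h0
  exact hy (by rw [coordRate, h0, map_zero, map_zero])

variable [FiniteDimensional ℝ E]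

theorem apply_gradient_extChartAt_symm (hh : ContMDiff 𝓘(ℝ, E) 𝓘(ℝ, ℝ) ∞ h) {x₀ : Cotangent E Q}
    {y : E × (E →L[ℝ] ℝ)} (hy : y ∈ (extChartAt (cotModel E) x₀).target) :
    ((extChartAt (cotModel E) x₀).symm y).2 (gradient g h ((extChartAt (cotModel E) x₀).symm y).proj)
      = coordRate g h x₀.proj y := by
  rw [apply_gradient_eq_coordRate g hh ((extChartAt (cotModel E) x₀).map_target hy),
    PartialEquiv.right_inv _ hy]

theorem extChartAt_symm_mem_impactSurface (hh : ContMDiff 𝓘(ℝ, E) 𝓘(ℝ, ℝ) ∞ h)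
    {x₀ : Cotangent E Q} {y : E × (E →L[ℝ] ℝ)} (hy : y ∈ (extChartAt (cotModel E) x₀).target)
    (h0 : h ((extChartAt 𝓘(ℝ, E) x₀.proj).symm y.1) = 0) (hr : coordRate g h x₀.proj y < 0) :
    (extChartAt (cotModel E) x₀).symm y ∈ impactSurface g h :=
  ⟨by rw [proj_extChartAt_symm hy, h0], by rwa [apply_gradient_extChartAt_symm hh hy]⟩

/-- The first alternative serves before the impact, the second after it. -/
theorem extChartAt_symm_notMem_closure (hh : ContMDiff 𝓘(ℝ, E) 𝓘(ℝ, ℝ) ∞ h)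
    {x₀ : Cotangent E Q} {y : E × (E →L[ℝ] ℝ)} (hy : y ∈ (extChartAt (cotModel E) x₀).target)
    (hr : h ((extChartAt 𝓘(ℝ, E) x₀.proj).symm y.1) ≠ 0 ∨ 0 < coordRate g h x₀.proj y) :
    (extChartAt (cotModel E) x₀).symm y ∉ closure (impactSurface g h) := by
  intro hcl
  obtain ⟨h1, h2⟩ := closure_impactSurface_subset g hh hcl
  rw [proj_extChartAt_symm hy] at h1
  rw [apply_gradient_extChartAt_symm hh hy] at h2
  exact hr.elim (fun hr => hr h1) fun hr => hr.not_ge h2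

/-- Along the Hamiltonian flow, `h` has the derivative `p(∇h)`. -/
theorem hasStrictFDerivAt_and_apply_chartField (hV : ContMDiff 𝓘(ℝ, E) 𝓘(ℝ, ℝ) ∞ V)
    (hh : ContMDiff 𝓘(ℝ, E) 𝓘(ℝ, ℝ) ∞ h) {x₀ : Cotangent E Q} {y : E × (E →L[ℝ] ℝ)}
    (hy : y ∈ (extChartAt (cotModel E) x₀).target) :
    HasStrictFDerivAt (fun y : E × (E →L[ℝ] ℝ) => h ((extChartAt 𝓘(ℝ, E) x₀.proj).symm y.1))
      (coordDifferential h x₀.proj y.1 ∘L ContinuousLinearMap.fst ℝ E (E →L[ℝ] ℝ)) y ∧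
    coordDifferential h x₀.proj y.1
      (chartField (hamiltonianVectorField (hamiltonian g V)) x₀ y).1 =
      coordRate g h x₀.proj y := by
  have hy1 := mem_cotangent_target.1 hy
  constructor
  · exact ((contDiffAt_comp_symm hh hy1).hasStrictFDerivAt (by simp)).comp y
      hasStrictFDerivAt_fst
  · rw [chartField_fst g hV hy]
    exact coordSharp_symm g hy1 _ _

/-- `Δ` is given only on `S^*`; this presents it as the restriction of `coordReset`, which is smooth
on a neighbourhood in the chart. -/
theorem IsWeierstrassErdmann.extChartAt_apply {Δ : impactSurface g h → Cotangent E Q}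
    (hΔ : IsWeierstrassErdmann g V h Δ) (hh : ContMDiff 𝓘(ℝ, E) 𝓘(ℝ, ℝ) ∞ h)
    {x₀ : Cotangent E Q} (x : impactSurface g h)
    (hx : x.1 ∈ (extChartAt (cotModel E) x₀).source) :
    Δ x = (extChartAt (cotModel E) x₀).symm
      (coordReset g h x₀.proj (extChartAt (cotModel E) x₀ x.1)) := by
  have hq := mem_cotangent_source.1 hx
  have hs : Δ x ∈ (extChartAt (cotModel E) x₀).source := by
    rw [hΔ.apply_eq x]
    exact mem_cotangent_source.2 hq
  rw [← (extChartAt (cotModel E) x₀).left_inv hs]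
  congr 1
  rw [hΔ.apply_eq x, extChartAt_cotangent_apply, apply_gradient_eq_coordRate g hh hx, gradient,
    apply_sharp_eq g hq, differential_comp_frame hh hq, coordReset]
  refine Prod.ext (by rw [extChartAt_cotangent_apply]) ?_
  rw [← differential_comp_frame hh hq]
  simp only [extChartAt_cotangent_apply]
  rw [← differential_comp_frame hh hq]
  rfl

/-- Trajectories of a natural system meet the impact surface transversally, and are reflected by a
symplectic map. -/
theorem hasRegularImpacts_impactSystem (hV : ContMDiff 𝓘(ℝ, E) 𝓘(ℝ, ℝ) ∞ V)
    (hh : ContMDiff 𝓘(ℝ, E) 𝓘(ℝ, ℝ) ∞ h) {Δ : impactSurface g h → Cotangent E Q}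
    (hΔ : IsWeierstrassErdmann g V h Δ) :
    (impactSystem g V h Δ).HasRegularImpacts (canonicalSymplectic (E := E) (Q := Q)) := by
  have := FiniteDimensional.complete ℝ (E × (E →L[ℝ] ℝ))
  intro y hy
  change y ∈ impactSurface g h at hy
  have hfield := isSymplecticField_hamiltonianVectorField (contMDiff_hamiltonian g hV)
  set e := extChartAt (cotModel E) y with he
  set R := coordReset g h y.proj with hRdef
  set k := fun z : E × (E →L[ℝ] ℝ) => h ((extChartAt 𝓘(ℝ, E) y.proj).symm z.1) with hk
  have hys : y ∈ e.source := mem_extChartAt_source y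
  have hyt : e y ∈ e.target := e.map_source hys
  have hyt1 := mem_cotangent_target.1 hyt
  have hrate : coordRate g h y.proj (e y) < 0 := by
    rw [he, ← apply_gradient_eq_coordRate g hh hys]
    exact hy.2
  have hdiff := coordDifferential_ne_zero_of_coordRate hrate.ne
  have hRt : R (e y) ∈ e.target := mem_cotangent_target.2 hyt1
  have hRrate : 0 < coordRate g h y.proj (R (e y)) := by
    rw [hRdef, coordRate_coordReset g h hyt1 hdiff]
    linarith
  have hR : HasFDerivAt R (fderiv ℝ R (e y)) (e y) :=
    ((contDiffAt_coordReset g hh hyt1 hdiff).differentiableAt (by simp)).hasFDerivAt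
  have ht : IsOpen e.target := isOpen_extChartAt_target y
  -- Incoming flow box: the rate is negative, so `h` decreases strictly along trajectories.
  have hU : e.target ∩ {z | coordRate g h y.proj z < 0} ∈ 𝓝 (e y) :=
    inter_mem (ht.mem_nhds hyt)
      ((contDiffAt_coordRate g hh hyt1).continuousAt.eventually_lt continuousAt_const hrate)
  -- Outgoing flow box: the rate is positive, so the whole box avoids `closure S^*`.
  have hU' : e.target ∩ {z | 0 < coordRate g h y.proj z} ∈ 𝓝 (R (e y)) :=
    inter_mem (ht.mem_nhds hRt) (continuousAt_const.eventually_lt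
      (contDiffAt_coordRate g hh (y := R (e y)) hyt1).continuousAt hRrate)
  obtain ⟨r, ε, Φ, hΦ⟩ := exists_isLocalFlow (hfield.c2 y _ hyt) hU
  obtain ⟨r', ε', Ψ, hΨ⟩ := exists_isLocalFlow (hfield.c2 y _ hRt) hU'
  have hkd := fun (z : E × (E →L[ℝ] ℝ)) (hz : z ∈ e.target) =>
    hasStrictFDerivAt_and_apply_chartField (g := g) hV hh (x₀ := y) hz
  have hk0 : k (e y) = 0 := by
    have h1 := proj_extChartAt_symm hyt
    rw [← he, e.left_inv hys] at h1
    rw [hk]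
    beta_reduce
    rw [← h1]
    exact hy.1
  obtain ⟨τ, τ', hτ, hτ0, hττ, hkτ⟩ := hΦ.exists_hitting_time (hkd _ hyt).1 hk0
    ((hkd _ hyt).2.trans_lt hrate).ne
  have hJ := hΦ.hasFDerivAt_impact hR hΨ hτ hτ0
  set ζ := fun z => R (Φ z (τ z)) with hζ
  have hζ0 : ζ (e y) = R (e y) := by rw [hζ]; beta_reduce; rw [hτ0, hΦ.apply_center]
  have hΨ0 : Ψ (ζ (e y)) (-τ (e y)) = R (e y) := by rw [hζ0, hτ0, neg_zero, hΨ.apply_center]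
  have hΔR : Δ ⟨y, hy⟩ = e.symm (R (e y)) := hΔ.extChartAt_apply hh ⟨y, hy⟩ hys
  refine ⟨fun z => e.symm (Ψ (ζ (e z)) (-τ (e z))), (congrArg e.symm hΨ0).trans hΔR.symm,
    hfield.locallyConst.preservesAt hys hJ (by rw [hΨ0]; exact hRt)
      (stdSymplectic_compContinuousLinearMap_eq (bilin_impact_eq (fun u v => by simp)
        (fun u v => stdBilin_fderiv_coordReset g hh hyt1 hdiff) (fun u => ?_) hττ))
      (Eventually.of_forall fun _ => rfl), min ε (ε' / 2), lt_min hΦ.eps_pos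
        (half_pos hΨ.eps_pos), fun η hη => ?_⟩
  · rw [stdBilin_chartField_hamiltonian g hV hyt, stdBilin_chartField_hamiltonian g hV hRt]
    exact fderiv_coordHamiltonian_coordReset g hV hh hyt1 hdiff u
  have hζc : ContinuousAt ζ (e y) := by
    have h1 : ContinuousAt (fun p : _ × ℝ => Φ p.1 p.2) (e y, τ (e y)) := by
      rw [hτ0]
      exact hΦ.strict.continuousAt
    have h2 : ContinuousAt R (Φ (e y) (τ (e y))) := by
      rw [hτ0, hΦ.apply_center]
      exact hR.continuousAt
    exact h2.comp (f := fun z => Φ z (τ z))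
      (h1.comp (f := fun z => (z, τ z)) (continuousAt_id.prodMk hτ.continuousAt))
  -- The outgoing curve is evaluated at `s - τ w` with `|s| ≤ δ` and `|τ w| < δ`, hence the half of
  -- `ε'`.
  set δ := min ε (ε' / 2) with hδ
  have hδpos : 0 < δ := lt_min hΦ.eps_pos (half_pos hΨ.eps_pos)
  have hδε : δ ≤ ε := min_le_left _ _
  have hδε' : δ ≤ ε' / 2 := min_le_right _ _
  have ev : ∀ᶠ w in 𝓝 (e y), w ∈ ball (e y) r ∧ ζ w ∈ ball (R (e y)) r' ∧ |τ w| < min η δ ∧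
      k (Φ w (τ w)) = 0 := by
    have h1 : ∀ᶠ w in 𝓝 (e y), ζ w ∈ ball (R (e y)) r' :=
      hζc (by rw [hζ0]; exact ball_mem_nhds _ hΨ.r_pos)
    have h2 : |τ (e y)| < min η δ := by rw [hτ0, abs_zero]; exact lt_min hη hδpos
    filter_upwards [ball_mem_nhds (e y) hΦ.r_pos, h1,
      hτ.continuousAt.abs.eventually_lt continuousAt_const h2, hkτ] with w a b c d
    exact ⟨a, b, c, d⟩
  filter_upwards [extChartAt_source_mem_nhds (I := cotModel E) y,
    (continuousAt_extChartAt (I := cotModel E) y).eventually ev] with z hz hz'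
  obtain ⟨hzr, hzr', hzτ, hzk⟩ := hz'
  set w := e z with hw
  have hτδ : |τ w| < δ := hzτ.trans_le (min_le_right _ _)
  have hτδ' := abs_lt.1 hτδ
  have hτε : τ w ∈ Icc (-ε) ε := ⟨by linarith, by linarith⟩
  have hmem := hΦ.mem w hzr
  have hmem' := hΨ.mem _ hzr'
  have hit : e.symm (Φ w (τ w)) ∈ impactSurface g h :=
    extChartAt_symm_mem_impactSurface hh (hmem _ hτε).1 hzk (hmem _ hτε).2
  have hanti := hΦ.strictAntiOn (k := k) (fun u hu => by
    have h1 := (hkd u hu.1).1.hasFDerivAt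
    refine ⟨h1.differentiableAt, ?_⟩
    rw [h1.fderiv]
    exact (hkd u hu.1).2.trans_lt hu.2) hzr
  have hsub : ∀ s ∈ Icc (-δ) δ, s ∈ Icc (-ε) ε := fun s hs =>
    ⟨by linarith [hs.1], by linarith [hs.2]⟩
  have hsub' : ∀ s ∈ Icc (-δ) δ, s + -τ w ∈ Icc (-ε') ε' := fun s hs =>
    ⟨by linarith [hs.1], by linarith [hs.2]⟩
  -- The outgoing curve is shifted to pass through the reset point at time `τ w`; its value at time
  -- `0` is then `J z`.
  refine ⟨τ w, fun s => e.symm (Φ w s), fun s => e.symm (Ψ (ζ w) (s + -τ w)), hit,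
    hzτ.trans_le (min_le_left _ _), ?_, ?_, ?_, ?_, ?_, ?_, ?_⟩
  · have h1 : IsMIntegralCurveOn (fun s => e.symm (Φ w s))
        (hamiltonianVectorField (hamiltonian g V)) (Icc (-ε) ε) := fun s hs =>
      hasMFDerivWithinAt_extChartAt_symm_comp (hΦ.deriv w hzr s hs) (hmem s hs).1
    exact h1.mono hsub
  · beta_reduce
    rw [hΦ.init w hzr, hw, e.left_inv hz]
  · intro s hs
    have hsε : s ∈ Icc (-ε) ε := hsub s ⟨hs.1, by linarith [hs.2]⟩
    refine extChartAt_symm_notMem_closure hh (hmem s hsε).1 (Or.inl ?_)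
    -- Strict decrease gives `h > 0` at all times before the hit.
    have h1 := hanti hsε hτε hs.2
    beta_reduce at h1
    rw [hzk] at h1
    exact h1.ne'
  · have h1 : IsMIntegralCurveOn (fun s => e.symm (Ψ (ζ w) s))
        (hamiltonianVectorField (hamiltonian g V)) (Icc (-ε') ε') := fun s hs =>
      hasMFDerivWithinAt_extChartAt_symm_comp (hΨ.deriv _ hzr' s hs) (hmem' s hs).1
    refine (isMIntegralCurveOn_Icc_shift h1 (-τ w)).mono fun s hs => ?_
    have := hsub' s hs
    exact ⟨by linarith [this.1], by linarith [this.2]⟩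
  · beta_reduce
    rw [add_neg_cancel, hΨ.init _ hzr']
    have h1 := hΔ.extChartAt_apply hh ⟨_, hit⟩ (e.map_target (hmem _ hτε).1)
    rw [← he, e.right_inv (hmem _ hτε).1] at h1
    exact h1.symm
  · beta_reduce
    rw [zero_add]
  · intro s hs
    exact extChartAt_symm_notMem_closure hh (hmem' _ (hsub' s hs)).1
      (Or.inr (hmem' _ (hsub' s hs)).2)

end ImpactSystem

/-! ### From preservation at points to hybrid invariance -/

section Invariance

variable {E' : Type*} [NormedAddCommGroup E'] [NormedSpace ℝ E']
  {H' : Type*} [TopologicalSpace H'] {I : ModelWithCorners ℝ E' H'}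
  {M : Type*} [TopologicalSpace M] [ChartedSpace H' M] {ι : Type*}

theorem HybridSystem.isInvariant_of_preservesAt {𝓗 : HybridSystem I M}
    {α : (x : M) → (TangentSpace I x) [⋀^ι]→L[ℝ] ℝ}
    (h : ∀ t x y, 𝓗.Flow t x y → ∃ φ : M → M, PreservesAt α φ x ∧
      ∀ᶠ z in 𝓝 x, 𝓗.Flow t z (φ z)) : 𝓗.IsInvariant α := by
  intro t x y hf
  obtain ⟨φ, ⟨A, hA, hα⟩, hφ⟩ := h t x y hf
  exact ⟨φ, hφ, hA.mdifferentiableAt, by rw [hA.mfderiv, hα]⟩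

end Invariance

end

end HybridImpact


theorem mainTheorem7 {E : Type*} [NormedAddCommGroup E] [NormedSpace ℝ E] [FiniteDimensional ℝ E]
    {Q : Type*} [TopologicalSpace Q] [T2Space Q] [ChartedSpace E Q] [IsManifold 𝓘(ℝ, E) ∞ Q]
    (g : HybridImpact.Metric E Q) (V : Q → ℝ) (hV : ContMDiff 𝓘(ℝ, E) 𝓘(ℝ, ℝ) ∞ V)
    (h : Q → ℝ) (hh : ContMDiff 𝓘(ℝ, E) 𝓘(ℝ, ℝ) ∞ h)
    (hreg : ∀ q, h q = 0 → mfderiv 𝓘(ℝ, E) 𝓘(ℝ, ℝ) h q ≠ 0)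
    (Δ : HybridImpact.impactSurface g h → HybridImpact.Cotangent E Q)
    (hΔ : HybridImpact.IsWeierstrassErdmann g V h Δ) :
    HybridImpact.canonicalSymplectic ∈
        (HybridImpact.impactSystem g V h Δ).invariantForms (Fin 2) ∧
      HybridImpact.liouvillePower (Module.finrank ℝ E) ∈
        (HybridImpact.impactSystem g V h Δ).invariantForms
          (Fin (2 * Module.finrank ℝ E)) := by
  have := FiniteDimensional.complete ℝ (E × (E →L[ℝ] ℝ))
  -- The same local map `φ` serves for `ω` and for its power.
  have hflow : ∀ t x y, (HybridImpact.impactSystem g V h Δ).Flow t x y →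
      ∃ φ, HybridImpact.PreservesAt HybridImpact.canonicalSymplectic φ x ∧
        ∀ᶠ z in 𝓝 x, (HybridImpact.impactSystem g V h Δ).Flow t z (φ z) := by
    intro t x y hf
    obtain ⟨φ, -, hφ, hev⟩ := HybridImpact.HybridSystem.Flow.preservesAlong
      (HybridImpact.isSymplecticField_hamiltonianVectorField
        (HybridImpact.contMDiff_hamiltonian g hV))
      (HybridImpact.hasRegularImpacts_impactSystem hV hh hΔ) hf
    exact ⟨φ, hφ, hev⟩
  refine ⟨⟨HybridImpact.isLocallyConst_canonicalSymplectic.isSmoothForm,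
    HybridImpact.HybridSystem.isInvariant_of_preservesAt hflow⟩,
    (HybridImpact.isLocallyConst_liouvillePower _).isSmoothForm,
    HybridImpact.HybridSystem.isInvariant_of_preservesAt fun t x y hf => ?_⟩
  obtain ⟨φ, hφ, hev⟩ := hflow t x y hf
  exact ⟨φ, hφ.liouvillePower _, hev⟩
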